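/- **Setting.** Let $X_0$ be a complex analytic space, $Y_0\subset X_0$ a closed analytic subspace with ideal sheaf $\mathcal J_{Y_0|X_0}=\ker(\mathcal O_{X_0}\to\mathcal O_{Y_0})$, and $W_0$ a locally free sheaf (of finite rank) on $Y_0$. An *Artin ring* is a local $\mathbb C$-algebra of finite dimension over $\mathbb C$; its maximal ideal is written $\mathfrak m_A$. For data $(X,Y,W)$ consisting of an analytic space, a closed subspace and a locally free sheaf on it, a *framed vector bundle* to $(X,Y,W)$ is a pair $(E,\alpha)$ with $E$ a locally free sheaf on $X$ and $\alpha\colon E|_Y\to W$ an isomorphism. Given a framed vector bundle $(E,\alpha)$ to $(X,Y,W)$ and an Artin ring $A$, a *deformation* of $(E,\alpha)$ over $A$ is a triple $(F,\beta,\psi)$, where $(F,\beta)$ is a framed vector bundle to $(\operatorname{Spec}A\times X,\ \operatorname{Spec}A\times Y,\ p^*W)$, with $p\colon\operatorname{Spec}A\times Y\to Y$ the projection, and $\psi\colon F|_{\{s_0\}\times X}\to E$ is an isomorphism over the closed point $s_0$ of $\operatorname{Spec}A$ such that $\alpha\circ\psi|_{Y}=\beta|_{\{s_0\}\times Y}$.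 An isomorphism $(F,\beta,\psi)\to(F',\beta',\psi')$ is an isomorphism $f\colon F\to F'$ with $\beta'\circ f|_{\operatorname{Spec}A\times Y}=\beta$ and $\psi'\circ f|_{\{s_0\}\times X}=\psi$. Let $\mathrm{Def}(E,\alpha)(A)$ be the set of isomorphism classes of deformations of $(E,\alpha)$ over $A$. The deformation-theoretical tangent space of $(E,\alpha)$ is $\mathrm{Def}(E,\alpha)(\mathbb C[\varepsilon])$, where $\mathbb C[\varepsilon]=\mathbb C[x]/(x^2)$. **Proposition 1.3.** Let $(E_0,\alpha_0)$ be a framed vector bundle to $(X_0,Y_0,W_0)$ with $$\mathrm{Ext}^2_{X_0}(E_0,\ \mathcal J_{Y_0|X_0}\otimes E_0)=0 .$$ Let $R\to\bar R=R/tR$ be a small extension of Artin rings, i.e. a surjection of Artin rings with kernel $tR$ for some $t\in R$ with $t\cdot\mathfrak m_R=0$. Let $(E,\alpha)$ underlie a deformation of $(E_0,\alpha_0)$ over $R$, regarded as a framed vector bundle to $(\operatorname{Spec}R\times X_0,\ \operatorname{Spec}R\times Y_0,\ W)$ with $W$ the pullback of $W_0$. Let $(\bar E,\bar\alpha)$ be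 its restriction to $\operatorname{Spec}\bar R\times X_0$, a framed vector bundle to $(\operatorname{Spec}\bar R\times X_0,\ \operatorname{Spec}\bar R\times Y_0,\ \bar W)$ with $\bar W$ the pullback of $W_0$. Then the natural map between the deformation-theoretical tangent spaces $$\mathrm{Def}(E,\alpha)(\mathbb C[\varepsilon])\longrightarrow\mathrm{Def}(\bar E,\bar\alpha)(\mathbb C[\varepsilon]),$$ given by restriction of deformations along $\operatorname{Spec}\mathbb C[\varepsilon]\times\operatorname{Spec}\bar R\times X_0\to\operatorname{Spec}\mathbb C[\varepsilon]\times\operatorname{Spec}R\times X_0$, is surjective. -/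

import Mathlib

open CategoryTheory Limits TopologicalSpace Opposite AlgebraicGeometry
open scoped TensorProduct

noncomputable section

namespace FramedDef

/-! ### Commutative `ℂ`-algebras: limits are computed on underlying sets -/

def forgetCorepresentable :
    coyoneda.obj (op (CommAlgCat.of ℂ (Polynomial ℂ))) ≅ forget (CommAlgCat.{0} ℂ) :=
  NatIso.ofComponents (fun B =>
    { hom := ↾ fun f => f.hom Polynomial.X
      inv := ↾ fun b => CommAlgCat.ofHom (Polynomial.aeval b)
      hom_inv_id := by
        ext f
        apply CommAlgCat.hom_ext
        apply Polynomial.algHom_ext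
        simp
      inv_hom_id := by
        ext b
        simp }) (by
      intro B B' f
      ext g
      rfl)

instance : PreservesLimitsOfSize.{0, 0} (forget (CommAlgCat.{0} ℂ)) :=
  preservesLimits_of_natIso forgetCorepresentable

instance : ReflectsLimitsOfSize.{0, 0} (forget (CommAlgCat.{0} ℂ)) :=
  reflectsLimits_of_reflectsIsomorphisms

instance : ReflectsLimitsOfSize.{0, 0} (forget CommRingCat.{0}) :=
  reflectsLimits_of_reflectsIsomorphisms

instance : PreservesLimitsOfSize.{0, 0} (forget₂ (CommAlgCat.{0} ℂ) CommRingCat.{0}) :=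
  haveI : PreservesLimitsOfSize.{0, 0}
      (forget₂ (CommAlgCat.{0} ℂ) CommRingCat.{0} ⋙ forget CommRingCat.{0}) :=
    inferInstanceAs (PreservesLimitsOfSize.{0, 0} (forget (CommAlgCat.{0} ℂ)))
  preservesLimits_of_reflects_of_preserves _ (forget CommRingCat.{0})

/-! ### Ringed spaces over `ℂ` and sheaves of modules on them -/

/-- A `ℂ`-ringed space: a topological space with a sheaf of commutative `ℂ`-algebras. Morphisms
are continuous maps `f : X → Y` together with a map of sheaves of `ℂ`-algebras `𝒪_Y → f_* 𝒪_X`. -/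
abbrev CSpace := SheafedSpace.{1, 0, 0} (CommAlgCat.{0} ℂ)

/-- The structure sheaf of a `ℂ`-ringed space, as a presheaf of commutative rings. -/
abbrev commRingPresheaf (X : CSpace) : (Opens X.carrier)ᵒᵖ ⥤ CommRingCat.{0} :=
  X.presheaf ⋙ forget₂ (CommAlgCat.{0} ℂ) CommRingCat.{0}

/-- The structure sheaf of a `ℂ`-ringed space, as a sheaf of rings. -/
def ringSheaf (X : CSpace) : Sheaf (Opens.grothendieckTopology X.carrier) RingCat.{0} :=
  ⟨commRingPresheaf X ⋙ forget₂ CommRingCat.{0} RingCat.{0},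
    ((sheafCompose _ (forget₂ CommRingCat.{0} RingCat.{0})).obj
      ((sheafCompose _ (forget₂ (CommAlgCat.{0} ℂ) CommRingCat.{0})).obj X.sheaf)).property⟩

/-- The abelian category of sheaves of `𝒪_X`-modules. -/
abbrev Mod (X : CSpace) := SheafOfModules.{0} (ringSheaf X)

/-- Ext-groups of `𝒪_X`-modules are formed in the abelian category of all `𝒪_X`-modules. -/
instance (X : CSpace) : HasExt.{1} (Mod X) := HasExt.standard _

/-- The map of sheaves of rings `𝒪_Y → f_* 𝒪_X` underlying a morphism `f : X → Y`. -/
def ringHom {X Y : CSpace} (f : X ⟶ Y) :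
    ringSheaf Y ⟶ ((Opens.map f.hom.base).sheafPushforwardContinuous _ _ _).obj (ringSheaf X) where
  hom := Functor.whiskerRight
    (Functor.whiskerRight f.hom.c (forget₂ (CommAlgCat.{0} ℂ) CommRingCat.{0})) _

/-- The direct image `f_*` of sheaves of modules. -/
def pushforward {X Y : CSpace} (f : X ⟶ Y) : Mod X ⥤ Mod Y :=
  SheafOfModules.pushforward (ringHom f)

instance {X Y : CSpace} (f : X ⟶ Y) :
    (SheafOfModules.pushforward.{0} (ringHom f)).IsRightAdjoint :=
  haveI : (PresheafOfModules.pushforward.{0} (F := Opens.map f.hom.base) (R := (ringSheaf X).obj)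
      (S := (ringSheaf Y).obj) (ringHom f).hom).IsRightAdjoint :=
    Functor.isRightAdjoint_of_leftAdjointObjIsDefined_eq_top
      (PresheafOfModules.pullbackObjIsDefined_eq_top (C := Opens Y.carrier) (D := Opens X.carrier)
        (F := Opens.map f.hom.base) (R := (ringSheaf X).obj) (S := (ringSheaf Y).obj)
        (ringHom f).hom)
  (SheafOfModules.PullbackConstruction.adjunction.{0} (ringHom f)).isRightAdjoint

/-- The inverse image (pullback, restriction) `f^*` of sheaves of modules. -/
def pullback {X Y : CSpace} (f : X ⟶ Y) : Mod Y ⥤ Mod X :=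
  SheafOfModules.pullback (ringHom f)

/-- The inverse image is left adjoint to the direct image. -/
def pullbackAdj {X Y : CSpace} (f : X ⟶ Y) : pullback f ⊣ pushforward f :=
  SheafOfModules.pullbackPushforwardAdjunction _

/-- Sections of a sheaf of modules over an open set. -/
abbrev Sec {X : CSpace} (E : Mod X) (U : Opens X.carrier) := E.val.obj (op U)

/-- Sections of the structure sheaf over an open set. -/
abbrev Fn (X : CSpace) (U : Opens X.carrier) := (ringSheaf X).obj.obj (op U)

/-- Restriction of sections of a sheaf of modules to a smaller open set. -/
def res {X : CSpace} (E : Mod X) {U V : Opens X.carrier} (h : V ≤ U) (x : Sec E U) : Sec E V :=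
  E.val.map (homOfLE h).op x

/-- Sections `e₁, …, eₙ` of `E` over `U` form a basis of `E|_U`: over every open `V ⊆ U`, every
section of `E` is a unique linear combination of their restrictions. Equivalently, they define an
isomorphism from `𝒪_U^n` to `E|_U`. -/
def IsLocalBasis {X : CSpace} (E : Mod X) (U : Opens X.carrier) {n : ℕ} (e : Fin n → Sec E U) :
    Prop :=
  ∀ (V : Opens X.carrier) (h : V ≤ U),
    Function.Bijective (fun c : Fin n → Fn X V => ∑ i, c i • res E h (e i))

/-- Locally free sheaves of modules (of finite, locally constant rank), i.e. vector bundles. -/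
def IsLocallyFree {X : CSpace} (E : Mod X) : Prop :=
  ∀ x : X.carrier, ∃ U : Opens X.carrier, x ∈ U ∧
    ∃ (n : ℕ) (e : Fin n → Sec E U), IsLocalBasis E U e

/-- The tensor product of two sheaves of modules: the sheafification of the presheaf
`U ↦ E(U) ⊗ F(U)`. -/
def tensor {X : CSpace} (E F : Mod X) : Mod X :=
  (PresheafOfModules.sheafification (𝟙 (ringSheaf X).obj)).obj
    (PresheafOfModules.Monoidal.tensorObj (R := commRingPresheaf X) E.val F.val)

/-- The ideal sheaf of a closed subspace `i : Y → X`: the kernel of `𝒪_X → i_* 𝒪_Y`. -/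
def idealSheaf {X Y : CSpace} (i : Y ⟶ X) : Mod X :=
  kernel (SheafOfModules.unitToPushforwardObjUnit (ringHom i))

/-! ### Analytic spaces -/

/-- `i : Y → X` is a closed immersion: topologically a closed embedding, and `𝒪_X → i_* 𝒪_Y` is an
epimorphism of sheaves. -/
def IsClosedImmersion {X Y : CSpace} (i : Y ⟶ X) : Prop :=
  Topology.IsClosedEmbedding i.hom.base ∧
    ∀ (U : Opens X.carrier) (s : Y.presheaf.obj (op ((Opens.map i.hom.base).obj U))),
      ∀ x ∈ U, ∃ (V : Opens X.carrier) (h : V ≤ U), x ∈ V ∧ ∃ r : X.presheaf.obj (op V),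
        i.hom.c.app (op V) r = Y.presheaf.map ((Opens.map i.hom.base).map (homOfLE h)).op s

/-- The algebra of holomorphic functions on an open subset of `ℂⁿ`. -/
def holomorphic (n : ℕ) (U : Opens (TopCat.of (Fin n → ℂ))) : Subalgebra ℂ (U → ℂ) where
  carrier := {f | ∃ g : (Fin n → ℂ) → ℂ, DifferentiableOn ℂ g (U : Set (Fin n → ℂ)) ∧
    ∀ z : U, f z = g z.1}
  mul_mem' := by
    rintro f₁ f₂ ⟨g₁, h₁, e₁⟩ ⟨g₂, h₂, e₂⟩
    exact ⟨g₁ * g₂, h₁.mul h₂, fun z => by simp [e₁, e₂]⟩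
  add_mem' := by
    rintro f₁ f₂ ⟨g₁, h₁, e₁⟩ ⟨g₂, h₂, e₂⟩
    exact ⟨g₁ + g₂, h₁.add h₂, fun z => by simp [e₁, e₂]⟩
  algebraMap_mem' c := ⟨fun _ => c, differentiableOn_const c, fun _ => rfl⟩

/-- Restriction of holomorphic functions. -/
def holomorphicRestrict (n : ℕ) {U V : Opens (TopCat.of (Fin n → ℂ))} (h : V ≤ U) :
    holomorphic n U →ₐ[ℂ] holomorphic n V where
  toFun f := ⟨fun z => f.1 ⟨z.1, h z.2⟩, by
    obtain ⟨g, hg, e⟩ := f.2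
    exact ⟨g, hg.mono h, fun z => e _⟩⟩
  map_one' := rfl
  map_mul' _ _ := rfl
  map_zero' := rfl
  map_add' _ _ := rfl
  commutes' _ := rfl

/-- The presheaf of holomorphic functions on `ℂⁿ`. -/
def holomorphicPresheaf (n : ℕ) : TopCat.Presheaf (CommAlgCat.{0} ℂ) (TopCat.of (Fin n → ℂ)) where
  obj U := CommAlgCat.of ℂ (holomorphic n U.unop)
  map f := CommAlgCat.ofHom (holomorphicRestrict n f.unop.le)
  map_id _ := rfl
  map_comp _ _ := rfl

theorem holomorphicPresheaf_isSheaf (n : ℕ) : (holomorphicPresheaf n).IsSheaf := by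
  rw [TopCat.Presheaf.isSheaf_iff_isSheaf_comp (forget (CommAlgCat.{0} ℂ))]
  let P : TopCat.LocalPredicate (X := TopCat.of (Fin n → ℂ)) (fun _ => ℂ) :=
    { pred := fun {U} f => f ∈ holomorphic n U
      res := by
        rintro U V i f ⟨g, hg, e⟩
        exact ⟨g, hg.mono i.le, fun z => e _⟩
      locality := by
        classical
        intro U f H
        refine ⟨fun z => if h : z ∈ U then f ⟨z, h⟩ else 0, fun z hz => ?_, fun z => ?_⟩
        · obtain ⟨V, hzV, i, g, hg, e⟩ := H ⟨z, hz⟩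
          have hd : DifferentiableAt ℂ g z :=
            (hg z hzV).differentiableAt (V.isOpen.mem_nhds hzV)
          refine (hd.congr_of_eventuallyEq ?_).differentiableWithinAt
          filter_upwards [V.isOpen.mem_nhds hzV] with w hw
          have hwU : w ∈ U := i.le hw
          have := e ⟨w, hw⟩
          simp only [hwU, dif_pos]
          exact this
        · have : z.1 ∈ U := z.2
          simp [this] }
  refine TopCat.Presheaf.isSheaf_of_iso ?_ (TopCat.subsheafToTypes P).2
  exact NatIso.ofComponents (fun U => Iso.refl _) (by intros; rfl)

/-- Complex affine space `ℂⁿ` with its sheaf of holomorphic functions. -/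
def affineSpace (n : ℕ) : CSpace where
  carrier := TopCat.of (Fin n → ℂ)
  presheaf := holomorphicPresheaf n
  IsSheaf := holomorphicPresheaf_isSheaf n

/-- The open subspace of a `ℂ`-ringed space on an open subset. -/
def openSubspace (X : CSpace) (U : Opens X.carrier) : CSpace :=
  X.restrict U.isOpenEmbedding

/-- An open subset `D ⊆ ℂⁿ` with its sheaf of holomorphic functions. -/
abbrev domain (n : ℕ) (D : Opens (affineSpace n).carrier) : CSpace :=
  openSubspace (affineSpace n) D

/-- The value at a point of a holomorphic function on `D`. -/
def evalAt {n : ℕ} {D : Opens (affineSpace n).carrier} (f : (domain n D).presheaf.obj (op ⊤))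
    (z : (domain n D).carrier) : ℂ :=
  (show holomorphic n (D.isOpenEmbedding.isOpenMap.functor.obj ⊤) from f).1
    ⟨z.1, ⟨z, trivial, rfl⟩⟩

/-- (Complex) analytic spaces: Hausdorff `ℂ`-ringed spaces which are locally isomorphic to the
zero locus of finitely many holomorphic functions `f₁, …, f_k` on an open set `D ⊆ ℂⁿ`, with
structure sheaf `𝒪_D / (f₁, …, f_k)`. The local isomorphism is expressed as a closed immersion
into `D` with image the zero locus and with ideal sheaf `(f₁, …, f_k)`. -/
def IsAnalyticSpace (X : CSpace) : Prop :=
  T2Space X.carrier ∧ ∀ x : X.carrier, ∃ U : Opens X.carrier, x ∈ U ∧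
    ∃ (n : ℕ) (D : Opens (affineSpace n).carrier) (j : openSubspace X U ⟶ domain n D)
      (k : ℕ) (f : Fin k → (domain n D).presheaf.obj (op ⊤)),
      IsClosedImmersion j ∧
      (∀ z : (domain n D).carrier, z ∈ Set.range j.hom.base ↔ ∀ m, evalAt (f m) z = 0) ∧
      ∀ (V : Opens (domain n D).carrier) (g : (domain n D).presheaf.obj (op V)),
        j.hom.c.app (op V) g = 0 ↔
          ∀ z ∈ V, ∃ (V' : Opens (domain n D).carrier) (h : V' ≤ V), z ∈ V' ∧
            ∃ a : Fin k → (domain n D).presheaf.obj (op V'),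
              (domain n D).presheaf.map (homOfLE h).op g =
                ∑ m, a m * (domain n D).presheaf.map (homOfLE le_top).op (f m)

/-! ### Products with `Spec A` for a finite-dimensional algebra `A` -/

/-- The functor `B ↦ A ⊗_ℂ B` on commutative `ℂ`-algebras. -/
def tensorFunctor (A : Type) [CommRing A] [Algebra ℂ A] :
    CommAlgCat.{0} ℂ ⥤ CommAlgCat.{0} ℂ where
  obj B := CommAlgCat.of ℂ (A ⊗[ℂ] B)
  map f := CommAlgCat.ofHom (Algebra.TensorProduct.map (AlgHom.id ℂ A) f.hom)
  map_id B := by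
    apply CommAlgCat.hom_ext
    exact Algebra.TensorProduct.map_id
  map_comp f g := by
    apply CommAlgCat.hom_ext
    apply Algebra.TensorProduct.ext'
    intro a b
    rfl

/-- Coordinates with respect to a basis of `A`. -/
def tensorCoord (A : Type) [CommRing A] [Algebra ℂ A] [Module.Finite ℂ A] (B : CommAlgCat.{0} ℂ) :
    (A ⊗[ℂ] B) ≃ (Fin (Module.finrank ℂ A) → B) :=
  (TensorProduct.equivFinsuppOfBasisLeft (N := B) (Module.finBasis ℂ A)).toEquiv.trans
    Finsupp.equivFunOnFinite

theorem tensorCoord_map (A : Type) [CommRing A] [Algebra ℂ A] [Module.Finite ℂ A]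
    {B B' : CommAlgCat.{0} ℂ} (f : B ⟶ B') (x : A ⊗[ℂ] B) (i : Fin (Module.finrank ℂ A)) :
    tensorCoord A B' (Algebra.TensorProduct.map (AlgHom.id ℂ A) f.hom x) i =
      f.hom (tensorCoord A B x i) := by
  induction x using TensorProduct.induction_on with
  | zero => simp [tensorCoord]
  | tmul a b => simp [tensorCoord]
  | add x y hx hy =>
    simp only [tensorCoord, LinearEquiv.coe_toEquiv, Equiv.trans_apply,
      Finsupp.equivFunOnFinite_apply, map_add, Finsupp.add_apply] at hx hy ⊢
    rw [hx, hy]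

def tensorForgetIso (A : Type) [CommRing A] [Algebra ℂ A] [Module.Finite ℂ A] :
    tensorFunctor A ⋙ forget (CommAlgCat.{0} ℂ) ≅
      forget (CommAlgCat.{0} ℂ) ⋙ coyoneda.obj (op (Fin (Module.finrank ℂ A))) :=
  NatIso.ofComponents (fun B =>
    { hom := ↾ fun (x : A ⊗[ℂ] B) => ↾ (tensorCoord A B x)
      inv := ↾ fun (c : Fin (Module.finrank ℂ A) ⟶ (B : Type)) =>
        ((tensorCoord A B).symm (ConcreteCategory.hom c) : A ⊗[ℂ] B)
      hom_inv_id := by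
        ext x
        exact (tensorCoord A B).symm_apply_apply x
      inv_hom_id := by
        ext c
        apply ConcreteCategory.hom_ext
        intro i
        exact congrFun ((tensorCoord A B).apply_symm_apply (ConcreteCategory.hom c)) i }) (by
      intro B B' f
      ext x
      apply ConcreteCategory.hom_ext
      intro i
      exact tensorCoord_map A f x i)

instance (A : Type) [CommRing A] [Algebra ℂ A] [Module.Finite ℂ A] :
    PreservesLimitsOfSize.{0, 0} (tensorFunctor A) :=
  haveI : PreservesLimitsOfSize.{0, 0} (tensorFunctor A ⋙ forget (CommAlgCat.{0} ℂ)) :=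
    preservesLimits_of_natIso (tensorForgetIso A).symm
  preservesLimits_of_reflects_of_preserves _ (forget (CommAlgCat.{0} ℂ))

theorem homMk_ext {X Y : CSpace} {b : X.carrier ⟶ Y.carrier}
    {c c' : Y.presheaf ⟶ (TopCat.Presheaf.pushforward _ b).obj X.presheaf}
    (h : ∀ U (s : Y.presheaf.obj U), (c.app U).hom s = (c'.app U).hom s) :
    (InducedCategory.homMk (PresheafedSpace.Hom.mk b c) : X ⟶ Y) =
      InducedCategory.homMk (PresheafedSpace.Hom.mk b c') := by
  have : c = c' := NatTrans.ext (funext fun U => CommAlgCat.hom_ext (AlgHom.ext (h U)))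
  rw [this]

section Thicken

variable (A : Type) [CommRing A] [Algebra ℂ A] [Module.Finite ℂ A]
variable (A' : Type) [CommRing A'] [Algebra ℂ A'] [Module.Finite ℂ A']

/-- The product `Spec A × X` for a local finite-dimensional `ℂ`-algebra `A`: as `Spec A` is a point
with structure ring `A`, this is the space `X` with the structure sheaf `U ↦ A ⊗_ℂ 𝒪_X(U)`. -/
def thicken (X : CSpace) : CSpace where
  carrier := X.carrier
  presheaf := X.presheaf ⋙ tensorFunctor A
  IsSheaf := ((sheafCompose _ (tensorFunctor A)).obj X.sheaf).property

variable {A A'}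

/-- The morphism `Spec A' × X → Spec A × Y` induced by `φ : A → A'` and `f : X → Y`. -/
def thickenMap (φ : A →ₐ[ℂ] A') {X Y : CSpace} (f : X ⟶ Y) : thicken A' X ⟶ thicken A Y :=
  InducedCategory.homMk
    { base := f.hom.base
      c :=
        { app := fun U => CommAlgCat.ofHom (Algebra.TensorProduct.map φ (f.hom.c.app U).hom)
          naturality := by
            intro U V h
            apply CommAlgCat.hom_ext
            apply Algebra.TensorProduct.ext'
            intro a b
            have := ConcreteCategory.congr_hom (f.hom.c.naturality h) b
            exact congrArg (fun z => φ a ⊗ₜ[ℂ] z) this } }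

variable (A)

/-- The projection `Spec A × X → X`. -/
def thickenProj (X : CSpace) : thicken A X ⟶ X :=
  InducedCategory.homMk
    { base := 𝟙 X.carrier
      c :=
        { app := fun U => CommAlgCat.ofHom Algebra.TensorProduct.includeRight
          naturality := by
            intro U V h
            rfl } }

/-- For a local finite-dimensional `ℂ`-algebra `A`, the quotient map `A → A / m_A = ℂ`. -/
def residueHom [IsLocalRing A] : A →ₐ[ℂ] ℂ :=
  ((AlgEquiv.ofBijective (Algebra.ofId ℂ (IsLocalRing.ResidueField A))
    IsAlgClosed.algebraMap_bijective_of_isIntegral).symm : IsLocalRing.ResidueField A →ₐ[ℂ] ℂ).comp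
    (IsScalarTower.toAlgHom ℂ A (IsLocalRing.ResidueField A))

/-- The map `A ⊗ B → (A / m_A) ⊗ B = B`. -/
def reduceHom [IsLocalRing A] (B : Type) [CommRing B] [Algebra ℂ B] : A ⊗[ℂ] B →ₐ[ℂ] B :=
  Algebra.TensorProduct.lift ((Algebra.ofId ℂ B).comp (residueHom A)) (AlgHom.id ℂ B)
    (fun _ _ => Commute.all _ _)

theorem reduceHom_tmul [IsLocalRing A] (B : Type) [CommRing B] [Algebra ℂ B] (a : A) (b : B) :
    reduceHom A B (a ⊗ₜ b) = algebraMap ℂ B (residueHom A a) * b := rfl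

theorem reduceHom_map [IsLocalRing A] {B B' : Type} [CommRing B] [Algebra ℂ B] [CommRing B']
    [Algebra ℂ B'] (f : B →ₐ[ℂ] B') (x : A ⊗[ℂ] B) :
    reduceHom A B' (Algebra.TensorProduct.map (AlgHom.id ℂ A) f x) = f (reduceHom A B x) := by
  induction x using TensorProduct.induction_on with
  | zero => simp
  | tmul a b => simp [reduceHom_tmul]
  | add x y hx hy => simp only [map_add, hx, hy]

/-- The inclusion `X = {s₀} × X → Spec A × X` of the fibre over the closed point `s₀ ∈ Spec A`. -/
def closedFibre [IsLocalRing A] (X : CSpace) : X ⟶ thicken A X :=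
  InducedCategory.homMk
    { base := 𝟙 X.carrier
      c :=
        { app := fun U => CommAlgCat.ofHom (reduceHom A (X.presheaf.obj U))
          naturality := by
            intro U V h
            apply CommAlgCat.hom_ext
            apply AlgHom.ext
            intro x
            exact reduceHom_map A (X.presheaf.map h).hom x } }

theorem closedFibre_thickenMap [IsLocalRing A] {X Y : CSpace} (f : X ⟶ Y) :
    closedFibre A X ≫ thickenMap (.id _ A) f = f ≫ closedFibre A Y :=
  homMk_ext (Y := thicken A Y) (b := f.hom.base) (c := (closedFibre A X ≫ thickenMap (.id _ A) f).hom.c)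
    (c' := (f ≫ closedFibre A Y).hom.c) fun U x => reduceHom_map A (f.hom.c.app U).hom x

theorem closedFibre_thickenProj [IsLocalRing A] (X : CSpace) :
    closedFibre A X ≫ thickenProj A X = 𝟙 X :=
  homMk_ext (b := 𝟙 X.carrier) (c := (closedFibre A X ≫ thickenProj A X).hom.c)
    (c' := (𝟙 X : X ⟶ X).hom.c) fun U (x : X.presheaf.obj U) => by
      change reduceHom A (X.presheaf.obj U) (1 ⊗ₜ x) = x
      rw [reduceHom_tmul, map_one, map_one, one_mul]

theorem thickenMap_thickenProj (φ : A →ₐ[ℂ] A') {X Y : CSpace} (f : X ⟶ Y) :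
    thickenMap φ f ≫ thickenProj A Y = thickenProj A' X ≫ f :=
  homMk_ext (X := thicken A' X) (b := f.hom.base) (c := (thickenMap φ f ≫ thickenProj A Y).hom.c)
    (c' := (thickenProj A' X ≫ f).hom.c) fun U (x : Y.presheaf.obj U) => by
      change Algebra.TensorProduct.map φ (f.hom.c.app U).hom (1 ⊗ₜ x) =
        1 ⊗ₜ[ℂ] (f.hom.c.app U).hom x
      rw [Algebra.TensorProduct.map_tmul, map_one]

theorem thickenMap_comp {A₁ A₂ A₃ : Type} [CommRing A₁] [Algebra ℂ A₁] [Module.Finite ℂ A₁]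
    [CommRing A₂] [Algebra ℂ A₂] [Module.Finite ℂ A₂] [CommRing A₃] [Algebra ℂ A₃]
    [Module.Finite ℂ A₃] (φ : A₁ →ₐ[ℂ] A₂) (ψ : A₂ →ₐ[ℂ] A₃) {X Y Z : CSpace} (f : X ⟶ Y)
    (g : Y ⟶ Z) : thickenMap ψ f ≫ thickenMap φ g = thickenMap (ψ.comp φ) (f ≫ g) :=
  homMk_ext (X := thicken A₃ X) (Y := thicken A₁ Z) (b := f.hom.base ≫ g.hom.base)
    (c := (thickenMap ψ f ≫ thickenMap φ g).hom.c)
    (c' := (thickenMap (ψ.comp φ) (f ≫ g)).hom.c) fun U (x : A₁ ⊗[ℂ] Z.presheaf.obj U) => by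
      have key : (Algebra.TensorProduct.map ψ
            (f.hom.c.app (op ((Opens.map g.hom.base).obj U.unop))).hom).comp
          (Algebra.TensorProduct.map φ (g.hom.c.app U).hom) =
          Algebra.TensorProduct.map (ψ.comp φ) ((f ≫ g).hom.c.app U).hom :=
        Algebra.TensorProduct.ext' fun a b => rfl
      exact AlgHom.congr_fun key x

end Thicken

instance : Module.Finite ℂ (DualNumber ℂ) :=
  inferInstanceAs (Module.Finite ℂ (ℂ × ℂ))

/-! ### Spaces with a sheaf of modules -/

/-- A pair `(X, E)` of a `ℂ`-ringed space and an `𝒪_X`-module. -/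
structure ModSpace where
  space : CSpace
  mod : Mod space

/-- A morphism `(X, E) → (Y, F)`: a morphism `f : X → Y` together with a map of `𝒪_Y`-modules
`F → f_* E`, i.e. by adjunction a map `f^* F → E`. -/
@[ext]
structure ModSpace.Hom (P Q : ModSpace) where
  base : P.space ⟶ Q.space
  map : Q.mod ⟶ (pushforward base).obj P.mod

instance : Category ModSpace where
  Hom := ModSpace.Hom
  id P := ⟨𝟙 P.space, 𝟙 P.mod⟩
  comp f g := ⟨f.base ≫ g.base, g.map ≫ (pushforward g.base).map f.map⟩
  id_comp _ := rfl
  comp_id _ := rfl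
  assoc _ _ _ := rfl

/-- The morphism `(X, f^* F) → (Y, F)`. -/
def ModSpace.pull {X Y : CSpace} (f : X ⟶ Y) (F : Mod Y) :
    (⟨X, (pullback f).obj F⟩ : ModSpace) ⟶ ⟨Y, F⟩ :=
  ⟨f, (pullbackAdj f).unit.app F⟩

/-- The morphism `(X, E) → (Y, F)` corresponding to a morphism `f : X → Y` and a map
`u : f^* F → E`. -/
def ModSpace.ofPullback {X Y : CSpace} (f : X ⟶ Y) {E : Mod X} {F : Mod Y}
    (u : (pullback f).obj F ⟶ E) : (⟨X, E⟩ : ModSpace) ⟶ ⟨Y, F⟩ :=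
  ⟨f, (pullbackAdj f).homEquiv F E u⟩

/-- The map `f^* F → E` corresponding to a morphism `(X, E) → (Y, F)` over `f`. -/
def ModSpace.Hom.toPullback {P Q : ModSpace} (f : P ⟶ Q) : (pullback f.base).obj Q.mod ⟶ P.mod :=
  ((pullbackAdj f.base).homEquiv Q.mod P.mod).symm f.map

/-- A morphism `(X, E) → (Y, F)` over `f : X → Y` is cartesian if it exhibits `E` as the
restriction `f^* F`. -/
def ModSpace.Hom.IsCartesian {P Q : ModSpace} (f : P ⟶ Q) : Prop :=
  IsIso f.toPullback

namespace ModSpace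

theorem isCartesian_iff_bijective {P Q : ModSpace} (f : P ⟶ Q) :
    Hom.IsCartesian f ↔ ∀ N : Mod P.space,
      Function.Bijective (fun g : P.mod ⟶ N => f.map ≫ (pushforward f.base).map g) := by
  have key : ∀ N : Mod P.space,
      (fun g : P.mod ⟶ N => f.map ≫ (pushforward f.base).map g) =
        (pullbackAdj f.base).homEquiv Q.mod N ∘ (fun g => Hom.toPullback f ≫ g) := by
    intro N
    funext g
    simp [Hom.toPullback, Adjunction.homEquiv_naturality_right]
  constructor
  · intro hf N
    have : IsIso (Hom.toPullback f) := hf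
    rw [key]
    exact (Equiv.bijective _).comp
      ⟨fun a b h => (cancel_epi _).1 h, fun b => ⟨inv (Hom.toPullback f) ≫ b, by simp⟩⟩
  · intro hf
    have hb : ∀ N, Function.Bijective (fun g : P.mod ⟶ N => Hom.toPullback f ≫ g) := by
      intro N
      have := hf N
      rw [key] at this
      exact (Equiv.comp_bijective _ _).1 this
    obtain ⟨r, hr⟩ := (hb _).2 (𝟙 _)
    refine ⟨r, hr, (hb _).1 ?_⟩
    change Hom.toPullback f ≫ r = 𝟙 _ at hr
    simp only
    rw [← Category.assoc, hr, Category.id_comp, Category.comp_id]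

theorem Hom.IsCartesian.bijective {P Q : ModSpace} {f : P ⟶ Q} (hf : Hom.IsCartesian f)
    (N : Mod P.space) :
    Function.Bijective (fun g : P.mod ⟶ N => f.map ≫ (pushforward f.base).map g) :=
  (isCartesian_iff_bijective f).1 hf N

theorem Hom.IsCartesian.hom_ext {P Q T : ModSpace} {f : P ⟶ Q} (hf : Hom.IsCartesian f)
    {g h : T ⟶ P} (hb : g.base = h.base) (hgh : g ≫ f = h ≫ f) : g = h := by
  obtain ⟨gb, gm⟩ := g
  obtain ⟨hb', hm⟩ := h
  obtain rfl : gb = hb' := hb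
  have h1 : f.map ≫ (pushforward f.base).map gm = f.map ≫ (pushforward f.base).map hm := by
    have h2 : (⟨gb ≫ f.base, f.map ≫ (pushforward f.base).map gm⟩ : ModSpace.Hom T Q) =
      ⟨gb ≫ f.base, f.map ≫ (pushforward f.base).map hm⟩ := hgh
    injection h2
  rw [(hf.bijective _).1 h1]

/-- The morphism induced on a restriction: a morphism `T → Q` whose base factors through the
base of a cartesian morphism `P → Q` factors uniquely through `P → Q`. -/
def lift {P Q T : ModSpace} {f : P ⟶ Q} (hf : Hom.IsCartesian f) (g : T ⟶ Q)
    (h : T.space ⟶ P.space) (hg : h ≫ f.base = g.base) : T ⟶ P :=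
  haveI : IsIso (Hom.toPullback f) := hf
  ⟨h, inv (Hom.toPullback f) ≫ ((pullbackAdj f.base).homEquiv Q.mod _).symm
    (g.map ≫ eqToHom (by rw [← hg]; rfl))⟩

theorem lift_comp {P Q T : ModSpace} {f : P ⟶ Q} (hf : Hom.IsCartesian f) (g : T ⟶ Q)
    (h : T.space ⟶ P.space) (hg : h ≫ f.base = g.base) : lift hf g h hg ≫ f = g := by
  obtain ⟨gb, gm⟩ := g
  obtain rfl : h ≫ f.base = gb := hg
  have : IsIso (Hom.toPullback f) := hf
  refine ModSpace.Hom.ext rfl (heq_of_eq ?_)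
  let gm' : Q.mod ⟶ (pushforward f.base).obj ((pushforward h).obj T.mod) := gm
  change f.map ≫ (pushforward f.base).map (inv (Hom.toPullback f) ≫
    ((pullbackAdj f.base).homEquiv Q.mod ((pushforward h).obj T.mod)).symm (gm' ≫ 𝟙 _)) = gm'
  have h1 : f.map = (pullbackAdj f.base).homEquiv Q.mod P.mod (Hom.toPullback f) := by
    simp [Hom.toPullback]
  conv_lhs => arg 1; rw [h1]
  rw [← Adjunction.homEquiv_naturality_right, IsIso.hom_inv_id_assoc, Equiv.apply_symm_apply]
  exact Category.comp_id gm'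

@[simp]
theorem lift_base {P Q T : ModSpace} {f : P ⟶ Q} (hf : Hom.IsCartesian f) (g : T ⟶ Q)
    (h : T.space ⟶ P.space) (hg : h ≫ f.base = g.base) : (lift hf g h hg).base = h := rfl

theorem isCartesian_comp {P Q T : ModSpace} {f : P ⟶ Q} {g : Q ⟶ T} (hf : Hom.IsCartesian f)
    (hg : Hom.IsCartesian g) : Hom.IsCartesian (f ≫ g) := by
  rw [isCartesian_iff_bijective]
  intro N
  exact (hg.bijective ((pushforward f.base).obj N)).comp (hf.bijective N)

theorem isCartesian_of_comp {P Q T : ModSpace} {f : P ⟶ Q} {g : Q ⟶ T}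
    (hg : Hom.IsCartesian g) (hfg : Hom.IsCartesian (f ≫ g)) : Hom.IsCartesian f := by
  rw [isCartesian_iff_bijective]
  intro N
  refine (Function.Bijective.of_comp_iff' (hg.bijective ((pushforward f.base).obj N)) _).1 ?_
  exact hfg.bijective N

theorem isCartesian_ofPullback {X Y : CSpace} (f : X ⟶ Y) {E : Mod X} {F : Mod Y}
    (u : (pullback f).obj F ⟶ E) [IsIso u] : Hom.IsCartesian (ofPullback f u) := by
  have : Hom.toPullback (ofPullback f u) = u := Equiv.symm_apply_apply _ _
  unfold Hom.IsCartesian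
  rw [this]
  exact ‹IsIso u›

theorem isCartesian_pull {X Y : CSpace} (f : X ⟶ Y) (F : Mod Y) :
    Hom.IsCartesian (pull f F) := by
  have : Hom.toPullback (pull f F) = 𝟙 _ := by
    exact (Equiv.symm_apply_eq _).2 ((pullbackAdj f).homEquiv_id F).symm
  unfold Hom.IsCartesian
  rw [this]
  exact IsIso.id _

/-- A cartesian morphism `(X, E) → (Y, F)` over `f` as an isomorphism `f^* F ≅ E`. -/
def Hom.IsCartesian.iso {P Q : ModSpace} {f : P ⟶ Q} (hf : Hom.IsCartesian f) :
    (pullback f.base).obj Q.mod ≅ P.mod :=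
  haveI : IsIso (Hom.toPullback f) := hf
  asIso (Hom.toPullback f)

theorem ofPullback_iso {P Q : ModSpace} {f : P ⟶ Q} (hf : Hom.IsCartesian f) :
    ofPullback f.base hf.iso.hom = f := by
  refine ModSpace.Hom.ext rfl (heq_of_eq ?_)
  exact Equiv.apply_symm_apply _ _

end ModSpace


/-! ### Restrictions of locally free sheaves are locally free -/

/-- Restriction of sections of the structure sheaf. -/
def resFn {X : CSpace} {U V : Opens X.carrier} (h : V ≤ U) : Fn X U →+* Fn X V :=
  ((ringSheaf X).obj.map (homOfLE h).op).hom

/-- Pullback of sections of the structure sheaf along a morphism. -/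
def pullFn {X Y : CSpace} (f : X ⟶ Y) (U : Opens Y.carrier) :
    Fn Y U →+* Fn X ((Opens.map f.hom.base).obj U) :=
  ((ringHom f).hom.app (op U)).hom

section Sections

variable {X Y : CSpace}

theorem res_add (E : Mod X) {U V : Opens X.carrier} (h : V ≤ U) (x y : Sec E U) :
    res E h (x + y) = res E h x + res E h y :=
  map_add (E.val.restrictₛₗ (homOfLE h).op) x y

theorem res_sum (E : Mod X) {U V : Opens X.carrier} (h : V ≤ U) {n : ℕ} (x : Fin n → Sec E U) :
    res E h (∑ i, x i) = ∑ i, res E h (x i) :=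
  map_sum (E.val.restrictₛₗ (homOfLE h).op) x _

theorem res_smul (E : Mod X) {U V : Opens X.carrier} (h : V ≤ U) (r : Fn X U) (x : Sec E U) :
    res E h (r • x) = resFn h r • res E h x :=
  E.val.map_smul (homOfLE h).op r x

theorem res_res (E : Mod X) {U V W : Opens X.carrier} (h : V ≤ U) (h' : W ≤ V) (x : Sec E U) :
    res E h' (res E h x) = res E (h'.trans h) x :=
  (E.val.map_comp_apply (homOfLE h).op (homOfLE h').op x).symm

theorem res_self (E : Mod X) {U : Opens X.carrier} (h : U ≤ U) (x : Sec E U) :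
    res E h x = x := by
  change E.val.map (𝟙 (op U)) x = x
  rw [E.val.map_id]
  rfl

theorem resFn_resFn {U V W : Opens X.carrier} (h : V ≤ U) (h' : W ≤ V) (x : Fn X U) :
    resFn h' (resFn h x) = resFn (h'.trans h) x :=
  (ConcreteCategory.congr_hom
    ((ringSheaf X).obj.map_comp (homOfLE h).op (homOfLE h').op) x).symm

theorem resFn_self {U : Opens X.carrier} (h : U ≤ U) (x : Fn X U) : resFn h x = x :=
  ConcreteCategory.congr_hom ((ringSheaf X).obj.map_id (op U)) x

theorem pullFn_resFn (f : X ⟶ Y) {U V : Opens Y.carrier} (h : V ≤ U) (r : Fn Y U) :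
    pullFn f V (resFn h r) = resFn ((Opens.map f.hom.base).map (homOfLE h)).le (pullFn f U r) :=
  ConcreteCategory.congr_hom ((ringHom f).hom.naturality (homOfLE h).op) r

/-- The effect of a morphism of sheaves of modules on sections. -/
def app {E F : Mod X} (g : E ⟶ F) (U : Opens X.carrier) : Sec E U →ₗ[Fn X U] Sec F U :=
  (g.val.app (op U)).hom

theorem app_res {E F : Mod X} (g : E ⟶ F) {U V : Opens X.carrier} (h : V ≤ U) (x : Sec E U) :
    app g V (res E h x) = res F h (app g U x) :=
  PresheafOfModules.naturality_apply g.val (homOfLE h).op x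

theorem hom_ext_app {E F : Mod X} {g h : E ⟶ F} (H : ∀ U x, app g U x = app h U x) : g = h := by
  apply SheafOfModules.hom_ext
  apply PresheafOfModules.hom_ext
  intro U
  exact ModuleCat.hom_ext (LinearMap.ext (H U.unop))

/-- A morphism of sheaves of modules from its effect on sections. -/
def homOfApp {E F : Mod X} (g : ∀ U, Sec E U →ₗ[Fn X U] Sec F U)
    (hg : ∀ {U V : Opens X.carrier} (h : V ≤ U) (x : Sec E U), g V (res E h x) = res F h (g U x)) :
    E ⟶ F where
  val :=
    { app := fun U => ModuleCat.ofHom (g U.unop)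
      naturality := by
        intro U V i
        refine ModuleCat.hom_ext (@LinearMap.ext _ _ _ _ _ _ _ _ (_) (_) _ _ _ (fun x => ?_))
        exact hg i.unop.le x }

@[simp]
theorem app_homOfApp {E F : Mod X} (g : ∀ U, Sec E U →ₗ[Fn X U] Sec F U)
    (hg : ∀ {U V : Opens X.carrier} (h : V ≤ U) (x : Sec E U), g V (res E h x) = res F h (g U x))
    (U : Opens X.carrier) (x : Sec E U) : app (homOfApp g hg) U x = g U x := rfl

/-- The functor `V ↦ V ∩ U` on open sets. -/
def interFunctor (U : Opens X.carrier) : Opens X.carrier ⥤ Opens X.carrier where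
  obj V := V ⊓ U
  map h := homOfLE (inf_le_inf_right U h.le)

instance (U : Opens X.carrier) : (interFunctor U).IsContinuous
    (Opens.grothendieckTopology X.carrier) (Opens.grothendieckTopology X.carrier) := by
  have e : Opens.map U.inclusion' ⋙ U.isOpenEmbedding.isOpenMap.functor ≅ interFunctor U :=
    NatIso.ofComponents (fun V => eqToIso (by
      apply Opens.ext
      ext x
      simp [interFunctor])) (by intros; exact Subsingleton.elim _ _)
  have : U.isOpenEmbedding.isOpenMap.functor.IsContinuous
    (Opens.grothendieckTopology _) (Opens.grothendieckTopology X.carrier) :=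
    U.isOpenEmbedding.functor_isContinuous
  have := Functor.isContinuous_comp (Opens.map U.inclusion') U.isOpenEmbedding.isOpenMap.functor
    (Opens.grothendieckTopology X.carrier) (Opens.grothendieckTopology _) 
    (Opens.grothendieckTopology X.carrier)
  exact Functor.isContinuous_of_iso e _ _

/-- The restriction maps `𝒪(V) → 𝒪(V ∩ U)`. -/
def interRingHom (U : Opens X.carrier) : ringSheaf X ⟶
    ((interFunctor U).sheafPushforwardContinuous RingCat.{0} (Opens.grothendieckTopology X.carrier)
      (Opens.grothendieckTopology X.carrier)).obj (ringSheaf X) where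
  hom :=
    { app := fun V => (ringSheaf X).obj.map (homOfLE (inf_le_left : V.unop ⊓ U ≤ V.unop)).op
      naturality := by
        intro V W h
        exact ((ringSheaf X).obj.map_comp h
            (homOfLE (inf_le_left : W.unop ⊓ U ≤ W.unop)).op).symm.trans
          ((ringSheaf X).obj.map_comp (homOfLE (inf_le_left : V.unop ⊓ U ≤ V.unop)).op
            (homOfLE (inf_le_inf_right U h.unop.le)).op) }

/-- The sheaf `V ↦ E(V ∩ U)`. -/
def inter (U : Opens X.carrier) (E : Mod X) : Mod X :=
  (SheafOfModules.pushforward.{0} (interRingHom U)).obj E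

/-- A section of `E` over `V ∩ U` is a section of `V ↦ E(V ∩ U)` over `V`. -/
def toInter (U : Opens X.carrier) (E : Mod X) {V : Opens X.carrier} (x : Sec E (V ⊓ U)) :
    Sec (inter U E) V := x

/-- The coefficients of a section with respect to a local basis. -/
def coeff {E : Mod X} {U : Opens X.carrier} {n : ℕ} {e : Fin n → Sec E U} (he : IsLocalBasis E U e)
    {V : Opens X.carrier} (h : V ≤ U) (x : Sec E V) : Fin n → Fn X V :=
  (Equiv.ofBijective _ (he V h)).symm x

theorem sum_coeff {E : Mod X} {U : Opens X.carrier} {n : ℕ} {e : Fin n → Sec E U}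
    (he : IsLocalBasis E U e) {V : Opens X.carrier} (h : V ≤ U) (x : Sec E V) :
    ∑ i, coeff he h x i • res E h (e i) = x :=
  (Equiv.ofBijective _ (he V h)).apply_symm_apply x

theorem coeff_eq {E : Mod X} {U : Opens X.carrier} {n : ℕ} {e : Fin n → Sec E U}
    (he : IsLocalBasis E U e) {V : Opens X.carrier} (h : V ≤ U) {x : Sec E V} {c : Fin n → Fn X V}
    (hc : ∑ i, c i • res E h (e i) = x) : coeff he h x = c :=
  (Equiv.symm_apply_eq _).2 hc.symm

theorem coeff_res {E : Mod X} {U : Opens X.carrier} {n : ℕ} {e : Fin n → Sec E U}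
    (he : IsLocalBasis E U e) {V W : Opens X.carrier} (h : V ≤ U) (h' : W ≤ V) (x : Sec E V)
    (i : Fin n) : coeff he (h'.trans h) (res E h' x) i = resFn h' (coeff he h x i) := by
  refine congrFun (coeff_eq he _ (c := fun i => resFn h' (coeff he h x i)) ?_) i
  conv_rhs => rw [← sum_coeff he h x]
  rw [res_sum]
  exact Finset.sum_congr rfl fun i _ => by rw [res_smul, res_res]

theorem coeff_add {E : Mod X} {U : Opens X.carrier} {n : ℕ} {e : Fin n → Sec E U}
    (he : IsLocalBasis E U e) {V : Opens X.carrier} (h : V ≤ U) (x y : Sec E V)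
    (i : Fin n) : coeff he h (x + y) i = coeff he h x i + coeff he h y i := by
  refine congrFun (coeff_eq he _ (c := fun i => coeff he h x i + coeff he h y i) ?_) i
  simp only [add_smul, Finset.sum_add_distrib, sum_coeff]

theorem coeff_smul {E : Mod X} {U : Opens X.carrier} {n : ℕ} {e : Fin n → Sec E U}
    (he : IsLocalBasis E U e) {V : Opens X.carrier} (h : V ≤ U) (r : Fn X V) (x : Sec E V)
    (i : Fin n) : coeff he h (r • x) i = r * coeff he h x i := by
  refine congrFun (coeff_eq he _ (c := fun i => r * coeff he h x i) ?_) i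
  simp only [mul_smul, ← Finset.smul_sum, sum_coeff]

theorem coeff_basis {E : Mod X} {U : Opens X.carrier} {n : ℕ} {e : Fin n → Sec E U}
    (he : IsLocalBasis E U e) {V : Opens X.carrier} (h : V ≤ U) (k i : Fin n) :
    coeff he h (res E h (e k)) i = if i = k then 1 else 0 := by
  refine congrFun (coeff_eq he _ (c := fun i => if i = k then 1 else 0) ?_) i
  simp

/-- The structure sheaf as a module over itself. -/
abbrev unitMod (X : CSpace) : Mod X := SheafOfModules.unit (ringSheaf X)

/-- The coordinate functional `E → f_* (V ↦ 𝒪_X(V ∩ f⁻¹ U))` of a local basis of `E` over `U`. -/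
def coordHom (f : X ⟶ Y) {E : Mod Y} {U : Opens Y.carrier} {n : ℕ} {e : Fin n → Sec E U}
    (he : IsLocalBasis E U e) (i : Fin n) :
    E ⟶ (pushforward f).obj (inter ((Opens.map f.hom.base).obj U) (unitMod X)) :=
  homOfApp
    (fun V =>
      { toFun := fun x => pullFn f (V ⊓ U)
          (coeff he inf_le_right (res E (inf_le_left : V ⊓ U ≤ V) x) i)
        map_add' := fun x y => by
          rw [res_add, coeff_add, map_add]
          rfl
        map_smul' := fun r x => by
          rw [res_smul, coeff_smul, map_mul, pullFn_resFn]
          rfl })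
    (fun {V W} h x => by
      change pullFn f (W ⊓ U) _ = resFn _ (pullFn f (V ⊓ U) _)
      rw [← pullFn_resFn f (inf_le_inf_right U h : W ⊓ U ≤ V ⊓ U), ← coeff_res he, res_res, res_res])

/-- The restriction map `E(V) → E(V ∩ U)`. -/
def toInterHom (U : Opens X.carrier) (E : Mod X) : E ⟶ inter U E :=
  homOfApp
    (fun V =>
      { toFun := fun x => toInter U E (res E inf_le_left x)
        map_add' := fun x y => res_add _ _ _ _
        map_smul' := fun r x => res_smul _ _ _ _ })
    (fun {V W} h x => by
      exact (res_res E h inf_le_left x).trans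
        (res_res E inf_le_left (inf_le_inf_right U h : W ⊓ U ≤ V ⊓ U) x).symm)

/-- The values of a functional `E → (V ↦ 𝒪(V ∩ U))`. -/
def fnOf {E : Mod X} {U : Opens X.carrier} (a : E ⟶ inter U (unitMod X)) (V : Opens X.carrier)
    (x : Sec E V) : Fn X (V ⊓ U) := app a V x

theorem fnOf_add {E : Mod X} {U : Opens X.carrier} (a : E ⟶ inter U (unitMod X))
    (V : Opens X.carrier) (x y : Sec E V) : fnOf a V (x + y) = fnOf a V x + fnOf a V y :=
  map_add (app a V) x y

theorem fnOf_smul {E : Mod X} {U : Opens X.carrier} (a : E ⟶ inter U (unitMod X))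
    (V : Opens X.carrier) (r : Fn X V) (x : Sec E V) :
    fnOf a V (r • x) = resFn inf_le_left r * fnOf a V x :=
  map_smul (app a V) r x

theorem fnOf_sum_smul {E : Mod X} {U : Opens X.carrier} (a : E ⟶ inter U (unitMod X))
    (V : Opens X.carrier) {n : ℕ} (r : Fin n → Fn X V) (x : Fin n → Sec E V) :
    fnOf a V (∑ i, r i • x i) = ∑ i, resFn inf_le_left (r i) * fnOf a V (x i) := by
  refine (map_sum (app a V) _ _).trans ?_
  exact Finset.sum_congr rfl fun i _ => fnOf_smul a V (r i) (x i)

theorem fnOf_res {E : Mod X} {U : Opens X.carrier} (a : E ⟶ inter U (unitMod X))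
    {V W : Opens X.carrier} (h : W ≤ V) (x : Sec E V) :
    fnOf a W (res E h x) = resFn (inf_le_inf_right U h) (fnOf a V x) :=
  app_res a h x

/-- The map `∑ aᵢ eᵢ` for functionals `aᵢ` and sections `eᵢ`. -/
def combHom {E : Mod X} (U : Opens X.carrier) {n : ℕ} (a : Fin n → (E ⟶ inter U (unitMod X)))
    (e : Fin n → Sec E U) : E ⟶ inter U E :=
  homOfApp
    (fun V =>
      { toFun := fun x => toInter U E (∑ i, fnOf (a i) V x • res E inf_le_right (e i))
        map_add' := fun x y => by
          simp only [fnOf_add, add_smul, Finset.sum_add_distrib]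
          rfl
        map_smul' := fun r x => by
          simp only [fnOf_smul, mul_smul, ← Finset.smul_sum]
          rfl })
    (fun {V W} h x => by
      have : ∑ i, fnOf (a i) W (res E h x) • res E (inf_le_right : W ⊓ U ≤ U) (e i) =
          res E (inf_le_inf_right U h)
            (∑ i, fnOf (a i) V x • res E (inf_le_right : V ⊓ U ≤ U) (e i)) := by
        rw [res_sum]
        exact Finset.sum_congr rfl fun i _ => by rw [res_smul, res_res, fnOf_res]
      exact this)

theorem isLocalBasis_of_isCartesian {P Q : ModSpace} (f : P ⟶ Q)
    (hf : ModSpace.Hom.IsCartesian f) {U : Opens Q.space.carrier} {n : ℕ} {e : Fin n → Sec Q.mod U}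
    (he : IsLocalBasis Q.mod U e) :
    IsLocalBasis P.mod ((Opens.map f.base.hom.base).obj U)
      (fun i => app (F := (pushforward f.base).obj P.mod) f.map U (e i)) := by
  -- the pullback of sections, and its compatibilities
  let u (V : Opens Q.space.carrier) (x : Sec Q.mod V) :
      Sec P.mod ((Opens.map f.base.hom.base).obj V) :=
    app (F := (pushforward f.base).obj P.mod) f.map V x
  have u_sum_smul : ∀ (V : Opens Q.space.carrier) (r : Fin n → Fn Q.space V)
      (x : Fin n → Sec Q.mod V), u V (∑ i, r i • x i) = ∑ i, pullFn f.base V (r i) • u V (x i) := by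
    intro V r x
    refine (map_sum (app (F := (pushforward f.base).obj P.mod) f.map V) _ _).trans ?_
    exact Finset.sum_congr rfl fun i _ =>
      map_smul (app (F := (pushforward f.base).obj P.mod) f.map V) (r i) (x i)
  have u_res : ∀ {V W : Opens Q.space.carrier} (h : W ≤ V) (x : Sec Q.mod V),
      u W (res Q.mod h x) = res P.mod ((Opens.map f.base.hom.base).map (homOfLE h)).le (u V x) :=
    fun h x => app_res (F := (pushforward f.base).obj P.mod) f.map h x
  let U' := (Opens.map f.base.hom.base).obj U
  let e' : Fin n → Sec P.mod U' := fun i => u U (e i)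
  -- the coordinate functionals on the pullback
  choose a ha using fun i => (hf.bijective (inter U' (unitMod P.space))).2 (coordHom f.base he i)
  have ha' : ∀ i (V : Opens Q.space.carrier) (x : Sec Q.mod V),
      fnOf (a i) ((Opens.map f.base.hom.base).obj V) (u V x) =
        pullFn f.base (V ⊓ U)
          (coeff he inf_le_right (res Q.mod (inf_le_left : V ⊓ U ≤ V) x) i) := by
    intro i V x
    have := congrArg (fun g => app g V x) (ha i)
    exact this
  have hRS : toInterHom U' P.mod = combHom U' a e' := by
    apply (hf.bijective _).1
    apply hom_ext_app
    intro V x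
    change res P.mod (inf_le_left : (Opens.map f.base.hom.base).obj V ⊓ U' ≤ _) (u V x) =
      ∑ i, fnOf (a i) ((Opens.map f.base.hom.base).obj V) (u V x) • res P.mod inf_le_right (e' i)
    have h1 := u_res (inf_le_left : V ⊓ U ≤ V) x
    have h2 := u_sum_smul (V ⊓ U)
      (coeff he inf_le_right (res Q.mod (inf_le_left : V ⊓ U ≤ V) x))
      (fun i => res Q.mod inf_le_right (e i))
    rw [sum_coeff he inf_le_right (res Q.mod (inf_le_left : V ⊓ U ≤ V) x)] at h2
    refine h1.symm.trans (h2.trans (Finset.sum_congr rfl fun i _ => ?_))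
    rw [ha', u_res (inf_le_right : V ⊓ U ≤ U) (e i)]
    rfl
  have hval : ∀ i k, fnOf (a k) U' (e' i) = if k = i then 1 else 0 := by
    intro i k
    refine (ha' k U (e i)).trans ?_
    rw [coeff_basis he (inf_le_right : U ⊓ U ≤ U) i k]
    split_ifs
    · exact map_one _
    · exact map_zero _
  intro V hV
  have hVV : V ≤ V ⊓ U' := le_inf le_rfl hV
  constructor
  · intro c d hcd
    have key : ∀ c : Fin n → Fn P.space V, ∀ k, resFn hVV (fnOf (a k) V
        (∑ i, c i • res P.mod hV (e' i))) = c k := by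
      intro c k
      rw [fnOf_sum_smul, map_sum, Finset.sum_eq_single k]
      · rw [map_mul, resFn_resFn, resFn_self, fnOf_res, hval, if_pos rfl, map_one, map_one,
          mul_one]
      · intro i _ hik
        rw [map_mul, fnOf_res, hval, if_neg (Ne.symm hik), map_zero, map_zero, mul_zero]
      · intro h
        exact absurd (Finset.mem_univ k) h
    funext k
    rw [← key c k, ← key d k]
    exact congrArg _ (congrArg _ hcd)
  · intro y
    refine ⟨fun i => resFn hVV (fnOf (a i) V y), ?_⟩
    have h1 : res P.mod (inf_le_left : V ⊓ U' ≤ V) y =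
        ∑ i, fnOf (a i) V y • res P.mod inf_le_right (e' i) :=
      congrArg (fun g => app g V y) hRS
    have h2 := congrArg (res P.mod hVV) h1
    rw [res_res, res_self, res_sum] at h2
    refine Eq.trans (Finset.sum_congr rfl fun i _ => ?_) h2.symm
    rw [res_smul, res_res]

end Sections

theorem isLocallyFree_of_isCartesian {P Q : ModSpace} (f : P ⟶ Q)
    (hf : ModSpace.Hom.IsCartesian f) (hQ : IsLocallyFree Q.mod) : IsLocallyFree P.mod := by
  intro x
  obtain ⟨U, hx, n, e, he⟩ := hQ (f.base.hom.base x)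
  exact ⟨(Opens.map f.base.hom.base).obj U, hx, n, _, isLocalBasis_of_isCartesian f hf he⟩

namespace ModSpace

theorem isCartesian_lift {P Q T : ModSpace} {f : P ⟶ Q} (hf : Hom.IsCartesian f) (g : T ⟶ Q)
    (h : T.space ⟶ P.space) (hg : h ≫ f.base = g.base) (hgc : Hom.IsCartesian g) :
    Hom.IsCartesian (lift hf g h hg) := by
  apply isCartesian_of_comp hf
  rw [lift_comp]
  exact hgc

/-- The morphism `(X, E') → (X, E)` over the identity of `X` given by a map `E → E'`. -/
def vert {X : CSpace} {E E' : Mod X} (e : E ⟶ E') : (⟨X, E'⟩ : ModSpace) ⟶ ⟨X, E⟩ :=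
  ⟨𝟙 X, e⟩

theorem ofPullback_map_comp {X Y : CSpace} (f : X ⟶ Y) {N : Mod X} {E E' : Mod Y} (e : E ⟶ E')
    (u : (pullback f).obj E' ⟶ N) :
    ofPullback f ((pullback f).map e ≫ u) = ofPullback f u ≫ vert e :=
  ModSpace.Hom.ext rfl (heq_of_eq ((pullbackAdj f).homEquiv_naturality_left e u))

theorem ofPullback_injective {X Y : CSpace} (f : X ⟶ Y) {N : Mod X} {E : Mod Y}
    {u v : (pullback f).obj E ⟶ N} (h : ofPullback f u = ofPullback f v) : u = v := by
  apply ((pullbackAdj f).homEquiv E N).injective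
  have h' : (⟨f, (pullbackAdj f).homEquiv E N u⟩ : ModSpace.Hom ⟨X, N⟩ ⟨Y, E⟩) =
    ⟨f, (pullbackAdj f).homEquiv E N v⟩ := h
  injection h'

theorem vert_pull {X Y : CSpace} (f : X ⟶ Y) {E E' : Mod Y} (e : E ⟶ E') :
    vert ((pullback f).map e) ≫ pull f E = pull f E' ≫ vert e :=
  ModSpace.Hom.ext rfl (heq_of_eq ((pullbackAdj f).unit.naturality e).symm)

theorem map_map_comp_eq {X Y X₁ : CSpace} (f : X ⟶ Y) {E E' : Mod Y} (e : E ⟶ E') {N : Mod X₁}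
    (h : X₁ ⟶ X) (u' : (pullback h).obj ((pullback f).obj E') ⟶ N)
    (u : (pullback h).obj ((pullback f).obj E) ⟶ N)
    (huu : (ofPullback h u' ≫ pull f E') ≫ vert e = ofPullback h u ≫ pull f E) :
    (pullback h).map ((pullback f).map e) ≫ u' = u := by
  apply ofPullback_injective
  rw [ofPullback_map_comp]
  apply (isCartesian_pull f E).hom_ext
  · rfl
  · rw [Category.assoc, vert_pull, ← Category.assoc, huu]

theorem square {C : Type*} [Category C] {Y' Y X' X T' T Z' Z : C} {r' : Y' ⟶ X'} {p' : X' ⟶ T'}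
    {c' : Y' ⟶ Z'} {s' : Z' ⟶ T'} {r : Y ⟶ X} {p : X ⟶ T} {c : Y ⟶ Z} {s : Z ⟶ T}
    {y : Y' ⟶ Y} {x : X' ⟶ X} {t : T' ⟶ T} {z : Z' ⟶ Z} (h : r ≫ p = c ≫ s)
    (h₁ : r' ≫ x = y ≫ r) (h₂ : p' ≫ t = x ≫ p) (h₃ : c' ≫ z = y ≫ c) (h₄ : s' ≫ t = z ≫ s) :
    (r' ≫ p') ≫ t = (c' ≫ s') ≫ t := by
  rw [Category.assoc, h₂, ← Category.assoc, h₁, Category.assoc, h, ← Category.assoc, ← h₃,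
    Category.assoc, ← h₄, Category.assoc]

end ModSpace

/-! ### Framed vector bundles -/

/-- Framing data `(X, Y, W)`: a space `X`, a subspace `i : Y → X` and a sheaf of modules `W` on `Y`. -/
structure FramingData where
  X : CSpace
  Y : CSpace
  i : Y ⟶ X
  W : Mod Y

/-- The pair `(Y, W)` of framing data `(X, Y, W)`. -/
abbrev FramingData.frame (D : FramingData) : ModSpace := ⟨D.Y, D.W⟩

/-- A framed vector bundle `(E, α)` to framing data `(X, Y, W)`: a locally free sheaf `E` on `X`
with a framing isomorphism `α : E|_Y ≅ W`. -/
structure FramedBundle (D : FramingData) where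
  E : Mod D.X
  locallyFree : IsLocallyFree E
  framing : (pullback D.i).obj E ≅ D.W

/-- The morphism `(Y, W) → (X, E)` corresponding to the framing `α : E|_Y ≅ W`. -/
def FramedBundle.restr {D : FramingData} (B : FramedBundle D) :
    D.frame ⟶ (⟨D.X, B.E⟩ : ModSpace) :=
  ModSpace.ofPullback D.i B.framing.hom

theorem FramedBundle.isCartesian_restr {D : FramingData} (B : FramedBundle D) :
    ModSpace.Hom.IsCartesian B.restr :=
  ModSpace.isCartesian_ofPullback _ _

/-- A morphism of framing data `(X', Y', W') → (X, Y, W)`: compatible morphisms `X' → X` and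
`Y' → Y`, and an isomorphism of `W'` with the restriction of `W` to `Y'`. -/
structure FramingData.Hom (D' D : FramingData) where
  x : D'.X ⟶ D.X
  w : D'.frame ⟶ D.frame
  isCartesian : ModSpace.Hom.IsCartesian w
  comm : D'.i ≫ x = w.base ≫ D.i

/-- The framing of the restriction of a framed vector bundle `(E, α)` along a morphism of framing
data, as a morphism `(Y', W') → (X', E|_{X'})`: it is the unique one over `Y' → X'` whose composite
with `(X', E|_{X'}) → (X, E)` is the composite `(Y', W') → (Y, W) → (X, E)`. -/
def FramedBundle.pullRestr {D' D : FramingData} (κ : FramingData.Hom D' D) (B : FramedBundle D) :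
    D'.frame ⟶ (⟨D'.X, (pullback κ.x).obj B.E⟩ : ModSpace) :=
  ModSpace.lift (ModSpace.isCartesian_pull κ.x B.E) (κ.w ≫ B.restr) D'.i κ.comm

theorem FramedBundle.pullRestr_comp {D' D : FramingData} (κ : FramingData.Hom D' D)
    (B : FramedBundle D) :
    B.pullRestr κ ≫ ModSpace.pull κ.x B.E = κ.w ≫ B.restr :=
  ModSpace.lift_comp _ _ _ _

theorem FramedBundle.isCartesian_pullRestr {D' D : FramingData} (κ : FramingData.Hom D' D)
    (B : FramedBundle D) : ModSpace.Hom.IsCartesian (B.pullRestr κ) :=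
  ModSpace.isCartesian_lift _ _ _ _ (ModSpace.isCartesian_comp κ.isCartesian B.isCartesian_restr)

/-- The restriction of a framed vector bundle along a morphism of framing data. -/
def FramedBundle.pull {D' D : FramingData} (κ : FramingData.Hom D' D) (B : FramedBundle D) :
    FramedBundle D' where
  E := (pullback κ.x).obj B.E
  locallyFree := isLocallyFree_of_isCartesian _ (ModSpace.isCartesian_pull κ.x B.E) B.locallyFree
  framing := (B.isCartesian_pullRestr κ).iso

theorem FramedBundle.restr_pull {D' D : FramingData} (κ : FramingData.Hom D' D)
    (B : FramedBundle D) : (B.pull κ).restr = B.pullRestr κ :=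
  ModSpace.ofPullback_iso (B.isCartesian_pullRestr κ)

/-! ### Families and deformations over `Spec A` -/

section Deformations

variable (A : Type) [CommRing A] [Algebra ℂ A] [Module.Finite ℂ A]
variable {A' : Type} [CommRing A'] [Algebra ℂ A'] [Module.Finite ℂ A']

/-- The framing data `(Spec A × X, Spec A × Y, p^* W)`, where `p : Spec A × Y → Y` is the
projection. Framed vector bundles to these data are the families of framed vector bundles to the
data `(X, Y, W)` parametrized by `Spec A`. -/
abbrev FramingData.thicken (D : FramingData) : FramingData where
  X := FramedDef.thicken A D.X
  Y := FramedDef.thicken A D.Y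
  i := thickenMap (AlgHom.id ℂ A) D.i
  W := (pullback (thickenProj A D.Y)).obj D.W

/-- The morphism `(Spec A × Y, p^* W) → (Y, W)`. -/
def FramingData.proj (D : FramingData) : (D.thicken A).frame ⟶ D.frame :=
  ModSpace.pull (thickenProj A D.Y) D.W

theorem FramingData.isCartesian_proj (D : FramingData) :
    ModSpace.Hom.IsCartesian (D.proj A) :=
  ModSpace.isCartesian_pull _ _

/-- The morphism `(Y, W) → (Spec A × Y, p^* W)` over the inclusion `s` of the fibre over the closed
point, corresponding to the canonical isomorphism `s^* p^* W = W`: it is the unique one over `s`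
whose composite with `(Spec A × Y, p^* W) → (Y, W)` is the identity. -/
def FramingData.closedFibre [IsLocalRing A] (D : FramingData) : D.frame ⟶ (D.thicken A).frame :=
  ModSpace.lift (D.isCartesian_proj A) (𝟙 _) (FramedDef.closedFibre A D.Y)
    (closedFibre_thickenProj A D.Y)

theorem FramingData.closedFibre_proj [IsLocalRing A] (D : FramingData) :
    D.closedFibre A ≫ D.proj A = 𝟙 _ :=
  ModSpace.lift_comp (D.isCartesian_proj A) (𝟙 _) (FramedDef.closedFibre A D.Y)
    (closedFibre_thickenProj A D.Y)

/-- A deformation `(E, α, ψ)` over `(Spec A, s₀)` of a framed vector bundle `(E₀, α₀)`: a family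
`(E, α)` parametrized by `Spec A` together with an isomorphism `ψ : E|_{s₀ × X} ≅ E₀` compatible
with the framings. The compatibility `α₀ ∘ ψ|_Y = α|_{s₀ × Y}` is expressed by the commutative square
with sides `(Y, W) → (X, E₀) → (Spec A × X, E)` and
`(Y, W) → (Spec A × Y, p^* W) → (Spec A × X, E)`, given by `α₀`, `ψ`, `s^* p^* W = W` and `α`. -/
structure Deformation [IsLocalRing A] {D : FramingData} (B : FramedBundle D) where
  fam : FramedBundle (D.thicken A)
  ψ : (pullback (FramedDef.closedFibre A D.X)).obj fam.E ≅ B.E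
  comm : B.restr ≫ ModSpace.ofPullback (FramedDef.closedFibre A D.X) ψ.hom =
    D.closedFibre A ≫ fam.restr

variable {A}

/-- Two deformations `(E, α, ψ)`, `(E', α', ψ')` are isomorphic if there is an isomorphism
`e : E ≅ E'` with `α' ∘ e|_{Spec A × Y} = α` and `ψ' ∘ e|_{s₀ × X} = ψ`. -/
def Deformation.Isomorphic [IsLocalRing A] {D : FramingData} {B : FramedBundle D}
    (ξ η : Deformation A B) : Prop :=
  ∃ e : ξ.fam.E ≅ η.fam.E,
    (pullback (D.thicken A).i).map e.hom ≫ η.fam.framing.hom = ξ.fam.framing.hom ∧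
    (pullback (FramedDef.closedFibre A D.X)).map e.hom ≫ η.ψ.hom = ξ.ψ.hom

instance Deformation.setoid [IsLocalRing A] {D : FramingData} (B : FramedBundle D) :
    Setoid (Deformation A B) where
  r := Deformation.Isomorphic
  iseqv :=
    { refl := fun ξ => ⟨Iso.refl _, by
        rw [Iso.refl_hom, CategoryTheory.Functor.map_id, Category.id_comp], by
        rw [Iso.refl_hom, CategoryTheory.Functor.map_id, Category.id_comp]⟩
      symm := by
        rintro ξ η ⟨e, h₁, h₂⟩
        refine ⟨e.symm, ?_, ?_⟩
        · rw [← h₁, ← Category.assoc, ← CategoryTheory.Functor.map_comp, Iso.symm_hom, Iso.inv_hom_id,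
            CategoryTheory.Functor.map_id, Category.id_comp]
        · rw [← h₂, ← Category.assoc, ← CategoryTheory.Functor.map_comp, Iso.symm_hom, Iso.inv_hom_id,
            CategoryTheory.Functor.map_id, Category.id_comp]
      trans := by
        rintro ξ η ζ ⟨e, h₁, h₂⟩ ⟨e', h₁', h₂'⟩
        refine ⟨e ≪≫ e', ?_, ?_⟩
        · rw [Iso.trans_hom, CategoryTheory.Functor.map_comp, Category.assoc, h₁', h₁]
        · rw [Iso.trans_hom, CategoryTheory.Functor.map_comp, Category.assoc, h₂', h₂] }

variable (A)

/-- `Def(E₀, α₀)(A)`: isomorphism classes of deformations of `(E₀, α₀)` over `Spec A`. -/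
def Def [IsLocalRing A] {D : FramingData} (B : FramedBundle D) : Type 1 :=
  Quotient (Deformation.setoid (A := A) B)

/-- The product of a morphism of framing data with `Spec A`. -/
def FramingData.Hom.thicken {D' D : FramingData} (κ : FramingData.Hom D' D) :
    FramingData.Hom (D'.thicken A) (D.thicken A) where
  x := thickenMap (AlgHom.id ℂ A) κ.x
  w := ModSpace.lift (D.isCartesian_proj A) (D'.proj A ≫ κ.w)
    (thickenMap (AlgHom.id ℂ A) κ.w.base) (thickenMap_thickenProj A _ _)
  isCartesian := ModSpace.isCartesian_lift _ _ _ _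
    (ModSpace.isCartesian_comp (D'.isCartesian_proj A) κ.isCartesian)
  comm := by
    refine (thickenMap_comp _ _ _ _).trans (Eq.trans ?_ (thickenMap_comp _ _ _ _).symm)
    rw [κ.comm]

theorem FramingData.Hom.thicken_w_proj {D' D : FramingData} (κ : FramingData.Hom D' D) :
    (κ.thicken A).w ≫ D.proj A = D'.proj A ≫ κ.w :=
  ModSpace.lift_comp (D.isCartesian_proj A) (D'.proj A ≫ κ.w)
    (thickenMap (AlgHom.id ℂ A) κ.w.base) (thickenMap_thickenProj A _ _)

theorem FramingData.closedFibre_thicken [IsLocalRing A] {D' D : FramingData}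
    (κ : FramingData.Hom D' D) :
    D'.closedFibre A ≫ (FramingData.Hom.thicken A κ).w = κ.w ≫ D.closedFibre A := by
  apply (D.isCartesian_proj A).hom_ext
  · exact closedFibre_thickenMap (A := A) κ.w.base
  · rw [Category.assoc, κ.thicken_w_proj A, ← Category.assoc, D'.closedFibre_proj A, Category.id_comp,
      Category.assoc, D.closedFibre_proj A, Category.comp_id]

variable {A}

/-- The morphism of framing data `Spec A' × (X, Y, W) → Spec A × (X, Y, W)` induced by a
homomorphism `A → A'`. -/
def FramingData.baseChange (D : FramingData) (φ : A →ₐ[ℂ] A') :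
    FramingData.Hom (D.thicken A') (D.thicken A) where
  x := thickenMap φ (𝟙 D.X)
  w := ModSpace.lift (D.isCartesian_proj A) (D.proj A') (thickenMap φ (𝟙 D.Y))
    (thickenMap_thickenProj _ φ (𝟙 D.Y))
  isCartesian := ModSpace.isCartesian_lift _ _ _ _ (D.isCartesian_proj A')
  comm := by
    refine (thickenMap_comp _ _ _ _).trans (Eq.trans ?_ (thickenMap_comp _ _ _ _).symm)
    rfl

/-- The restriction `(E, α)|_{Spec A'}` of a family over `Spec A` along `Spec A' → Spec A`. -/
def FramedBundle.baseChange {D : FramingData} (B : FramedBundle (D.thicken A)) (φ : A →ₐ[ℂ] A') :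
    FramedBundle (D.thicken A') :=
  B.pull (D.baseChange φ)

section Pull

variable [IsLocalRing A] {D' D : FramingData} (κ : FramingData.Hom D' D) {B : FramedBundle D}

/-- The isomorphism `ψ'` of the restriction of a deformation, as a morphism
`(X', E₀|_{X'}) → (Spec A × X', E|_{Spec A × X'})`: the unique one over the inclusion of the fibre
over the closed point whose composite with `(Spec A × X', E|_{Spec A × X'}) → (Spec A × X, E)` is the
composite `(X', E₀|_{X'}) → (X, E₀) → (Spec A × X, E)`. -/
def Deformation.pullψ (ξ : Deformation A B) :
    (⟨D'.X, (B.pull κ).E⟩ : ModSpace) ⟶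
      ⟨(D'.thicken A).X, (ξ.fam.pull (κ.thicken A)).E⟩ :=
  ModSpace.lift (ModSpace.isCartesian_pull (κ.thicken A).x ξ.fam.E)
    (ModSpace.pull κ.x B.E ≫ ModSpace.ofPullback (FramedDef.closedFibre A D.X) ξ.ψ.hom)
    (FramedDef.closedFibre A D'.X) (closedFibre_thickenMap A κ.x)

theorem Deformation.pullψ_comp (ξ : Deformation A B) :
    ξ.pullψ κ ≫ ModSpace.pull (κ.thicken A).x ξ.fam.E =
      ModSpace.pull κ.x B.E ≫ ModSpace.ofPullback (FramedDef.closedFibre A D.X) ξ.ψ.hom :=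
  ModSpace.lift_comp _ _ _ _

theorem Deformation.isCartesian_pullψ (ξ : Deformation A B) :
    ModSpace.Hom.IsCartesian (ξ.pullψ κ) :=
  ModSpace.isCartesian_lift _ _ _ _ (ModSpace.isCartesian_comp (ModSpace.isCartesian_pull κ.x B.E)
    (ModSpace.isCartesian_ofPullback _ _))

/-- The restriction of a deformation of `(E₀, α₀)` along a morphism of framing data is a deformation
of the restriction of `(E₀, α₀)`. -/
def Deformation.pull (ξ : Deformation A B) : Deformation A (B.pull κ) where
  fam := ξ.fam.pull (κ.thicken A)
  ψ := (ξ.isCartesian_pullψ κ).iso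
  comm := by
    have h : ModSpace.ofPullback (FramedDef.closedFibre A D'.X) (ξ.isCartesian_pullψ κ).iso.hom =
        ξ.pullψ κ := ModSpace.ofPullback_iso (ξ.isCartesian_pullψ κ)
    rw [FramedBundle.restr_pull, FramedBundle.restr_pull]
    refine (congrArg (fun z => B.pullRestr κ ≫ z) h).trans ?_
    apply (ModSpace.isCartesian_pull (κ.thicken A).x ξ.fam.E).hom_ext
    · exact (closedFibre_thickenMap A D'.i).symm
    · exact ModSpace.square ξ.comm (B.pullRestr_comp κ) (ξ.pullψ_comp κ)
        (FramingData.closedFibre_thicken A κ) (ξ.fam.pullRestr_comp (κ.thicken A))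

theorem FramedBundle.ofPullback_framing_pull {D' D : FramingData} (κ : FramingData.Hom D' D)
    (B : FramedBundle D) :
    ModSpace.ofPullback D'.i (B.pull κ).framing.hom ≫ ModSpace.pull κ.x B.E = κ.w ≫ B.restr :=
  (congrArg (fun z => z ≫ ModSpace.pull κ.x B.E) (B.restr_pull κ)).trans (B.pullRestr_comp κ)

theorem Deformation.ofPullback_ψ_pull (ξ : Deformation A B) :
    ModSpace.ofPullback (FramedDef.closedFibre A D'.X) (ξ.pull κ).ψ.hom ≫
        ModSpace.pull (κ.thicken A).x ξ.fam.E =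
      ModSpace.pull κ.x B.E ≫ ModSpace.ofPullback (FramedDef.closedFibre A D.X) ξ.ψ.hom :=
  (congrArg (fun z => z ≫ ModSpace.pull (κ.thicken A).x ξ.fam.E)
    (ModSpace.ofPullback_iso (ξ.isCartesian_pullψ κ))).trans (ξ.pullψ_comp κ)

theorem Deformation.pull_isomorphic {ξ η : Deformation A B} (h : ξ.Isomorphic η) :
    (ξ.pull κ).Isomorphic (η.pull κ) := by
  obtain ⟨e, h₁, h₂⟩ := h
  refine ⟨(pullback (κ.thicken A).x).mapIso e, ?_, ?_⟩
  · apply ModSpace.map_map_comp_eq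
    refine Eq.trans ?_ (FramedBundle.ofPullback_framing_pull (κ.thicken A) ξ.fam).symm
    refine (congrArg (fun z => z ≫ ModSpace.vert e.hom)
      (FramedBundle.ofPullback_framing_pull (κ.thicken A) η.fam)).trans ?_
    refine (Category.assoc _ _ _).trans ?_
    refine congrArg (fun z => (κ.thicken A).w ≫ z) ?_
    exact (ModSpace.ofPullback_map_comp _ _ _).symm.trans (congrArg (ModSpace.ofPullback _) h₁)
  · apply ModSpace.map_map_comp_eq
    refine Eq.trans ?_ (ξ.ofPullback_ψ_pull κ).symm
    refine (congrArg (fun z => z ≫ ModSpace.vert e.hom) (η.ofPullback_ψ_pull κ)).trans ?_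
    refine (Category.assoc _ _ _).trans ?_
    refine congrArg (fun z => ModSpace.pull κ.x B.E ≫ z) ?_
    exact (ModSpace.ofPullback_map_comp _ _ _).symm.trans (congrArg (ModSpace.ofPullback _) h₂)

/-- The restriction map `Def(E₀, α₀)(A) → Def(E₀|_{X'}, α₀|_{Y'})(A)`. -/
def Def.pull : Def A B → Def A (B.pull κ) :=
  Quotient.map (Deformation.pull κ) fun _ _ h => Deformation.pull_isomorphic κ h

end Pull

end Deformations

/-- For a homomorphism `φ : R → R'` and a family `(E, α)` over `Spec R` with restriction
`(E', α')` to `Spec R'`, the natural map `Def(E, α)(ℂ[ε]) → Def(E', α')(ℂ[ε])` between the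
deformation-theoretic tangent spaces, given by restriction along
`Spec ℂ[ε] × Spec R' × X → Spec ℂ[ε] × Spec R × X`. -/
def tangentMap {R R' : Type} [CommRing R] [Algebra ℂ R] [Module.Finite ℂ R] [CommRing R']
    [Algebra ℂ R'] [Module.Finite ℂ R'] {D : FramingData} (φ : R →ₐ[ℂ] R')
    (B : FramedBundle (D.thicken R)) :
    Def (DualNumber ℂ) B → Def (DualNumber ℂ) (B.baseChange φ) :=
  Def.pull (D.baseChange φ)


end FramedDef

end

/-!
A first-order deformation of a framed bundle `(E, α)` on `X` is the same as an extension
`0 → E → F → E → 0` of sheaves of modules, with `ε` acting as `F → E → F`, together with a morphism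
`φ : F → i_* W` which restricts to the map `E → i_* W` given by `α` on the subobject `E`: the framing of
`F` has a constant term determined by `α`, and `φ` is its coefficient of `ε`
(`exists_isDualExt`, `exists_isDualExt_of_shortExact`, `exists_frame_splitting`). As `E → i_* W` is an
epimorphism, such a pair `(F, φ)` amounts to the extension `ker φ` of `E` by `M = ker (E → i_* W)`, from
which `F` arises by pushout along `M → E`.

Let `k` be the inclusion of `Spec R' × X` into `Spec R × X`, let `E'` be the restriction of `E` along
`k`, and `M'` the analogue of `M` for `E'`. A first-order deformation of the restricted framed bundle
gives an extension of `E'` by `M'`. Its direct image under the homeomorphism `k` pulls back to an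
extension of `E` by `k_* M'`, and a lift of the deformation is a lift of this extension along
`M → k_* M'` (`exists_glued_extension`, `exists_deformation_of_pull`). This map is an epimorphism
(`epi_kernelMap`), so a lift exists if `Ext²(E, N)` vanishes for its kernel `N`
(`exists_lift_extension`).

Multiplication by `t` identifies `N` with `s_* N₀`, where `s : X → Spec R × X` is the inclusion of the
closed fibre and `N₀ = ker (E₀ → i_* W₀)` is isomorphic to `J ⊗ E₀` for the ideal sheaf `J` of `Y`
(`nonempty_kernel_kernelMap_iso`, `nonempty_tensor_idealSheaf_iso`); if `t = 0` then `N = 0`. Finally,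
`Ext²(E₀, N₀) = 0` implies `Ext²(E, s_* N₀) = 0` (`subsingleton_ext_two_closedFibre`). This is a form of
the adjunction between `s^*` and `s_*` on Ext-groups. To avoid derived functors of `s^*`, it is reduced by
dimension shifting to `Ext²(E, s_* I) = 0` for injective `I`, which follows from `Ext¹` statements and
the resolution `0 → K → p^* p_* E → E → 0` for the projection `p : Spec R × X → X`, under which `p_* E` is
again a vector bundle. That locally free sheaves, and kernels of epimorphisms between them, are flat
enough for this is seen from local splittings, without stalks.
-/

noncomputable section

namespace FramedDef

/-! ### The category of sheaves of modules has enough injectives -/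

section EnoughInjectives

variable (X : CSpace)

/-- Sheafification sends the free presheaves on representables to a separating family. -/
theorem isSeparating_sheafification_freeYoneda :
    (ObjectProperty.ofObj fun U : Opens X.carrier =>
      (PresheafOfModules.sheafification (𝟙 (ringSheaf X).obj)).obj
        ((yoneda ⋙ PresheafOfModules.free (ringSheaf X).obj).obj U)).IsSeparating := by
  intro M N f g h
  apply SheafOfModules.hom_ext
  apply PresheafOfModules.freeYoneda.isSeparating (ringSheaf X).obj
  rintro _ ⟨U⟩ a
  let adj := PresheafOfModules.sheafificationAdjunction (𝟙 (ringSheaf X).obj)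
  have key := h _ ⟨U⟩ ((adj.homEquiv _ M).symm a)
  exact (adj.homEquiv _ N).symm.injective ((adj.homEquiv_naturality_right_symm a f).trans
    (key.trans (adj.homEquiv_naturality_right_symm a g).symm))

/-- Colimits of sheaves of modules are computed on the underlying sheaves of abelian groups: a diagram
of sheaves is the sheafification of a diagram of presheaves, and sheafification is compatible with
passing to abelian groups. -/
theorem preservesColimitsOfShape_toSheaf (K : Type) [SmallCategory K] :
    PreservesColimitsOfShape K (SheafOfModules.toSheaf.{0} (ringSheaf X)) where
  preservesColimit {F} := by
    let a := PresheafOfModules.sheafification.{0} (𝟙 (ringSheaf X).obj)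
    let e : F ≅ (F ⋙ SheafOfModules.forget (ringSheaf X)) ⋙ a :=
      Functor.isoWhiskerLeft F
        (asIso (PresheafOfModules.sheafificationAdjunction (𝟙 (ringSheaf X).obj)).counit).symm
    have h1 : PreservesColimit (F ⋙ SheafOfModules.forget (ringSheaf X))
        (a ⋙ SheafOfModules.toSheaf.{0} (ringSheaf X)) :=
      inferInstanceAs (PreservesColimit (F ⋙ SheafOfModules.forget (ringSheaf X))
        (PresheafOfModules.toPresheaf _ ⋙ presheafToSheaf _ AddCommGrpCat.{0}))
    have h2 : PreservesColimit ((F ⋙ SheafOfModules.forget (ringSheaf X)) ⋙ a)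
        (SheafOfModules.toSheaf.{0} (ringSheaf X)) := by
      let c := colimit.cocone (F ⋙ SheafOfModules.forget (ringSheaf X))
      let hc : IsColimit c := colimit.isColimit _
      exact preservesColimit_of_preserves_colimit_cocone (isColimitOfPreserves a hc)
        (isColimitOfPreserves (a ⋙ SheafOfModules.toSheaf.{0} (ringSheaf X)) hc)
    exact preservesColimit_of_iso_diagram _ e.symm

instance : PreservesColimitsOfSize.{0, 0} (SheafOfModules.toSheaf.{0} (ringSheaf X)) :=
  ⟨fun {K} _ => preservesColimitsOfShape_toSheaf X K⟩

instance : PreservesFiniteColimits (SheafOfModules.toSheaf.{0} (ringSheaf X)) :=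
  PreservesColimitsOfSize.preservesFiniteColimits _

/-- Exactness of filtered colimits is inherited from sheaves of abelian groups, and the free
modules on open sets form a separating family. -/
instance : IsGrothendieckAbelian.{0} (Mod X) where
  hasFilteredColimitsOfSize := ⟨fun _ _ _ => inferInstance⟩
  ab5OfSize := by
    let _ : HasFilteredColimitsOfSize.{0, 0} (Mod X) := ⟨fun _ _ _ => inferInstance⟩
    exact ⟨fun K _ _ =>
      HasExactColimitsOfShape.domain_of_functor K (SheafOfModules.toSheaf.{0} (ringSheaf X))⟩
  hasSeparator := ⟨_, (isSeparator_sigma _).2 (isSeparating_sheafification_freeYoneda X)⟩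

instance : EnoughInjectives (Mod X) := IsGrothendieckAbelian.enoughInjectives

end EnoughInjectives

/-! ### Extensions and Ext-groups in an abelian category -/

section Abelian

universe w v u

variable {C : Type u} [Category.{v} C] [Abelian C]

open Abelian

theorem shortExact_of_lift {A B E : C} (a : A ⟶ B) (q : B ⟶ E) (w : a ≫ q = 0) [Mono a] [Epi q]
    (h : ∀ (T : C) (k : T ⟶ B), k ≫ q = 0 → ∃ l : T ⟶ A, l ≫ a = k) :
    (ShortComplex.mk a q w).ShortExact where
  exact := ShortComplex.exact_of_f_is_kernel _ (by
    have : Mono (ShortComplex.mk a q w).f := ‹Mono a›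
    exact KernelFork.IsLimit.ofι' _ _ fun {T} k hk => ⟨(h T k hk).choose, (h T k hk).choose_spec⟩)
  mono_f := ‹_›
  epi_g := ‹_›

theorem shortExact_of_desc {A B E : C} (a : A ⟶ B) (q : B ⟶ E) (w : a ≫ q = 0) [Mono a] [Epi q]
    (h : ∀ (T : C) (k : B ⟶ T), a ≫ k = 0 → ∃ l : E ⟶ T, q ≫ l = k) :
    (ShortComplex.mk a q w).ShortExact where
  exact := ShortComplex.exact_of_g_is_cokernel _ (by
    have : Epi (ShortComplex.mk a q w).g := ‹Epi q›
    exact CokernelCofork.IsColimit.ofπ' _ _ fun {T} k hk =>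
      ⟨(h T k hk).choose, (h T k hk).choose_spec⟩)
  mono_f := ‹_›
  epi_g := ‹_›

theorem shortExact_cokernel {A B : C} (a : A ⟶ B) [Mono a] :
    (ShortComplex.mk a (cokernel.π a) (cokernel.condition a)).ShortExact :=
  ⟨ShortComplex.exact_cokernel a⟩

/-- The pullback of a short exact sequence along a morphism to its quotient. -/
theorem shortExact_pullback {A B E E' : C} {a : A ⟶ B} {q : B ⟶ E} {w : a ≫ q = 0}
    (hS : (ShortComplex.mk a q w).ShortExact) (φ : E' ⟶ E) :
    (ShortComplex.mk (pullback.lift 0 a (by simp [w]) : A ⟶ Limits.pullback φ q)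
      (pullback.fst φ q) (pullback.lift_fst _ _ _)).ShortExact := by
  have : Mono a := hS.mono_f
  have : Epi q := hS.epi_g
  have : Mono (pullback.lift 0 a (by simp [w]) : A ⟶ Limits.pullback φ q) :=
    mono_of_mono_fac (pullback.lift_snd (f := φ) (g := q) 0 a (by simp [w]))
  refine shortExact_of_lift _ _ _ fun T h hh =>
    ⟨hS.exact.lift (h ≫ pullback.snd φ q) (by
      change (h ≫ pullback.snd φ q) ≫ q = 0
      rw [Category.assoc, ← pullback.condition, reassoc_of% hh, zero_comp]), ?_⟩
  apply pullback.hom_ext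
  · simp only [Category.assoc, pullback.lift_fst, comp_zero]
    exact hh.symm
  · simp only [Category.assoc, pullback.lift_snd]
    exact hS.exact.lift_f _ _

/-- The pushout of an extension along a morphism from its subobject. -/
theorem shortExact_pushout {A B E A' : C} {a : A ⟶ B} {q : B ⟶ E} {w : a ≫ q = 0}
    (hS : (ShortComplex.mk a q w).ShortExact) (φ : A ⟶ A') :
    (ShortComplex.mk (pushout.inl φ a) (pushout.desc 0 q (by simp [w]) : pushout φ a ⟶ E)
      (pushout.inl_desc _ _ _)).ShortExact := by
  have : Mono a := hS.mono_f
  have : Epi q := hS.epi_g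
  have : Epi (pushout.desc 0 q (by simp [w]) : pushout φ a ⟶ E) :=
    epi_of_epi_fac (pushout.inr_desc (f := φ) (g := a) 0 q (by simp [w]))
  refine shortExact_of_desc _ _ _ fun T h hh =>
    ⟨hS.exact.desc (pushout.inr φ a ≫ h) (by
      change a ≫ pushout.inr φ a ≫ h = 0
      rw [← pushout.condition_assoc, hh, comp_zero]), ?_⟩
  apply pushout.hom_ext
  · rw [← Category.assoc, pushout.inl_desc, zero_comp]
    exact hh.symm
  · rw [← Category.assoc, pushout.inr_desc]
    exact hS.exact.g_desc _ _

variable [HasExt.{w} C]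

/-- If `Ext¹` from the quotient of a short exact sequence to `T` vanishes, then morphisms to `T`
extend from the subobject. -/
theorem exists_extend_of_subsingleton_ext {S : ShortComplex C} (hS : S.ShortExact) {T : C}
    (h : Subsingleton (Ext.{w} S.X₃ T 1)) (f : S.X₁ ⟶ T) : ∃ g : S.X₂ ⟶ T, S.f ≫ g = f := by
  obtain ⟨x, hx⟩ := Ext.contravariant_sequence_exact₁ hS T (Ext.mk₀ f) (n₁ := 1) rfl
    (Subsingleton.elim _ _)
  obtain ⟨g, rfl⟩ := Ext.addEquiv₀.symm.surjective x
  refine ⟨g, Ext.addEquiv₀.symm.injective ?_⟩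
  change Ext.mk₀ _ = Ext.mk₀ _
  rw [← hx]
  exact (Ext.mk₀_comp_mk₀ _ _).symm

/-- If `Ext¹` from `T` to the subobject of a short exact sequence vanishes, then morphisms from `T`
lift from the quotient. -/
theorem exists_lift_of_subsingleton_ext {S : ShortComplex C} (hS : S.ShortExact) {T : C}
    (h : Subsingleton (Ext.{w} T S.X₁ 1)) (f : T ⟶ S.X₃) : ∃ g : T ⟶ S.X₂, g ≫ S.g = f := by
  obtain ⟨x, hx⟩ := Ext.covariant_sequence_exact₃ T hS (Ext.mk₀ f) (n₁ := 1) rfl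
    (Subsingleton.elim _ _)
  obtain ⟨g, rfl⟩ := Ext.addEquiv₀.symm.surjective x
  refine ⟨g, Ext.addEquiv₀.symm.injective ?_⟩
  change Ext.mk₀ _ = Ext.mk₀ _
  rw [← hx]
  exact (Ext.mk₀_comp_mk₀ _ _).symm

/-- If every extension of `E` by `B` splits then `Ext¹(E, B) = 0`. -/
theorem subsingleton_ext_one_of_split [EnoughInjectives C] {E B : C}
    (h : ∀ (G : C) (b : B ⟶ G) (q : G ⟶ E) (w : b ≫ q = 0),
      (ShortComplex.mk b q w).ShortExact → ∃ r : G ⟶ B, b ≫ r = 𝟙 B) :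
    Subsingleton (Ext.{w} E B 1) := by
  refine subsingleton_of_forall_eq 0 fun x => ?_
  -- a class is the image of some `φ : E → I/B` for an injective `I ⊇ B`, and a splitting of the
  -- pullback along `φ` of `0 → B → I → I/B → 0` lifts `φ` to `I`
  have hS := shortExact_cokernel (Injective.ι B)
  obtain ⟨y, rfl⟩ := Ext.covariant_sequence_exact₁ E hS x (Ext.eq_zero_of_injective _)
    (n₀ := 0) rfl
  obtain ⟨φ, rfl⟩ := Ext.addEquiv₀.symm.surjective y
  have hP := shortExact_pullback hS φ
  obtain ⟨r, hr⟩ := h _ _ _ _ hP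
  have hk : pullback.lift 0 (Injective.ι B) (by simp) ≫
      (pullback.snd φ (cokernel.π (Injective.ι B)) - r ≫ Injective.ι B) = 0 := by
    rw [Preadditive.comp_sub, pullback.lift_snd, reassoc_of% hr, sub_self]
  have : Epi (pullback.fst φ (cokernel.π (Injective.ι B))) := hP.epi_g
  have hψ : hP.exact.desc _ hk ≫ cokernel.π (Injective.ι B) = φ := by
    rw [← cancel_epi (pullback.fst φ (cokernel.π (Injective.ι B)))]
    have h1 := hP.exact.g_desc _ hk
    dsimp only at h1
    rw [reassoc_of% h1]
    simp [pullback.condition]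
  change (Ext.mk₀ φ).comp _ _ = 0
  rw [← hψ]
  change (Ext.mk₀ (_ ≫ (ShortComplex.mk (Injective.ι B) (cokernel.π (Injective.ι B))
      (cokernel.condition _)).g)).comp _ _ = 0
  rw [← Ext.mk₀_comp_mk₀, Ext.comp_assoc_of_second_deg_zero, hS.comp_extClass, Ext.comp_zero]

theorem subsingleton_ext_left {S : ShortComplex C} (hS : S.ShortExact) {E : C} {n : ℕ}
    (h₃ : Subsingleton (Ext.{w} E S.X₃ n)) (h₂ : Subsingleton (Ext.{w} E S.X₂ (n + 1))) :
    Subsingleton (Ext.{w} E S.X₁ (n + 1)) := by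
  refine subsingleton_of_forall_eq 0 fun x => ?_
  obtain ⟨y, rfl⟩ := Ext.covariant_sequence_exact₁ E hS x (Subsingleton.elim _ _) (n₀ := n) rfl
  rw [Subsingleton.elim y 0, Ext.zero_comp]

theorem subsingleton_ext_right {S : ShortComplex C} (hS : S.ShortExact) {E : C} {n : ℕ}
    (h₂ : Subsingleton (Ext.{w} E S.X₂ n)) (h₁ : Subsingleton (Ext.{w} E S.X₁ (n + 1))) :
    Subsingleton (Ext.{w} E S.X₃ n) := by
  refine subsingleton_of_forall_eq 0 fun x => ?_
  obtain ⟨y, rfl⟩ := Ext.covariant_sequence_exact₃ E hS x (n₁ := n + 1) rfl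
    (Subsingleton.elim _ _)
  rw [Subsingleton.elim y 0, Ext.zero_comp]

theorem subsingleton_ext_quotient {S : ShortComplex C} (hS : S.ShortExact) {T : C} {n : ℕ}
    (h₁ : Subsingleton (Ext.{w} S.X₁ T n)) (h₂ : Subsingleton (Ext.{w} S.X₂ T (n + 1))) :
    Subsingleton (Ext.{w} S.X₃ T (n + 1)) := by
  refine subsingleton_of_forall_eq 0 fun x => ?_
  obtain ⟨y, rfl⟩ := Ext.contravariant_sequence_exact₃ hS T x (Subsingleton.elim _ _)
    (n₀ := n) (Nat.add_comm 1 n)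
  rw [Subsingleton.elim y 0, Ext.comp_zero]

theorem subsingleton_ext_of_iso {E T T' : C} (e : T ≅ T') {n : ℕ}
    (h : Subsingleton (Ext.{w} E T n)) : Subsingleton (Ext.{w} E T' n) := by
  refine subsingleton_of_forall_eq 0 fun x => ?_
  have h1 : (x.comp (Ext.mk₀ e.inv) (add_zero n)).comp (Ext.mk₀ e.hom) (add_zero n) = x := by
    rw [Ext.comp_assoc_of_third_deg_zero, Ext.mk₀_comp_mk₀, e.inv_hom_id, Ext.comp_mk₀_id]
  rw [← h1, Subsingleton.elim (x.comp (Ext.mk₀ e.inv) (add_zero n)) 0, Ext.zero_comp]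

theorem subsingleton_ext_of_iso_left {E E' T : C} (e : E ≅ E') {n : ℕ}
    (h : Subsingleton (Ext.{w} E T n)) : Subsingleton (Ext.{w} E' T n) := by
  refine subsingleton_of_forall_eq 0 fun x => ?_
  have h1 : (Ext.mk₀ e.inv).comp ((Ext.mk₀ e.hom).comp x (zero_add n)) (zero_add n) = x := by
    rw [Ext.mk₀_comp_mk₀_assoc, e.inv_hom_id, Ext.mk₀_id_comp]
  rw [← h1, Subsingleton.elim ((Ext.mk₀ e.hom).comp x (zero_add n)) 0, Ext.comp_zero]

theorem subsingleton_ext_of_isZero {E T : C} (hT : IsZero T) (n : ℕ) :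
    Subsingleton (Ext.{w} E T n) := by
  refine subsingleton_of_forall_eq 0 fun x => ?_
  rw [← x.comp_mk₀_id, hT.eq_of_src (𝟙 T) 0, Ext.mk₀_zero, Ext.comp_zero]

/-- The class of an extension of `E` by `Q` lifts along an epimorphism `M → Q` with kernel `N`
when `Ext²(E, N) = 0`. With `M → L` a monomorphism to an injective object and `L/N` the pushout of
`Q` and `L` over `M`, the morphism `Q → L/N` extends to `G` since `Ext¹(E, L/N) = Ext²(E, N) = 0`,
and the lift is `G ×_{L/N} L`. -/
theorem exists_lift_extension [EnoughInjectives C] {S : ShortComplex C} (hS : S.ShortExact)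
    {E G : C} {b : S.X₃ ⟶ G} {q : G ⟶ E} {w₁ : b ≫ q = 0}
    (hG : (ShortComplex.mk b q w₁).ShortExact) (h : Subsingleton (Ext.{w} E S.X₁ 2)) :
    ∃ (F : C) (m : S.X₂ ⟶ F) (e : F ⟶ E) (w₂ : m ≫ e = 0) (c : F ⟶ G),
      (ShortComplex.mk m e w₂).ShortExact ∧ m ≫ c = S.g ≫ b ∧ c ≫ q = e := by
  have := hS.mono_f
  have := hS.epi_g
  have : Mono b := hG.mono_f
  have : Epi q := hG.epi_g
  let ι := Injective.ι S.X₂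
  let u := pushout.inl S.g ι
  let π := pushout.inr S.g ι
  have hu : S.g ≫ u = ι ≫ π := pushout.condition
  have : Mono ι := inferInstanceAs (Mono (Injective.ι _))
  have : Mono u := inferInstanceAs (Mono (pushout.inl S.g ι))
  have : Epi π := inferInstanceAs (Epi (pushout.inr S.g ι))
  have : Mono (S.f ≫ ι) := mono_comp _ _
  have hL : (ShortComplex.mk (S.f ≫ ι) π (by
      rw [Category.assoc, ← hu, S.zero_assoc, zero_comp])).ShortExact :=
    shortExact_of_desc _ _ _ fun T k hk =>
      ⟨pushout.desc (hS.exact.desc (ι ≫ k) (by rw [← Category.assoc]; exact hk)) k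
        (hS.exact.g_desc _ _), pushout.inr_desc _ _ _⟩
  obtain ⟨g', hg'⟩ := exists_extend_of_subsingleton_ext.{w} hG (T := pushout S.g ι)
    (subsingleton_ext_right hL (Ext.subsingleton_of_injective _ _ _) h) u
  dsimp only at hg'
  -- the pushout modulo `Q` is `L/M`; this identifies the kernel of `F → E` with `M`
  let c' : pushout S.g ι ⟶ cokernel ι := pushout.desc 0 (cokernel.π ι) (by simp)
  have hι := shortExact_cokernel ι
  let m : S.X₂ ⟶ Limits.pullback g' π := pullback.lift (S.g ≫ b) ι (by
    rw [Category.assoc, hg', hu])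
  have hm₁ : m ≫ pullback.fst g' π = S.g ≫ b := pullback.lift_fst _ _ _
  have hm₂ : m ≫ pullback.snd g' π = ι := pullback.lift_snd _ _ _
  refine ⟨Limits.pullback g' π, m, pullback.fst g' π ≫ q, ?_, pullback.fst g' π, ?_, hm₁, rfl⟩
  · rw [reassoc_of% hm₁, w₁, comp_zero]
  have : Mono (m ≫ pullback.snd g' π) := by
    rw [hm₂]
    infer_instance
  have : Mono m := mono_of_mono m (pullback.snd g' π)
  refine shortExact_of_lift _ _ _ fun T k hk => ?_
  have hk' : (k ≫ pullback.fst g' π) ≫ q = 0 := by rw [Category.assoc]; exact hk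
  let x : T ⟶ S.X₃ := hG.exact.lift _ hk'
  have hx : x ≫ b = k ≫ pullback.fst g' π := hG.exact.lift_f _ _
  have h1 : (k ≫ pullback.snd g' π) ≫ π = x ≫ u := by
    rw [Category.assoc, ← pullback.condition, ← hg', reassoc_of% hx]
  have h2 : (k ≫ pullback.snd g' π) ≫ cokernel.π ι = 0 := by
    have : π ≫ c' = cokernel.π ι := pushout.inr_desc _ _ _
    rw [← this, ← Category.assoc, h1, Category.assoc, pushout.inl_desc, comp_zero]
  let y : T ⟶ S.X₂ := hι.exact.lift _ h2
  have hy : y ≫ ι = k ≫ pullback.snd g' π := hι.exact.lift_f _ _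
  refine ⟨y, pullback.hom_ext ?_ ?_⟩
  · have h3 : y ≫ S.g = x := by
      rw [← cancel_mono u, Category.assoc, hu, reassoc_of% hy, ← h1, Category.assoc]
    rw [Category.assoc, hm₁, reassoc_of% h3, hx]
  · rw [Category.assoc, hm₂, hy]

end Abelian

/-! ### Sections and exactness -/

section SectionsExact

variable {X : CSpace}

theorem app_comp {E F G : Mod X} (f : E ⟶ F) (g : F ⟶ G) (U : Opens X.carrier) (x : Sec E U) :
    app (f ≫ g) U x = app g U (app f U x) := rfl

theorem app_zero {E F : Mod X} (U : Opens X.carrier) (x : Sec E U) : app (0 : E ⟶ F) U x = 0 := rfl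

/-- The functor of sections over `U`, with values in abelian groups. -/
def secFunctor (U : Opens X.carrier) : Mod X ⥤ AddCommGrpCat.{0} :=
  SheafOfModules.toSheaf (ringSheaf X) ⋙ sheafToPresheaf _ _ ⋙ (evaluation _ _).obj (op U)

instance (U : Opens X.carrier) : PreservesFiniteLimits (secFunctor U) := by
  unfold secFunctor
  infer_instance

instance (U : Opens X.carrier) : (secFunctor U).PreservesZeroMorphisms where
  map_zero _ _ := rfl

theorem injective_app_of_mono {E F : Mod X} (f : E ⟶ F) [Mono f] (U : Opens X.carrier) :
    Function.Injective (app f U) :=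
  (AddCommGrpCat.mono_iff_injective ((secFunctor U).map f)).1 inferInstance

theorem mono_of_injective_app {E F : Mod X} (f : E ⟶ F)
    (h : ∀ U, Function.Injective (app f U)) : Mono f :=
  ⟨fun _ _ hgk => hom_ext_app fun U x =>
    h U (congrArg (fun z => app z U x) hgk)⟩

theorem exists_app_eq_of_exact {S : ShortComplex (Mod X)} (hS : S.Exact) [Mono S.f]
    {U : Opens X.carrier} (y : Sec S.X₂ U) (hy : app S.g U y = 0) : ∃ x, app S.f U x = y := by
  have h := hS.map_of_mono_of_preservesKernel (secFunctor U) inferInstance inferInstance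
  rw [ShortComplex.ab_exact_iff] at h
  exact h y hy

/-- Sections which agree locally are equal. -/
theorem sec_ext {E : Mod X} {U : Opens X.carrier} {x y : Sec E U}
    (h : ∀ z ∈ U, ∃ (V : Opens X.carrier) (hV : V ≤ U), z ∈ V ∧ res E hV x = res E hV y) :
    x = y := by
  choose! V hV hz hxy using h
  let F : TopCat.Sheaf AddCommGrpCat.{0} X.carrier := ⟨E.val.presheaf, E.isSheaf⟩
  refine F.eq_of_locally_eq' (fun z : U => V z.1) U (fun z => homOfLE (hV z.1 z.2))
    (fun z hz' => ?_) x y (fun z => hxy z.1 z.2)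
  exact Opens.mem_iSup.2 ⟨⟨z, hz'⟩, hz z hz'⟩

theorem exists_local_lift_of_epi {E F : Mod X} (f : E ⟶ F) [Epi f] {U : Opens X.carrier}
    (y : Sec F U) {x : X.carrier} (hx : x ∈ U) :
    ∃ (V : Opens X.carrier) (h : V ≤ U), x ∈ V ∧ ∃ z : Sec E V, app f V z = res F h y := by
  have h : Sheaf.IsLocallySurjective ((SheafOfModules.toSheaf (ringSheaf X)).map f) :=
    (Sheaf.isLocallySurjective_iff_epi' _ _).2 inferInstance
  have h' := Presheaf.imageSieve_mem (Opens.grothendieckTopology X.carrier)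
    ((SheafOfModules.toSheaf (ringSheaf X)).map f).hom (U := op U) y
  obtain ⟨V, i, ⟨z, hz⟩, hV⟩ := h' x hx
  exact ⟨V, i.le, hV, z, hz⟩

theorem epi_of_local_lift {E F : Mod X} (f : E ⟶ F)
    (h : ∀ (U : Opens X.carrier) (y : Sec F U), ∀ x ∈ U,
      ∃ (V : Opens X.carrier) (h : V ≤ U), x ∈ V ∧ ∃ z : Sec E V, app f V z = res F h y) :
    Epi f := by
  refine ⟨fun g k hgk => hom_ext_app fun U y => sec_ext fun x hx => ?_⟩
  obtain ⟨V, hV, hxV, z, hz⟩ := h U y x hx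
  refine ⟨V, hV, hxV, ?_⟩
  rw [← app_res, ← app_res, ← hz]
  exact congrArg (fun u => app u V z) hgk

/-- A morphism whose values on sections lie in the image of a monomorphism factors through it. -/
theorem exists_lift_of_mono {A G T : Mod X} (a : A ⟶ G) [Mono a] (h : T ⟶ G)
    (H : ∀ (U : Opens X.carrier) (t : Sec T U), ∃ z, app a U z = app h U t) :
    ∃ l : T ⟶ A, l ≫ a = h := by
  have h0 : h ≫ cokernel.π a = 0 := hom_ext_app fun U t => by
    obtain ⟨z, hz⟩ := H U t
    rw [app_comp, ← hz, ← app_comp, cokernel.condition, app_zero, app_zero]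
  exact ⟨(shortExact_cokernel a).exact.lift h h0, (shortExact_cokernel a).exact.lift_f h h0⟩

/-- A section which is locally in the image of a monomorphism is in the image. -/
theorem exists_app_eq_of_local {A G : Mod X} (a : A ⟶ G) [Mono a] {U : Opens X.carrier}
    (y : Sec G U) (h : ∀ x ∈ U, ∃ (V : Opens X.carrier) (h : V ≤ U), x ∈ V ∧
      ∃ z : Sec A V, app a V z = res G h y) : ∃ z, app a U z = y := by
  refine exists_app_eq_of_exact (S := ShortComplex.mk a (cokernel.π a) (cokernel.condition a))
    (shortExact_cokernel a).exact y (sec_ext fun x hx => ?_)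
  obtain ⟨V, hV, hxV, z, hz⟩ := h x hx
  refine ⟨V, hV, hxV, ?_⟩
  change res _ hV (app (cokernel.π a) U y) = _
  rw [← app_res, ← hz, ← app_comp, cokernel.condition, app_zero]
  exact (map_zero ((cokernel a).val.restrictₛₗ (homOfLE hV).op)).symm

theorem res_zero (E : Mod X) {U V : Opens X.carrier} (h : V ≤ U) :
    res E h (0 : Sec E U) = 0 :=
  map_zero (E.val.restrictₛₗ (homOfLE h).op)

/-- Injectivity on sections may be checked on small open sets. -/
theorem injective_app_of_local {E F : Mod X} (f : E ⟶ F)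
    (h : ∀ x : X.carrier, ∃ U : Opens X.carrier, x ∈ U ∧ ∀ V ≤ U, ∀ y : Sec E V,
      app f V y = 0 → y = 0) (U : Opens X.carrier) : Function.Injective (app f U) := by
  rw [injective_iff_map_eq_zero]
  intro y hy
  refine sec_ext fun x hx => ?_
  obtain ⟨V, hxV, hV⟩ := h x
  refine ⟨U ⊓ V, inf_le_left, ⟨hx, hxV⟩, ?_⟩
  rw [res_zero]
  exact hV _ inf_le_right _ (by rw [app_res, hy, res_zero])

/-- Finitely many open neighbourhoods contain a common one. -/
theorem exists_le_of_finite {ι : Type*} [Finite ι] {U : Opens X.carrier} {x : X.carrier}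
    (hx : x ∈ U) (V : ι → Opens X.carrier) (hV : ∀ i, x ∈ V i) :
    ∃ W : Opens X.carrier, W ≤ U ∧ x ∈ W ∧ ∀ i, W ≤ V i :=
  ⟨U ⊓ ⟨⋂ i, (V i : Set X.carrier), isOpen_iInter_of_finite fun i => (V i).isOpen⟩, inf_le_left,
    ⟨hx, Set.mem_iInter.2 hV⟩, fun i => inf_le_right.trans fun _ hp => Set.mem_iInter.1 hp i⟩

/-- A complex of sheaves of modules which is exact on all sufficiently small open sets, except that
sections of the quotient only have to lift locally, is a short exact sequence. -/
theorem shortExact_of_local {A B E : Mod X} (a : A ⟶ B) (q : B ⟶ E)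
    (w : ∀ (U : Opens X.carrier) (x : Sec A U), app q U (app a U x) = 0)
    (h : ∀ x : X.carrier, ∃ U : Opens X.carrier, x ∈ U ∧
      (∀ V ≤ U, ∀ y : Sec A V, app a V y = 0 → y = 0) ∧
      (∀ V ≤ U, ∀ y : Sec B V, app q V y = 0 → ∃ z, app a V z = y) ∧
      (∀ V ≤ U, ∀ y : Sec E V, ∀ x ∈ V,
        ∃ (V' : Opens X.carrier) (h : V' ≤ V), x ∈ V' ∧ ∃ z, app q V' z = res E h y)) :
    ∃ w : a ≫ q = 0, (ShortComplex.mk a q w).ShortExact := by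
  have : Mono a := mono_of_injective_app a (injective_app_of_local a fun x => by
    obtain ⟨U, hx, h1, -⟩ := h x
    exact ⟨U, hx, h1⟩)
  have : Epi q := epi_of_local_lift q fun U y x hx => by
    obtain ⟨V, hxV, -, -, h3⟩ := h x
    obtain ⟨V', h', hxV', z, hz⟩ := h3 (U ⊓ V) inf_le_right (res E inf_le_left y) x ⟨hx, hxV⟩
    exact ⟨V', h'.trans inf_le_left, hxV', z, by rw [hz, res_res]⟩
  refine ⟨hom_ext_app fun U x => w U x, shortExact_of_lift _ _ _ fun T k hk => ?_⟩
  refine exists_lift_of_mono a k fun U t => exists_app_eq_of_local a _ fun x hx => ?_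
  obtain ⟨V, hxV, -, h2, -⟩ := h x
  refine ⟨U ⊓ V, inf_le_left, ⟨hx, hxV⟩, h2 _ inf_le_right _ ?_⟩
  rw [app_res]
  change res _ _ (app (k ≫ q) U t) = 0
  rw [hk, app_zero, res_zero]

end SectionsExact

/-! ### Restriction to open subsets -/

section Inter

variable {X : CSpace}

/-- The functoriality of `V ↦ E(V ∩ U)` in `E`. -/
def interMap (U : Opens X.carrier) {E F : Mod X} (f : E ⟶ F) : inter U E ⟶ inter U F :=
  (SheafOfModules.pushforward.{0} (interRingHom U)).map f

theorem app_interMap (U : Opens X.carrier) {E F : Mod X} (f : E ⟶ F) (V : Opens X.carrier)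
    (x : Sec E (V ⊓ U)) : app (interMap U f) V (toInter U E x) = toInter U F (app f (V ⊓ U) x) :=
  rfl

theorem toInterHom_naturality (U : Opens X.carrier) {E F : Mod X} (f : E ⟶ F) :
    f ≫ toInterHom U F = toInterHom U E ≫ interMap U f :=
  hom_ext_app fun _ x => (app_res f inf_le_left x).symm

instance (U : Opens X.carrier) {E F : Mod X} (f : E ⟶ F) [Mono f] : Mono (interMap U f) :=
  mono_of_injective_app _ fun V => injective_app_of_mono f (V ⊓ U)

/-- The restriction maps `E(V ∩ U) → E(V ∩ U')` for `U' ⊆ U`. -/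
def interRes {U U' : Opens X.carrier} (h : U' ≤ U) (E : Mod X) : inter U E ⟶ inter U' E :=
  homOfApp
    (fun V =>
      { toFun := fun x => toInter U' E (res E (inf_le_inf_left V h) (x : Sec E (V ⊓ U)))
        map_add' := fun x y => res_add E (inf_le_inf_left V h) (x : Sec E (V ⊓ U)) y
        map_smul' := fun r x => by
          refine (res_smul E (inf_le_inf_left V h) (resFn inf_le_left r) (x : Sec E (V ⊓ U))).trans ?_
          rw [resFn_resFn]
          rfl })
    (fun {V W} h' x =>
      (res_res E (inf_le_inf_right U h') (inf_le_inf_left W h) (x : Sec E (V ⊓ U))).trans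
        (res_res E (inf_le_inf_left V h) (inf_le_inf_right U' h') (x : Sec E (V ⊓ U))).symm)

theorem toInterHom_interRes {U U' : Opens X.carrier} (h : U' ≤ U) (E : Mod X) :
    toInterHom U E ≫ interRes h E = toInterHom U' E :=
  hom_ext_app fun V x => res_res E _ (inf_le_inf_left V h) x

/-- A morphism of sheaves which vanishes locally is zero. -/
theorem eq_zero_of_comp_toInterHom {E F : Mod X} (f : E ⟶ F)
    (h : ∀ x : X.carrier, ∃ U : Opens X.carrier, x ∈ U ∧ f ≫ toInterHom U F = 0) : f = 0 := by
  refine hom_ext_app fun V y => sec_ext fun x hx => ?_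
  obtain ⟨U, hxU, hU⟩ := h x
  refine ⟨V ⊓ U, inf_le_left, ⟨hx, hxU⟩, ?_⟩
  rw [app_zero, res_zero]
  exact congrArg (fun g => app g V y) hU

/-- The morphism with prescribed values on a local basis: sections `y₁, …, yₙ` of `G` over `U` define a morphism
from a sheaf with a local basis over `U` to `V ↦ G(V ∩ U)`. -/
def ofBasis {P G : Mod X} {U : Opens X.carrier} {n : ℕ} {e : Fin n → Sec P U}
    (he : IsLocalBasis P U e) (y : Fin n → Sec G U) : P ⟶ inter U G :=
  homOfApp
    (fun V =>
      { toFun := fun x => toInter U G (∑ i,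
          coeff he inf_le_right (res P (inf_le_left : V ⊓ U ≤ V) x) i • res G inf_le_right (y i))
        map_add' := fun x z => by
          simp only [res_add, coeff_add, add_smul, Finset.sum_add_distrib]
          rfl
        map_smul' := fun r x => by
          simp only [res_smul, coeff_smul, mul_smul, ← Finset.smul_sum]
          rfl })
    (fun {V W} h x => by
      have : ∑ i, coeff he inf_le_right (res P (inf_le_left : W ⊓ U ≤ W) (res P h x)) i •
            res G inf_le_right (y i) =
          res G (inf_le_inf_right U h)
            (∑ i, coeff he inf_le_right (res P (inf_le_left : V ⊓ U ≤ V) x) i •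
              res G (inf_le_right : V ⊓ U ≤ U) (y i)) := by
        rw [res_sum]
        refine Finset.sum_congr rfl fun i _ => ?_
        rw [res_smul, res_res, ← coeff_res he, res_res, res_res]
      exact this)

theorem app_ofBasis {P G : Mod X} {U : Opens X.carrier} {n : ℕ} {e : Fin n → Sec P U}
    (he : IsLocalBasis P U e) (y : Fin n → Sec G U) (V : Opens X.carrier) (x : Sec P V) :
    app (ofBasis he y) V x = toInter U G (∑ i,
      coeff he inf_le_right (res P (inf_le_left : V ⊓ U ≤ V) x) i • res G inf_le_right (y i)) :=
  rfl

theorem IsLocalBasis.restrict {P : Mod X} {U : Opens X.carrier} {n : ℕ} {e : Fin n → Sec P U}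
    (he : IsLocalBasis P U e) {V : Opens X.carrier} (h : V ≤ U) :
    IsLocalBasis P V fun i => res P h (e i) := by
  intro W hW
  have := he W (hW.trans h)
  simp only [res_res]
  exact this

theorem app_sum_smul {E F : Mod X} (f : E ⟶ F) {U : Opens X.carrier} {n : ℕ}
    (c : Fin n → Fn X U) (x : Fin n → Sec E U) :
    app f U (∑ i, c i • x i) = ∑ i, c i • app f U (x i) := by
  rw [map_sum]
  exact Finset.sum_congr rfl fun i _ => map_smul _ _ _

/-- Morphisms from a locally free sheaf to a quotient lift locally. -/
theorem exists_local_lift_of_isLocallyFree {P G K : Mod X} (hP : IsLocallyFree P) (q : G ⟶ K)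
    [Epi q] {U : Opens X.carrier} (ρ : P ⟶ inter U K) {x : X.carrier} (hx : x ∈ U) :
    ∃ (U' : Opens X.carrier) (h : U' ≤ U), x ∈ U' ∧
      ∃ ρ' : P ⟶ inter U' G, ρ' ≫ interMap U' q = ρ ≫ interRes h K := by
  obtain ⟨U₁, hx₁, n, e, he⟩ := hP x
  let z : Fin n → Sec K (U₁ ⊓ U) := fun i => app ρ U₁ (e i)
  choose V hV hxV y hy using fun i => exists_local_lift_of_epi q (z i) (x := x) ⟨hx₁, hx⟩
  obtain ⟨U', hU'U, hxU', hU'V⟩ := exists_le_of_finite (U := U₁ ⊓ U) ⟨hx₁, hx⟩ V hxV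
  have hU'₁ : U' ≤ U₁ := hU'U.trans inf_le_left
  have hU' : U' ≤ U := hU'U.trans inf_le_right
  have he' := he.restrict hU'₁
  refine ⟨U', hU', hxU',
    ofBasis he' (fun i => res G (hU'V i) (y i)), ?_⟩
  refine hom_ext_app fun W p => ?_
  rw [app_comp, app_comp, app_ofBasis, app_interMap, app_sum_smul]
  have h1 : app (interRes hU' K) W (app ρ W p) =
      toInter U' K (res K (inf_le_inf_left W hU') (app ρ W p : Sec K (W ⊓ U))) := rfl
  rw [h1]
  refine congrArg (toInter U' K) ?_
  -- both sides are linear combinations with the same coefficients, so compare them on the basis;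
  -- the values of `ρ` over `W ∩ U'` live over `(W ∩ U') ∩ U`, equal to `W ∩ U'` only propositionally
  have h2 : app ρ (W ⊓ U') (res P inf_le_left p) =
      toInter U K (res K (inf_le_inf_right U inf_le_left) (app ρ W p : Sec K (W ⊓ U))) :=
    app_res ρ inf_le_left p
  have h3 := sum_coeff he' (inf_le_right : W ⊓ U' ≤ U') (res P inf_le_left p)
  have h4 : res K (le_inf le_rfl (inf_le_right.trans hU') : W ⊓ U' ≤ (W ⊓ U') ⊓ U)
      (app ρ (W ⊓ U') (res P inf_le_left p) : Sec K ((W ⊓ U') ⊓ U)) =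
        res K (inf_le_inf_left W hU') (app ρ W p : Sec K (W ⊓ U)) := by
    rw [h2]
    exact res_res _ _ _ _
  rw [← h4, ← h3, app_sum_smul]
  let κ : Fin n → Sec K ((W ⊓ U') ⊓ U) := fun i =>
    app ρ (W ⊓ U') (res P inf_le_right (res P hU'₁ (e i)))
  change _ = res K _ (∑ i, resFn (inf_le_left : (W ⊓ U') ⊓ U ≤ W ⊓ U')
    (coeff he' inf_le_right (res P inf_le_left p) i) • κ i)
  rw [res_sum, h3]
  refine Finset.sum_congr rfl fun i _ => ?_
  rw [res_smul, resFn_resFn, resFn_self]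
  congr 1
  have h5 : κ i = res K (inf_le_inf_right U (inf_le_right.trans hU'₁)) (z i) :=
    (congrArg (app ρ (W ⊓ U')) (res_res P _ _ (e i))).trans
      (app_res ρ (inf_le_right.trans hU'₁ : W ⊓ U' ≤ U₁) (e i))
  rw [h5, app_res, app_res, hy, res_res, res_res, res_res]

end Inter

/-! ### Flatness of locally free sheaves -/

section Flat

open Abelian

variable {X Y : CSpace}

/-- Every epimorphism onto `E` splits locally. -/
def IsLocallyProjective (E : Mod X) : Prop :=
  ∀ (G : Mod X) (q : G ⟶ E) [Epi q] (x : X.carrier), ∃ U : Opens X.carrier, x ∈ U ∧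
    ∃ σ : E ⟶ inter U G, σ ≫ interMap U q = toInterHom U E

theorem IsLocallyFree.isLocallyProjective {E : Mod X} (hE : IsLocallyFree E) :
    IsLocallyProjective E := by
  intro G q _ x
  obtain ⟨U, h, hx, σ, hσ⟩ :=
    exists_local_lift_of_isLocallyFree hE q (toInterHom ⊤ E) (x := x) trivial
  exact ⟨U, hx, σ, by rw [hσ, toInterHom_interRes]⟩

/-- For a short exact sequence `0 → A → B → E → 0`, the sequence of sheaves `V ↦ A(V ∩ U)`,
`V ↦ B(V ∩ U)`, `V ↦ E(V ∩ U)` is left exact. -/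
theorem exists_lift_inter {A B E : Mod X} {a : A ⟶ B} {q : B ⟶ E} {w : a ≫ q = 0}
    (hS : (ShortComplex.mk a q w).ShortExact) {U : Opens X.carrier} {T : Mod X}
    (h : T ⟶ inter U B) (hq : h ≫ interMap U q = 0) : ∃ l, l ≫ interMap U a = h := by
  have : Mono a := hS.mono_f
  have : Mono (ShortComplex.mk a q w).f := this
  exact exists_lift_of_mono (interMap U a) h fun V t =>
    exists_app_eq_of_exact hS.exact (U := V ⊓ U) (app h V t)
      (congrArg (fun g => app g V t) hq)

/-- The kernel of an epimorphism between locally free sheaves is locally projective. -/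
theorem isLocallyProjective_kernel {K P E : Mod X} {a : K ⟶ P} {q : P ⟶ E} {w : a ≫ q = 0}
    (hS : (ShortComplex.mk a q w).ShortExact) (hP : IsLocallyFree P) (hE : IsLocallyFree E) :
    IsLocallyProjective K := by
  intro G r _ x
  have : Epi q := hS.epi_g
  have : Mono a := hS.mono_f
  obtain ⟨U, hx, σ, hσ⟩ := hE.isLocallyProjective P q x
  obtain ⟨ρ, hρ⟩ := exists_lift_inter hS (toInterHom U P - q ≫ σ) (by
    rw [Preadditive.sub_comp, Category.assoc, hσ, toInterHom_naturality, sub_self])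
  have haρ : a ≫ ρ = toInterHom U K := by
    rw [← cancel_mono (interMap U a), Category.assoc, hρ, Preadditive.comp_sub, reassoc_of% w,
      zero_comp, sub_zero, toInterHom_naturality]
  obtain ⟨U', h, hx', ρ', hρ'⟩ := exists_local_lift_of_isLocallyFree hP r ρ hx
  refine ⟨U', hx', a ≫ ρ', ?_⟩
  rw [Category.assoc, hρ', reassoc_of% haρ, toInterHom_interRes]

/-- An extension of a locally projective sheaf splits locally. -/
theorem exists_local_retraction {A G E : Mod X} {a : A ⟶ G} {q : G ⟶ E} {w : a ≫ q = 0}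
    (hS : (ShortComplex.mk a q w).ShortExact) (hE : IsLocallyProjective E) (x : X.carrier) :
    ∃ U : Opens X.carrier, x ∈ U ∧ ∃ r : G ⟶ inter U A, a ≫ r = toInterHom U A := by
  have : Epi q := hS.epi_g
  have : Mono a := hS.mono_f
  obtain ⟨U, hx, σ, hσ⟩ := hE G q x
  obtain ⟨ρ, hρ⟩ := exists_lift_inter hS (toInterHom U G - q ≫ σ) (by
    rw [Preadditive.sub_comp, Category.assoc, hσ, toInterHom_naturality, sub_self])
  refine ⟨U, hx, ρ, ?_⟩
  rw [← cancel_mono (interMap U a), Category.assoc, hρ, Preadditive.comp_sub, reassoc_of% w,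
    zero_comp, sub_zero, toInterHom_naturality]

/-- The identification of `V ↦ M(f⁻¹ V ∩ f⁻¹ U)` with the direct image of `V ↦ M(V ∩ f⁻¹ U)`. -/
def pushforwardInter (f : X ⟶ Y) (U : Opens Y.carrier) (M : Mod X) :
    inter U ((pushforward f).obj M) ⟶
      (pushforward f).obj (inter ((Opens.map f.hom.base).obj U) M) :=
  homOfApp
    (fun V =>
      { toFun := fun x => x
        map_add' := fun _ _ => rfl
        map_smul' := fun r x => by
          let y : Sec M ((Opens.map f.hom.base).obj (V ⊓ U)) := x
          change pullFn f (V ⊓ U) (resFn inf_le_left r) • y = _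
          rw [pullFn_resFn]
          rfl })
    (fun _ _ => rfl)

theorem toInterHom_pushforwardInter (f : X ⟶ Y) (U : Opens Y.carrier) (M : Mod X) :
    toInterHom U ((pushforward f).obj M) ≫ pushforwardInter f U M =
      (pushforward f).map (toInterHom ((Opens.map f.hom.base).obj U) M) :=
  hom_ext_app fun _ _ => rfl

/-- The natural map `f^*(V ↦ A(V ∩ U)) → (V ↦ (f^* A)(V ∩ f⁻¹ U))`. -/
def pullbackInter (f : X ⟶ Y) (U : Opens Y.carrier) (A : Mod Y) :
    (pullback f).obj (inter U A) ⟶ inter ((Opens.map f.hom.base).obj U) ((pullback f).obj A) :=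
  ((pullbackAdj f).homEquiv (inter U A)
    (inter ((Opens.map f.hom.base).obj U) ((pullback f).obj A))).symm
    (interMap U ((pullbackAdj f).unit.app A) ≫ pushforwardInter f U _)

theorem map_toInterHom_pullbackInter (f : X ⟶ Y) (U : Opens Y.carrier) (A : Mod Y) :
    (pullback f).map (toInterHom U A) ≫ pullbackInter f U A =
      toInterHom ((Opens.map f.hom.base).obj U) ((pullback f).obj A) := by
  unfold pullbackInter
  rw [← Adjunction.homEquiv_naturality_left_symm, Equiv.symm_apply_eq, Adjunction.homEquiv_unit,
    ← toInterHom_pushforwardInter, ← Category.assoc, ← Category.assoc]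
  exact congrArg (· ≫ pushforwardInter f U _)
    (toInterHom_naturality U ((pullbackAdj f).unit.app A)).symm

instance (f : X ⟶ Y) : (pullback f).IsLeftAdjoint := (pullbackAdj f).isLeftAdjoint

instance (f : X ⟶ Y) : (pushforward f).IsRightAdjoint := (pullbackAdj f).isRightAdjoint

instance (f : X ⟶ Y) : (pushforward f).PreservesZeroMorphisms where
  map_zero _ _ := rfl

instance (f : X ⟶ Y) : (pullback f).PreservesZeroMorphisms :=
  Functor.preservesZeroMorphisms_of_isLeftAdjoint _

theorem epi_pullback_map (f : X ⟶ Y) {A B : Mod Y} (q : A ⟶ B) [Epi q] :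
    Epi ((pullback f).map q) :=
  (pullback f).map_epi q

theorem mono_pushforward_map (f : X ⟶ Y) {A B : Mod X} (q : A ⟶ B) [Mono q] :
    Mono ((pushforward f).map q) :=
  (pushforward f).map_mono q

/-- Inverse images preserve the injectivity of a morphism with locally projective cokernel, as a local
retraction pulls back to a local retraction. -/
theorem mono_pullback_map (f : X ⟶ Y) {A G E : Mod Y} {a : A ⟶ G} {q : G ⟶ E} {w : a ≫ q = 0}
    (hS : (ShortComplex.mk a q w).ShortExact) (hE : IsLocallyProjective E) :
    Mono ((pullback f).map a) := by
  refine Preadditive.mono_of_cancel_zero _ fun {T} g hg =>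
    eq_zero_of_comp_toInterHom g fun x => ?_
  obtain ⟨U, hx, r, hr⟩ := exists_local_retraction hS hE (f.hom.base x)
  refine ⟨(Opens.map f.hom.base).obj U, hx, ?_⟩
  rw [← map_toInterHom_pullbackInter, ← hr, Functor.map_comp, Category.assoc, reassoc_of% hg,
    zero_comp]

/-- The inverse image of an extension of a locally projective sheaf is an extension. -/
theorem shortExact_pullback_map (f : X ⟶ Y) {A G E : Mod Y} {a : A ⟶ G} {q : G ⟶ E}
    {w : a ≫ q = 0} (hS : (ShortComplex.mk a q w).ShortExact) (hE : IsLocallyProjective E) :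
    ((ShortComplex.mk a q w).map (pullback f)).ShortExact := by
  have h : Epi q := hS.epi_g
  exact
    { exact := hS.exact.map_of_epi_of_preservesCokernel (pullback f) h inferInstance
      mono_f := mono_pullback_map f hS hE
      epi_g := epi_pullback_map f q }

/-- The direct image along a homeomorphism preserves epimorphisms. -/
theorem epi_pushforward_map (f : X ⟶ Y) (hf : IsHomeomorph f.hom.base) {E F : Mod X} (q : E ⟶ F)
    [Epi q] : Epi ((pushforward f).map q) := by
  refine epi_of_local_lift _ fun U y x hx => ?_
  obtain ⟨x, rfl⟩ := hf.surjective x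
  obtain ⟨V, hV, hxV, z, hz⟩ := exists_local_lift_of_epi q
    (U := (Opens.map f.hom.base).obj U) y (x := x) hx
  let V' : Opens Y.carrier := ⟨f.hom.base '' V, hf.isOpenMap _ V.isOpen⟩
  have hV'U : V' ≤ U := by
    rintro _ ⟨v, hv, rfl⟩
    exact hV hv
  have hV'V : (Opens.map f.hom.base).obj V' ≤ V := by
    rintro v ⟨v', hv', h⟩
    exact hf.injective h ▸ hv'
  refine ⟨V', hV'U, ⟨x, hxV, rfl⟩, res E hV'V z, ?_⟩
  refine (app_res q hV'V z).trans ?_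
  rw [hz]
  exact res_res F hV hV'V _

theorem shortExact_pushforward_map (f : X ⟶ Y) (hf : IsHomeomorph f.hom.base)
    {S : ShortComplex (Mod X)} (hS : S.ShortExact) : (S.map (pushforward f)).ShortExact := by
  have h : Mono S.f := hS.mono_f
  have : Epi S.g := hS.epi_g
  exact
    { exact := hS.exact.map_of_mono_of_preservesKernel (pushforward f) h inferInstance
      mono_f := mono_pushforward_map f S.f
      epi_g := epi_pushforward_map f hf S.g }

/-- For locally projective `E`, `Ext¹(E, f_* C)` embeds into `Ext¹(f^* E, C)`: if the inverse image
of an extension splits, then so does the extension, by adjunction. -/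
theorem subsingleton_ext_one_pushforward (f : X ⟶ Y) {E : Mod Y} (hE : IsLocallyProjective E)
    {C : Mod X} (h : Subsingleton (Ext ((pullback f).obj E) C 1)) :
    Subsingleton (Ext E ((pushforward f).obj C) 1) := by
  refine subsingleton_ext_one_of_split fun G b q w hS => ?_
  obtain ⟨g, hg⟩ := exists_extend_of_subsingleton_ext (shortExact_pullback_map f hS hE) h
    ((pullbackAdj f).counit.app C)
  refine ⟨(pullbackAdj f).homEquiv G C g, ?_⟩
  refine ((pullbackAdj f).homEquiv_naturality_left b g).symm.trans ?_
  refine (congrArg _ hg).trans ?_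
  rw [Adjunction.homEquiv_unit, Adjunction.right_triangle_components]

/-- If `f_*` is exact then `Ext¹(f^* B, V)` embeds into `Ext¹(B, f_* V)`. -/
theorem subsingleton_ext_one_pullback (f : X ⟶ Y) (hf : IsHomeomorph f.hom.base) {B : Mod Y}
    {V : Mod X} (h : Subsingleton (Ext B ((pushforward f).obj V) 1)) :
    Subsingleton (Ext ((pullback f).obj B) V 1) := by
  refine subsingleton_ext_one_of_split fun G b q w hS => ?_
  have : Mono b := hS.mono_f
  obtain ⟨g, hg⟩ := exists_lift_of_subsingleton_ext (shortExact_pushforward_map f hf hS) h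
    ((pullbackAdj f).unit.app B)
  change g ≫ (pushforward f).map q = _ at hg
  let s := ((pullbackAdj f).homEquiv B G).symm g
  have hs : s ≫ q = 𝟙 _ := by
    refine ((pullbackAdj f).homEquiv_naturality_right_symm g q).symm.trans ?_
    refine (congrArg _ hg).trans ?_
    rw [Equiv.symm_apply_eq, Adjunction.homEquiv_id]
  have hk : (𝟙 G - q ≫ s) ≫ q = 0 := by
    rw [Preadditive.sub_comp, Category.id_comp, Category.assoc, hs, Category.comp_id, sub_self]
  have hl : hS.exact.lift _ hk ≫ b = 𝟙 G - q ≫ s := hS.exact.lift_f _ hk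
  refine ⟨hS.exact.lift _ hk, ?_⟩
  rw [← cancel_mono b, Category.assoc, hl, Preadditive.comp_sub, reassoc_of% w, zero_comp,
    sub_zero, Category.comp_id, Category.id_comp]

end Flat

/-! ### Vanishing of `Ext²` on an infinitesimal thickening -/

section Thickening

open Abelian

variable {X Z : CSpace}

/-- As `p_* s_* I = I`, the direct image of `s_* I` is injective although `s_* I` need not be. -/
theorem injective_pushforward_section (p : Z ⟶ X) (s : X ⟶ Z) (hsp : s ≫ p = 𝟙 X) (I : Mod X)
    [Injective I] :
    Injective ((pushforward p).obj ((pushforward s).obj I)) := by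
  have h : ∀ f : X ⟶ X, f = 𝟙 X → Injective ((pushforward f).obj I) := by
    rintro _ rfl
    have e : (pushforward (𝟙 X)).obj I = I := rfl
    rw [e]
    infer_instance
  have e : (pushforward p).obj ((pushforward s).obj I) = (pushforward (s ≫ p)).obj I := rfl
  rw [e]
  exact h _ hsp

/-- For injective `I` one has `Ext²(p^* B, s_* I) = 0`: let `V = L / s_* I` with `L` injective. Then
`Ext²(p^* B, s_* I)` is a quotient of `Ext¹(p^* B, V)`, which vanishes if `Ext¹(B, p_* V)` does, and
`p_* V` is the quotient of `p_* L` by the injective sheaf `p_* s_* I = I`. -/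
theorem subsingleton_ext_two_pullback (p : Z ⟶ X) (s : X ⟶ Z) (hsp : s ≫ p = 𝟙 X)
    (hp : IsHomeomorph p.hom.base) {B : Mod X} (hB : IsLocallyFree B) (I : Mod X) [Injective I] :
    Subsingleton (Ext ((pullback p).obj B) ((pushforward s).obj I) 2) := by
  have hS := shortExact_cokernel (Injective.ι ((pushforward s).obj I))
  have := injective_pushforward_section p s hsp I
  refine subsingleton_ext_left hS ?_ (Ext.subsingleton_of_injective _ _ _)
  refine subsingleton_ext_one_pullback p hp ?_
  refine subsingleton_ext_right (shortExact_pushforward_map p hp hS) ?_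
    (Ext.subsingleton_of_injective B ((pushforward p).obj ((pushforward s).obj I)) 1)
  exact subsingleton_ext_one_pushforward p hB.isLocallyProjective
    (Ext.subsingleton_of_injective _ _ _)

/-- The counit `p^* p_* E → E` along a homeomorphism is an epimorphism, as `p_* E` has the same
sections as `E`. -/
theorem epi_counit (p : Z ⟶ X) {E : Mod Z} (hp : IsHomeomorph p.hom.base) :
    Epi ((pullbackAdj p).counit.app E) := by
  refine epi_of_local_lift _ fun U y x hx => ?_
  let V : Opens X.carrier := ⟨p.hom.base '' U, hp.isOpenMap _ U.isOpen⟩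
  have hVU : (Opens.map p.hom.base).obj V = U :=
    Opens.ext (Set.preimage_image_eq _ hp.injective)
  have h : ∀ (W : Opens Z.carrier), (Opens.map p.hom.base).obj V = W → ∀ y : Sec E W,
      ∃ z, app ((pullbackAdj p).counit.app E) W z = y := by
    rintro _ rfl y
    exact ⟨app ((pullbackAdj p).unit.app ((pushforward p).obj E)) V y,
      congrArg (fun g => app g V y) ((pullbackAdj p).right_triangle_components E)⟩
  obtain ⟨z, hz⟩ := h U hVU y
  exact ⟨U, le_rfl, hx, z, by rw [hz, res_self]⟩

/-- Let `p : Z → X` be a homeomorphism with a section `s`, and `E` a locally free sheaf on `Z` with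
`p_* E` locally free. Then the vanishing of `Ext²` of `s^* E` with values in `N` implies that of
`Ext²(E, s_* N)`. For injective `N` this follows from the resolution
`0 → K → p^* p_* E → E → 0`, and in general by dimension shifting. -/
theorem subsingleton_ext_two_pushforward (p : Z ⟶ X) (s : X ⟶ Z) (hsp : s ≫ p = 𝟙 X)
    (hp : IsHomeomorph p.hom.base) (hs : IsHomeomorph s.hom.base) {E : Mod Z} (hE : IsLocallyFree E)
    (hpE : IsLocallyFree ((pushforward p).obj E)) {N : Mod X}
    (h : Subsingleton (Ext ((pullback s).obj E) N 2)) :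
    Subsingleton (Ext E ((pushforward s).obj N) 2) := by
  have hinj : ∀ I : Mod X, Injective I → Subsingleton (Ext E ((pushforward s).obj I) 2) := by
    intro I _
    have : Epi ((pullbackAdj p).counit.app E) := epi_counit p hp
    have hK : (ShortComplex.mk _ _ (kernel.condition ((pullbackAdj p).counit.app E))).ShortExact :=
      ⟨ShortComplex.exact_kernel _⟩
    have hP : IsLocallyFree ((pullback p).obj ((pushforward p).obj E)) :=
      isLocallyFree_of_isCartesian _ (ModSpace.isCartesian_pull p _) hpE
    exact subsingleton_ext_quotient hK
      (subsingleton_ext_one_pushforward s (isLocallyProjective_kernel hK hP hE)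
        (Ext.subsingleton_of_injective _ _ _))
      (subsingleton_ext_two_pullback p s hsp hp hpE I)
  have hS := shortExact_cokernel (Injective.ι N)
  refine subsingleton_ext_left (shortExact_pushforward_map s hs hS) ?_ (hinj _ inferInstance)
  exact subsingleton_ext_one_pushforward s hE.isLocallyProjective
    (subsingleton_ext_right hS (Ext.subsingleton_of_injective _ _ _) h)

end Thickening

/-! ### Functions on a thickening -/

section Functions

variable {A A' : Type} [CommRing A] [Algebra ℂ A] [Module.Finite ℂ A]
  [CommRing A'] [Algebra ℂ A'] [Module.Finite ℂ A'] {X Y : CSpace}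

/-- Functions on `Spec A × X` over `V` are elements of `A ⊗ 𝒪_X(V)`. -/
def tensorEquiv (A : Type) [CommRing A] [Algebra ℂ A] [Module.Finite ℂ A] (X : CSpace)
    (V : Opens X.carrier) :
    (A ⊗[ℂ] (X.presheaf.obj (op V))) ≃+* Fn (thicken A X) V :=
  RingEquiv.refl _

/-- Functions on `X` over `V` as elements of the `ℂ`-algebra `𝒪_X(V)`. -/
def algEquivFn (X : CSpace) (V : Opens X.carrier) : X.presheaf.obj (op V) ≃+* Fn X V :=
  RingEquiv.refl _

/-- Constant functions on `X`. -/
def constFn (X : CSpace) (V : Opens X.carrier) : ℂ →+* Fn X V :=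
  (algEquivFn X V).toRingHom.comp (algebraMap ℂ (X.presheaf.obj (op V)))

/-- The functions on `Spec A × X` coming from `X`. -/
def incFn (A : Type) [CommRing A] [Algebra ℂ A] [Module.Finite ℂ A] {X : CSpace}
    (V : Opens X.carrier) : Fn X V →+* Fn (thicken A X) V :=
  pullFn (thickenProj A X) V

/-- The functions on `Spec A × X` coming from `Spec A`. -/
def scalFn (X : CSpace) (V : Opens X.carrier) : A →+* Fn (thicken A X) V :=
  (tensorEquiv A X V).toRingHom.comp
    (Algebra.TensorProduct.includeLeftRingHom : A →+* A ⊗[ℂ] (X.presheaf.obj (op V)))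

/-- The map `ℓ ⊗ 1 : A ⊗ 𝒪_X → A' ⊗ 𝒪_X` for a linear map `ℓ : A → A'`. -/
def mapFn (ℓ : A →ₗ[ℂ] A') {X : CSpace} (V : Opens X.carrier) :
    Fn (thicken A X) V →+ Fn (thicken A' X) V :=
  ((tensorEquiv A' X V : _ →+ _).comp
    (LinearMap.rTensor (X.presheaf.obj (op V)) ℓ).toAddMonoidHom).comp
      ((tensorEquiv A X V).symm : _ →+ _)

/-- The map `ℓ ⊗ 1 : A ⊗ 𝒪_X → 𝒪_X` for a linear functional `ℓ : A → ℂ`. -/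
def coordFn (ℓ : A →ₗ[ℂ] ℂ) {X : CSpace} (V : Opens X.carrier) :
    Fn (thicken A X) V →+ Fn X V :=
  ((algEquivFn X V : _ →+ _).comp
    ((TensorProduct.lid ℂ (X.presheaf.obj (op V))).toLinearMap ∘ₗ
      LinearMap.rTensor (X.presheaf.obj (op V)) ℓ).toAddMonoidHom).comp
      ((tensorEquiv A X V).symm : _ →+ _)

theorem tensorEquiv_tmul (V : Opens X.carrier) (a : A) (b : X.presheaf.obj (op V)) :
    tensorEquiv A X V (a ⊗ₜ b) = scalFn X V a * incFn A V (algEquivFn X V b) := by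
  have : (a ⊗ₜ[ℂ] b : A ⊗[ℂ] (X.presheaf.obj (op V))) = (a ⊗ₜ 1) * (1 ⊗ₜ b) := by simp
  rw [this, map_mul]
  rfl

/-- Induction on elements of `A ⊗ 𝒪_X(V)`: an additive property of functions on `Spec A × X` need only
be checked on products of an element of `A` and a function on `X`. -/
theorem fn_induction {V : Opens X.carrier} {motive : Fn (thicken A X) V → Prop}
    (c : Fn (thicken A X) V) (tmul : ∀ a o, motive (scalFn X V a * incFn A V o))
    (add : ∀ c d, motive c → motive d → motive (c + d)) : motive c := by
  have key : ∀ x : A ⊗[ℂ] (X.presheaf.obj (op V)), motive (tensorEquiv A X V x) := by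
    intro x
    induction x using TensorProduct.induction_on with
    | zero =>
      have := tmul 0 0
      rwa [map_zero, zero_mul] at this
    | tmul a b => rw [tensorEquiv_tmul]; exact tmul _ _
    | add x y hx hy => rw [map_add]; exact add _ _ hx hy
  exact key c

theorem coordFn_mul (ℓ : A →ₗ[ℂ] ℂ) (V : Opens X.carrier) (a : A) (o : Fn X V) :
    coordFn ℓ V (scalFn X V a * incFn A V o) = constFn X V (ℓ a) * o := by
  obtain ⟨b, rfl⟩ := (algEquivFn X V).surjective o
  rw [← tensorEquiv_tmul]
  change algEquivFn X V (ℓ a • b) = _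
  rw [Algebra.smul_def, map_mul]
  rfl

theorem mapFn_mul (ℓ : A →ₗ[ℂ] A') (V : Opens X.carrier) (a : A) (o : Fn X V) :
    mapFn ℓ V (scalFn X V a * incFn A V o) = scalFn X V (ℓ a) * incFn A' V o := by
  obtain ⟨b, rfl⟩ := (algEquivFn X V).surjective o
  rw [← tensorEquiv_tmul, ← tensorEquiv_tmul]
  rfl

theorem scalFn_algebraMap (V : Opens X.carrier) (z : ℂ) :
    scalFn X V (algebraMap ℂ A z) = incFn A V (constFn X V z) := by
  have h : (algebraMap ℂ A z ⊗ₜ[ℂ] 1 : A ⊗[ℂ] (X.presheaf.obj (op V))) =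
      1 ⊗ₜ algebraMap ℂ _ z := by
    rw [Algebra.algebraMap_eq_smul_one, Algebra.algebraMap_eq_smul_one, TensorProduct.smul_tmul]
  exact congrArg (tensorEquiv A X V) h

theorem scalFn_smul (V : Opens X.carrier) (z : ℂ) (a : A) :
    scalFn X V (z • a) = incFn A V (constFn X V z) * scalFn X V a := by
  rw [Algebra.smul_def, map_mul, scalFn_algebraMap]

theorem resFn_scalFn {V W : Opens X.carrier} (h : W ≤ V) (a : A) :
    resFn (X := thicken A X) h (scalFn X V a) = scalFn X W a := by
  have h1 : (Algebra.TensorProduct.map (AlgHom.id ℂ A) (X.presheaf.map (homOfLE h).op).hom)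
      (a ⊗ₜ[ℂ] 1) = a ⊗ₜ 1 := by
    rw [Algebra.TensorProduct.map_tmul, map_one]
    rfl
  exact congrArg (tensorEquiv A X W) h1

theorem resFn_incFn {V W : Opens X.carrier} (h : W ≤ V) (o : Fn X V) :
    resFn (X := thicken A X) h (incFn A V o) = incFn A W (resFn h o) :=
  (pullFn_resFn (thickenProj A X) h o).symm

theorem resFn_constFn {V W : Opens X.carrier} (h : W ≤ V) (z : ℂ) :
    resFn h (constFn X V z) = constFn X W z :=
  congrArg (algEquivFn X W) ((X.presheaf.map (homOfLE h).op).hom.commutes z)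

theorem resFn_coordFn (ℓ : A →ₗ[ℂ] ℂ) {V W : Opens X.carrier} (h : W ≤ V)
    (c : Fn (thicken A X) V) :
    coordFn ℓ W (resFn (X := thicken A X) h c) = resFn h (coordFn ℓ V c) := by
  induction c using fn_induction with
  | tmul a o => rw [map_mul, resFn_scalFn, resFn_incFn, coordFn_mul, coordFn_mul, map_mul,
      resFn_constFn]
  | add c d hc hd => simp only [map_add, hc, hd]

theorem pullFn_scalFn (φ : A →ₐ[ℂ] A') (f : X ⟶ Y) (V : Opens Y.carrier) (a : A) :
    pullFn (thickenMap φ f) V (scalFn Y V a) =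
      scalFn X ((Opens.map f.hom.base).obj V) (φ a) := by
  have h1 : Algebra.TensorProduct.map φ (f.hom.c.app (op V)).hom (a ⊗ₜ[ℂ] 1) = φ a ⊗ₜ 1 := by
    rw [Algebra.TensorProduct.map_tmul, map_one]
  exact congrArg (tensorEquiv A' X ((Opens.map f.hom.base).obj V)) h1

theorem pullFn_incFn (φ : A →ₐ[ℂ] A') (f : X ⟶ Y) (V : Opens Y.carrier) (o : Fn Y V) :
    pullFn (thickenMap φ f) V (incFn A V o) =
      incFn A' ((Opens.map f.hom.base).obj V) (pullFn f V o) := by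
  have h1 : Algebra.TensorProduct.map φ (f.hom.c.app (op V)).hom
      (1 ⊗ₜ[ℂ] (algEquivFn Y V).symm o) = 1 ⊗ₜ (f.hom.c.app (op V)).hom ((algEquivFn Y V).symm o) := by
    rw [Algebra.TensorProduct.map_tmul, map_one]
  exact congrArg (tensorEquiv A' X ((Opens.map f.hom.base).obj V)) h1

theorem pullFn_constFn (f : X ⟶ Y) (V : Opens Y.carrier) (z : ℂ) :
    pullFn f V (constFn Y V z) = constFn X ((Opens.map f.hom.base).obj V) z :=
  congrArg (algEquivFn X ((Opens.map f.hom.base).obj V)) ((f.hom.c.app (op V)).hom.commutes z)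

theorem coordFn_pullFn (ℓ : A' →ₗ[ℂ] ℂ) (φ : A →ₐ[ℂ] A') (f : X ⟶ Y) (V : Opens Y.carrier)
    (c : Fn (thicken A Y) V) :
    coordFn ℓ ((Opens.map f.hom.base).obj V) (pullFn (thickenMap φ f) V c) =
      pullFn f V (coordFn (ℓ ∘ₗ φ.toLinearMap) V c) := by
  induction c using fn_induction with
  | tmul a o =>
    rw [map_mul, pullFn_scalFn, pullFn_incFn, coordFn_mul]
    refine (coordFn_mul _ _ _ _).trans ?_
    rw [map_mul, pullFn_constFn]
    rfl
  | add c d hc hd =>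
    rw [map_add, map_add, map_add, ← hc, ← hd]
    exact map_add _ _ _

theorem mapFn_pullFn (ℓ : A →ₗ[ℂ] A') (f : X ⟶ Y) (V : Opens Y.carrier)
    (c : Fn (thicken A Y) V) :
    mapFn ℓ ((Opens.map f.hom.base).obj V) (pullFn (thickenMap (AlgHom.id ℂ A) f) V c) =
      pullFn (thickenMap (AlgHom.id ℂ A') f) V (mapFn ℓ V c) := by
  induction c using fn_induction with
  | tmul a o =>
    rw [map_mul, pullFn_scalFn, pullFn_incFn, mapFn_mul]
    refine (mapFn_mul _ _ _ _).trans ?_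
    rw [map_mul, pullFn_scalFn, pullFn_incFn]
    rfl
  | add c d hc hd =>
    rw [map_add, map_add, map_add, ← hc, ← hd]
    exact map_add _ _ _

/-- Restriction of functions to the closed fibre is reduction of the coefficients modulo the maximal
ideal. -/
theorem pullFn_closedFibre [IsLocalRing A] (V : Opens X.carrier) (c : Fn (thicken A X) V) :
    pullFn (closedFibre A X) V c = coordFn (residueHom A).toLinearMap V c := by
  induction c using fn_induction with
  | tmul a o =>
    rw [coordFn_mul]
    obtain ⟨b, rfl⟩ := (algEquivFn X V).surjective o
    rw [← tensorEquiv_tmul]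
    exact congrArg (algEquivFn X V) (reduceHom_tmul A _ a b)
  | add c d hc hd =>
    rw [map_add, map_add, hc, hd]
    rfl

theorem coordFn_incFn (ℓ : A →ₗ[ℂ] ℂ) (V : Opens X.carrier) (o : Fn X V) :
    coordFn ℓ V (incFn A V o) = constFn X V (ℓ 1) * o := by
  rw [← coordFn_mul, map_one, one_mul]

theorem fn_mul_comm {V : Opens X.carrier} (a b : Fn X V) : a * b = b * a :=
  mul_comm ((algEquivFn X V).symm a) ((algEquivFn X V).symm b)

theorem fn_mul_left_comm {V : Opens X.carrier} (a b c : Fn X V) : a * (b * c) = b * (a * c) :=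
  mul_left_comm ((algEquivFn X V).symm a) ((algEquivFn X V).symm b) ((algEquivFn X V).symm c)

/-- Expansion of a function on `Spec A × X` in a basis of `A`. -/
theorem sum_scalFn_mul_coordFn {ι : Type} [Fintype ι] (b : Module.Basis ι ℂ A)
    (V : Opens X.carrier) (c : Fn (thicken A X) V) :
    ∑ j, scalFn X V (b j) * incFn A V (coordFn (b.coord j) V c) = c := by
  induction c using fn_induction with
  | tmul a o =>
    have h : ∀ j, scalFn X V (b j) * incFn A V (coordFn (b.coord j) V
        (scalFn X V a * incFn A V o)) = scalFn X V (b.coord j a • b j) * incFn A V o := by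
      intro j
      have h := fn_mul_left_comm (X := thicken A X) (scalFn X V (b j))
        (incFn A V (constFn X V (b.coord j a))) (incFn A V o)
      rw [coordFn_mul, map_mul, scalFn_smul, mul_assoc]
      exact h
    rw [Finset.sum_congr rfl fun j _ => h j, ← Finset.sum_mul, ← map_sum]
    congr 2
    exact b.sum_repr a
  | add c d hc hd =>
    simp only [map_add, mul_add, Finset.sum_add_distrib, hc, hd]

end Functions

section Functions

variable {A A' : Type} [CommRing A] [Algebra ℂ A] [Module.Finite ℂ A]
  [CommRing A'] [Algebra ℂ A'] [Module.Finite ℂ A'] {X Y : CSpace}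

/-- A basis of `A` over `ℂ` is a basis of `A ⊗ 𝒪_X(V)` over `𝒪_X(V)`. -/
theorem bijective_sum_scalFn {ι : Type} [Fintype ι] (b : Module.Basis ι ℂ A)
    (V : Opens X.carrier) :
    Function.Bijective fun o : ι → Fn X V => ∑ j, scalFn X V (b j) * incFn A V (o j) := by
  classical
  have h : ∀ o : ι → Fn X V, ∀ k,
      coordFn (b.coord k) V (∑ j, scalFn X V (b j) * incFn A V (o j)) = o k := by
    intro o k
    rw [map_sum, Finset.sum_eq_single k]
    · rw [coordFn_mul, Module.Basis.coord_apply, Module.Basis.repr_self, Finsupp.single_eq_same,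
        map_one, one_mul]
    · intro j _ hjk
      rw [coordFn_mul, Module.Basis.coord_apply, Module.Basis.repr_self,
        Finsupp.single_eq_of_ne hjk.symm, map_zero, zero_mul]
    · intro hk
      exact absurd (Finset.mem_univ k) hk
  refine ⟨fun o o' hoo => funext fun k => ?_, fun c =>
    ⟨fun j => coordFn (b.coord j) V c, sum_scalFn_mul_coordFn b V c⟩⟩
  rw [← h o k, ← h o' k]
  exact congrArg _ hoo

/-! ### Dual numbers -/

/-- The function `ε` on `Spec ℂ[ε] × X`. -/
def epsFn (X : CSpace) (V : Opens X.carrier) : Fn (thicken (DualNumber ℂ) X) V :=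
  scalFn X V DualNumber.eps

/-- The part without `ε` of a function on `Spec ℂ[ε] × X`. -/
def reFn {V : Opens X.carrier} (c : Fn (thicken (DualNumber ℂ) X) V) : Fn X V :=
  pullFn (closedFibre (DualNumber ℂ) X) V c

/-- The coefficient of `ε` of a function on `Spec ℂ[ε] × X`. -/
def imFn {V : Opens X.carrier} (c : Fn (thicken (DualNumber ℂ) X) V) : Fn X V :=
  coordFn (TrivSqZeroExt.sndHom ℂ ℂ) V c

theorem residueHom_dualNumber (a : DualNumber ℂ) : residueHom (DualNumber ℂ) a = a.fst := by
  have h : residueHom (DualNumber ℂ) = TrivSqZeroExt.fstHom ℂ ℂ ℂ := by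
    apply DualNumber.algHom_ext
    have h0 : residueHom (DualNumber ℂ) DualNumber.eps *
        residueHom (DualNumber ℂ) DualNumber.eps = 0 := by
      rw [← map_mul, DualNumber.eps_mul_eps, map_zero]
    rw [mul_self_eq_zero.1 h0]
    simp
  rw [h]
  rfl

theorem reFn_inc {V : Opens X.carrier} (o : Fn X V) : reFn (incFn (DualNumber ℂ) V o) = o := by
  unfold reFn
  rw [pullFn_closedFibre, coordFn_incFn]
  simp

theorem imFn_inc {V : Opens X.carrier} (o : Fn X V) : imFn (incFn (DualNumber ℂ) V o) = 0 := by
  unfold imFn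
  rw [coordFn_incFn]
  simp

theorem reFn_eps {V : Opens X.carrier} : reFn (epsFn X V) = 0 := by
  have h : epsFn X V = scalFn X V DualNumber.eps * incFn (DualNumber ℂ) V 1 := by
    rw [map_one, mul_one]
    rfl
  unfold reFn
  rw [pullFn_closedFibre, h, coordFn_mul]
  simp [residueHom_dualNumber]

theorem reFn_add {V : Opens X.carrier} (c d : Fn (thicken (DualNumber ℂ) X) V) :
    reFn (c + d) = reFn c + reFn d := map_add (pullFn (closedFibre (DualNumber ℂ) X) V) c d

theorem imFn_add {V : Opens X.carrier} (c d : Fn (thicken (DualNumber ℂ) X) V) :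
    imFn (c + d) = imFn c + imFn d := map_add _ _ _

theorem imFn_mul {V : Opens X.carrier} (c d : Fn (thicken (DualNumber ℂ) X) V) :
    imFn (c * d) = reFn c * imFn d + imFn c * reFn d := by
  induction c using fn_induction with
  | tmul a o =>
    induction d using fn_induction with
    | tmul a' o' =>
      have h : (scalFn X V a * incFn (DualNumber ℂ) V o) *
          (scalFn X V a' * incFn (DualNumber ℂ) V o') =
          scalFn X V (a * a') * incFn (DualNumber ℂ) V (o * o') := by
        rw [map_mul, map_mul, mul_assoc, mul_assoc]
        congr 1
        exact fn_mul_left_comm (X := thicken (DualNumber ℂ) X) _ _ _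
      unfold reFn imFn
      rw [h]
      simp only [pullFn_closedFibre, coordFn_mul]
      change constFn X V ((a * a').snd) * (o * o') =
        (constFn X V (residueHom _ a) * o) * (constFn X V a'.snd * o') +
        (constFn X V a.snd * o) * (constFn X V (residueHom _ a') * o')
      rw [residueHom_dualNumber, residueHom_dualNumber, DualNumber.snd_mul, map_add, map_mul,
        map_mul, add_mul]
      simp only [mul_assoc]
      rw [fn_mul_left_comm o, fn_mul_left_comm o]
    | add c d hc hd =>
      rw [mul_add, imFn_add, hc, hd, imFn_add, reFn_add, mul_add, mul_add]
      abel
  | add c' d' hc hd =>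
    rw [add_mul, imFn_add, hc, hd, imFn_add, reFn_add, add_mul, add_mul]
    abel

theorem imFn_eps {V : Opens X.carrier} : imFn (epsFn X V) = 1 := by
  have h : epsFn X V = scalFn X V DualNumber.eps * incFn (DualNumber ℂ) V 1 := by
    rw [map_one, mul_one]
    rfl
  unfold imFn
  rw [h, coordFn_mul]
  simp

theorem incFn_add_epsFn {V : Opens X.carrier} (c : Fn (thicken (DualNumber ℂ) X) V) :
    incFn (DualNumber ℂ) V (reFn c) + epsFn X V * incFn (DualNumber ℂ) V (imFn c) = c := by
  induction c using fn_induction with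
  | tmul a o =>
    unfold reFn imFn
    rw [pullFn_closedFibre, coordFn_mul, coordFn_mul, map_mul, map_mul, ← scalFn_algebraMap,
      ← scalFn_algebraMap]
    unfold epsFn
    rw [← mul_assoc, ← map_mul, ← add_mul, ← map_add]
    congr 2
    change algebraMap ℂ _ (residueHom _ a) + DualNumber.eps * algebraMap ℂ _ a.snd = a
    rw [residueHom_dualNumber]
    rw [TrivSqZeroExt.algebraMap_eq_inl]
    ext
    · simp
    · simp
  | add c d hc hd =>
    rw [reFn_add, imFn_add, map_add, map_add, mul_add, add_add_add_comm, hc, hd]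

theorem resFn_epsFn {V W : Opens X.carrier} (h : W ≤ V) :
    resFn (X := thicken (DualNumber ℂ) X) h (epsFn X V) = epsFn X W := resFn_scalFn h _

theorem resFn_reFn {V W : Opens X.carrier} (h : W ≤ V) (c : Fn (thicken (DualNumber ℂ) X) V) :
    reFn (resFn (X := thicken (DualNumber ℂ) X) h c) = resFn h (reFn c) :=
  pullFn_resFn (closedFibre (DualNumber ℂ) X) h c

theorem resFn_imFn {V W : Opens X.carrier} (h : W ≤ V) (c : Fn (thicken (DualNumber ℂ) X) V) :
    imFn (resFn (X := thicken (DualNumber ℂ) X) h c) = resFn h (imFn c) := resFn_coordFn _ h c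

theorem epsFn_mul_epsFn {V : Opens X.carrier} : epsFn X V * epsFn X V = 0 := by
  unfold epsFn
  rw [← map_mul, DualNumber.eps_mul_eps, map_zero]

/-! ### Small extensions -/

/-- A small extension `0 → tR → R → R' → 0` splits linearly: there are a linear section `σ` of `π`
and a functional `μ` with `r = σ(π r) + μ(r) t` for all `r`. -/
theorem exists_linear_splitting {R R' : Type} [CommRing R] [Algebra ℂ R] [IsLocalRing R]
    [Module.Finite ℂ R] [CommRing R'] [Algebra ℂ R'] (π : R →ₐ[ℂ] R')
    (hπ : Function.Surjective π) (t : R) (hker : RingHom.ker π = Ideal.span {t})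
    (ht : ∀ a ∈ IsLocalRing.maximalIdeal R, t * a = 0) :
    (∀ a, a * t = residueHom R a • t) ∧
      ∃ (σ : R' →ₗ[ℂ] R) (μ : R →ₗ[ℂ] ℂ), (∀ r', π (σ r') = r') ∧
        (∀ r, σ (π r) + μ r • t = r) := by
  -- `t` is annihilated by the maximal ideal, so `R` acts on it through the residue field `ℂ`
  have h1 : ∀ a, a * t = residueHom R a • t := by
    intro a
    have hm : a - algebraMap ℂ R (residueHom R a) ∈ IsLocalRing.maximalIdeal R := by
      rw [← IsLocalRing.residue_eq_zero_iff, map_sub, sub_eq_zero]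
      have h2 : algebraMap ℂ (IsLocalRing.ResidueField R) (residueHom R a) =
          IsLocalRing.residue R a :=
        (AlgEquiv.ofBijective (Algebra.ofId ℂ (IsLocalRing.ResidueField R))
          IsAlgClosed.algebraMap_bijective_of_isIntegral).apply_symm_apply _
      exact h2.symm
    have h3 := ht _ hm
    rw [mul_sub, sub_eq_zero] at h3
    rw [mul_comm, h3, Algebra.smul_def, mul_comm]
  refine ⟨h1, ?_⟩
  obtain ⟨σ, hσ⟩ := π.toLinearMap.exists_rightInverse_of_surjective
    (LinearMap.range_eq_top.2 hπ)
  have hσ' : ∀ r', π (σ r') = r' := fun r' => LinearMap.congr_fun hσ r'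
  have hmem : ∀ r, r - σ (π r) ∈ LinearMap.range (LinearMap.toSpanSingleton ℂ R t) := by
    intro r
    have : r - σ (π r) ∈ RingHom.ker π := by
      rw [RingHom.mem_ker, map_sub, hσ', sub_self]
    rw [hker, Ideal.mem_span_singleton'] at this
    obtain ⟨a, ha⟩ := this
    exact ⟨residueHom R a, by rw [← ha, h1]; rfl⟩
  obtain ⟨τ, hτ⟩ := (LinearMap.toSpanSingleton ℂ R t).rangeRestrict.exists_rightInverse_of_surjective
    (LinearMap.range_rangeRestrict _)
  let δ : R →ₗ[ℂ] R := LinearMap.id - σ ∘ₗ π.toLinearMap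
  refine ⟨σ, τ ∘ₗ δ.codRestrict _ hmem, hσ', fun r => ?_⟩
  have h4 := congrArg Subtype.val (LinearMap.congr_fun hτ (δ.codRestrict _ hmem r))
  have h5 : (τ ∘ₗ δ.codRestrict _ hmem) r • t = r - σ (π r) := h4
  rw [h5, add_sub_cancel]

/-- The decomposition `c = σ(π c) + t μ(c)` of functions on `Spec R × X` induced by a linear
splitting of a small extension `π : R → R'`. -/
theorem mapFn_add_scalFn_mul {R R' : Type} [CommRing R] [Algebra ℂ R] [Module.Finite ℂ R]
    [CommRing R'] [Algebra ℂ R'] [Module.Finite ℂ R'] (π : R →ₐ[ℂ] R') (t : R)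
    (σ : R' →ₗ[ℂ] R) (μ : R →ₗ[ℂ] ℂ) (h : ∀ r, σ (π r) + μ r • t = r) (V : Opens X.carrier)
    (c : Fn (thicken R X) V) :
    mapFn σ V (pullFn (thickenMap π (𝟙 X)) V c : Fn (thicken R' X) V) +
      scalFn X V t * incFn R V (coordFn μ V c) = c := by
  induction c using fn_induction with
  | tmul a o =>
    have h1 : (pullFn (thickenMap π (𝟙 X)) V (scalFn X V a * incFn R V o) :
        Fn (thicken R' X) V) = scalFn X V (π a) * incFn R' V o := by
      rw [map_mul, pullFn_scalFn, pullFn_incFn]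
      rfl
    rw [h1, mapFn_mul, coordFn_mul, map_mul, ← mul_assoc]
    have h2 : scalFn X V t * incFn R V (constFn X V (μ a)) = scalFn X V (μ a • t) := by
      rw [scalFn_smul]
      exact fn_mul_comm (X := thicken R X) _ _
    rw [h2, ← add_mul, ← map_add, h]
  | add c d hc hd =>
    have h1 : (pullFn (thickenMap π (𝟙 X)) V (c + d) : Fn (thicken R' X) V) =
      (pullFn (thickenMap π (𝟙 X)) V c : Fn (thicken R' X) V) +
        (pullFn (thickenMap π (𝟙 X)) V d : Fn (thicken R' X) V) := map_add _ _ _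
    have h2 : mapFn σ V ((pullFn (thickenMap π (𝟙 X)) V c : Fn (thicken R' X) V) +
        (pullFn (thickenMap π (𝟙 X)) V d : Fn (thicken R' X) V)) =
      mapFn σ V (pullFn (thickenMap π (𝟙 X)) V c : Fn (thicken R' X) V) +
        mapFn σ V (pullFn (thickenMap π (𝟙 X)) V d : Fn (thicken R' X) V) := map_add _ _ _
    rw [h1, h2, map_add, map_add, mul_add, add_add_add_comm, hc, hd]

theorem pullFn_mapFn_section {R R' : Type} [CommRing R] [Algebra ℂ R] [Module.Finite ℂ R]
    [CommRing R'] [Algebra ℂ R'] [Module.Finite ℂ R'] (π : R →ₐ[ℂ] R') (σ : R' →ₗ[ℂ] R)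
    (h : ∀ r', π (σ r') = r') (V : Opens X.carrier) (c : Fn (thicken R' X) V) :
    pullFn (thickenMap π (𝟙 X)) V (mapFn σ V c) = c := by
  induction c using fn_induction with
  | tmul a o =>
    rw [mapFn_mul, map_mul, pullFn_scalFn, pullFn_incFn, h]
    rfl
  | add c d hc hd =>
    rw [map_add, map_add, hc, hd]
    rfl

end Functions

/-! ### Vector bundles on `Spec A × X` -/

section ThickenProj

variable {A : Type} [CommRing A] [Algebra ℂ A] [Module.Finite ℂ A] {X : CSpace}

/-- The direct image of a vector bundle under the finite projection `Spec A × X → X` is a vector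
bundle: a local basis is given by the products of a basis of `A` and a local basis. -/
theorem isLocallyFree_pushforward_thickenProj {E : Mod (thicken A X)} (hE : IsLocallyFree E) :
    IsLocallyFree ((pushforward (thickenProj A X)).obj E) := by
  intro x
  obtain ⟨U, hx, n, e, he⟩ := hE x
  let b := Module.finBasis ℂ A
  let m := Module.finrank ℂ A
  refine ⟨U, hx, m * n, fun k => (scalFn X U (b (finProdFinEquiv.symm k).1) •
    e (finProdFinEquiv.symm k).2 : Sec E U), ?_⟩
  intro V h
  let C : (Fin (m * n) → Fn X V) ≃ (Fin n → Fin m → Fn X V) :=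
    { toFun := fun c i j => c (finProdFinEquiv (j, i))
      invFun := fun c k => c (finProdFinEquiv.symm k).2 (finProdFinEquiv.symm k).1
      left_inv := fun c => funext fun k => by
        change c (finProdFinEquiv (finProdFinEquiv.symm k)) = c k
        rw [Equiv.apply_symm_apply]
      right_inv := fun c => funext fun i => funext fun j => by
        change c (finProdFinEquiv.symm (finProdFinEquiv (j, i))).2
          (finProdFinEquiv.symm (finProdFinEquiv (j, i))).1 = c i j
        rw [Equiv.symm_apply_apply] }
  have key := ((he V h).comp (Function.Bijective.piMap
    (fun _ : Fin n => bijective_sum_scalFn (X := X) b V))).comp C.bijective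
  have hfun : (fun c : Fin (m * n) → Fn X V => ∑ k, c k •
      res ((pushforward (thickenProj A X)).obj E) h
        (scalFn X U (b (finProdFinEquiv.symm k).1) • e (finProdFinEquiv.symm k).2 : Sec E U)) =
      ((fun c : Fin n → Fn (thicken A X) V => ∑ i, c i • res E h (e i)) ∘
        Pi.map fun _ o => ∑ j, scalFn X V (b j) * incFn A V (o j)) ∘ ⇑C := by
    funext c
    have h1 : ∀ k, (c k • res ((pushforward (thickenProj A X)).obj E) h
        (scalFn X U (b (finProdFinEquiv.symm k).1) • e (finProdFinEquiv.symm k).2 : Sec E U)) =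
        ((scalFn X V (b (finProdFinEquiv.symm k).1) * incFn A V (c k)) •
          res E h (e (finProdFinEquiv.symm k).2) : Sec E V) := by
      intro k
      have h2 := res_smul E h (scalFn X U (b (finProdFinEquiv.symm k).1))
        (e (finProdFinEquiv.symm k).2)
      have h3 := congrArg (fun z : Sec E V => (incFn A V (c k) : Fn (thicken A X) V) • z) h2
      refine h3.trans ?_
      refine (mul_smul _ _ _).symm.trans ?_
      refine congrArg (fun z : Fn (thicken A X) V => z • res E h (e (finProdFinEquiv.symm k).2)) ?_
      have h4 := resFn_scalFn (X := X) h (b (finProdFinEquiv.symm k).1)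
      refine (fn_mul_comm (X := thicken A X) _ _).trans ?_
      exact congrArg (fun z : Fn (thicken A X) V => z * incFn A V (c k)) h4
    refine (Finset.sum_congr rfl fun k _ => h1 k).trans ?_
    change (∑ k, _ : Sec E V) = ∑ i, (∑ j, scalFn X V (b j) * incFn A V (c (finProdFinEquiv (j, i))) :
      Fn (thicken A X) V) • res E h (e i)
    simp only [Finset.sum_smul]
    rw [← finProdFinEquiv.sum_comp, Fintype.sum_prod_type_right]
    simp only [Equiv.symm_apply_apply]
    rfl
  rw [hfun]
  exact key

theorem isHomeomorph_thickenProj (A : Type) [CommRing A] [Algebra ℂ A] [Module.Finite ℂ A]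
    (X : CSpace) : IsHomeomorph (thickenProj A X).hom.base := IsHomeomorph.id

theorem isHomeomorph_closedFibre (A : Type) [CommRing A] [Algebra ℂ A] [Module.Finite ℂ A]
    [IsLocalRing A] (X : CSpace) : IsHomeomorph (closedFibre A X).hom.base := IsHomeomorph.id

theorem isHomeomorph_thickenMap_id {A' : Type} [CommRing A'] [Algebra ℂ A'] [Module.Finite ℂ A']
    (φ : A →ₐ[ℂ] A') (X : CSpace) : IsHomeomorph (thickenMap φ (𝟙 X)).hom.base := IsHomeomorph.id

/-- Vanishing of `Ext²` on the closed fibre of `Spec A × X → Spec A` gives vanishing of `Ext²` on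
`Spec A × X` with values in sheaves supported on the closed fibre. -/
theorem subsingleton_ext_two_closedFibre [IsLocalRing A] {E : Mod (thicken A X)}
    (hE : IsLocallyFree E) {N : Mod X}
    (h : Subsingleton (Abelian.Ext ((pullback (closedFibre A X)).obj E) N 2)) :
    Subsingleton (Abelian.Ext E ((pushforward (closedFibre A X)).obj N) 2) :=
  subsingleton_ext_two_pushforward (thickenProj A X) (closedFibre A X)
    (closedFibre_thickenProj A X) (isHomeomorph_thickenProj A X) (isHomeomorph_closedFibre A X) hE
    (isLocallyFree_pushforward_thickenProj hE) h

end ThickenProj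

/-! ### Pullback of sections along cartesian morphisms -/

theorem bijective_app_of_isLocalBasis {X : CSpace} {E F : Mod X} (g : E ⟶ F)
    {U : Opens X.carrier} {n : ℕ} {e : Fin n → Sec E U} (he : IsLocalBasis E U e)
    (hg : IsLocalBasis F U fun i => app g U (e i)) {V : Opens X.carrier} (h : V ≤ U) :
    Function.Bijective (app g V) := by
  refine (Function.Bijective.of_comp_iff _ (he V h)).1 ?_
  have h1 : (app g V ∘ fun c : Fin n → Fn X V => ∑ i, c i • res E h (e i)) =
      fun c => ∑ i, c i • res F h (app g U (e i)) := by
    funext c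
    change app g V (∑ i, c i • res E h (e i)) = _
    rw [app_sum_smul]
    simp only [app_res]
  rw [h1]
  exact hg V h

/-- A morphism taking local bases to local bases is an isomorphism. -/
theorem isIso_of_isLocalBasis {X : CSpace} {E F : Mod X} (g : E ⟶ F)
    (h : ∀ x : X.carrier, ∃ U : Opens X.carrier, x ∈ U ∧ ∃ (n : ℕ) (e : Fin n → Sec E U),
      IsLocalBasis E U e ∧ IsLocalBasis F U fun i => app g U (e i)) : IsIso g := by
  have : Mono g := mono_of_injective_app g (injective_app_of_local g fun x => by
    obtain ⟨U, hx, n, e, he, hg⟩ := h x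
    refine ⟨U, hx, fun V hV y hy => ?_⟩
    exact (bijective_app_of_isLocalBasis g he hg hV).1 (hy.trans (map_zero _).symm))
  have : Epi g := epi_of_local_lift g fun V y x hx => by
    obtain ⟨U, hxU, n, e, he, hg⟩ := h x
    exact ⟨V ⊓ U, inf_le_left, ⟨hx, hxU⟩,
      (bijective_app_of_isLocalBasis g he hg inf_le_right).2 _⟩
  exact isIso_of_mono_of_epi g

namespace ModSpace

variable {P Q T : ModSpace}

/-- The pullback of sections along a morphism `(X, E) → (Y, F)`. -/
def pb (f : P ⟶ Q) (V : Opens Q.space.carrier) :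
    Sec Q.mod V →+ Sec P.mod ((Opens.map f.base.hom.base).obj V) :=
  (app (F := (pushforward f.base).obj P.mod) f.map V).toAddMonoidHom

theorem pb_smul (f : P ⟶ Q) (V : Opens Q.space.carrier) (c : Fn Q.space V) (x : Sec Q.mod V) :
    pb f V (c • x) = pullFn f.base V c • pb f V x :=
  map_smul (app (F := (pushforward f.base).obj P.mod) f.map V) c x

theorem pb_res (f : P ⟶ Q) {V W : Opens Q.space.carrier} (h : W ≤ V) (x : Sec Q.mod V) :
    pb f W (res Q.mod h x) = res P.mod ((Opens.map f.base.hom.base).map (homOfLE h)).le (pb f V x) :=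
  app_res (F := (pushforward f.base).obj P.mod) f.map h x

/-- Equal morphisms have the same effect on sections. As the equality of the base maps need not be
definitional, the two sides live over propositionally equal open sets. -/
theorem pb_eq_of_eq {f g : P ⟶ Q} (h : f = g) (V : Opens Q.space.carrier) (x : Sec Q.mod V) :
    pb f V x = res P.mod (by rw [h]) (pb g V x) := by
  subst h
  exact (res_self _ _ _).symm

theorem hom_ext_pb {f g : P ⟶ Q} (hb : f.base = g.base)
    (h : ∀ (V : Opens Q.space.carrier) (x : Sec Q.mod V),
      pb f V x = res P.mod (by rw [hb]) (pb g V x)) : f = g := by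
  obtain ⟨fb, fm⟩ := f
  obtain ⟨gb, gm⟩ := g
  obtain rfl : fb = gb := hb
  refine ModSpace.Hom.ext rfl (heq_of_eq ?_)
  exact hom_ext_app (F := (pushforward fb).obj P.mod) fun V x => (h V x).trans (res_self _ _ _)

/-- A morphism `(X, E) → (Y, F)` from a morphism `f : X → Y` and its effect on sections. -/
def ofSections (f : P.space ⟶ Q.space)
    (u : ∀ V : Opens Q.space.carrier, Sec Q.mod V →+ Sec P.mod ((Opens.map f.hom.base).obj V))
    (u_smul : ∀ (V : Opens Q.space.carrier) (c : Fn Q.space V) (x : Sec Q.mod V),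
      u V (c • x) = pullFn f V c • u V x)
    (u_res : ∀ {V W : Opens Q.space.carrier} (h : W ≤ V) (x : Sec Q.mod V),
      u W (res Q.mod h x) = res P.mod ((Opens.map f.hom.base).map (homOfLE h)).le (u V x)) :
    P ⟶ Q :=
  ⟨f, homOfApp (F := (pushforward f).obj P.mod)
    (fun V =>
      { toFun := u V
        map_add' := map_add (u V)
        map_smul' := u_smul V })
    (fun h x => u_res h x)⟩

theorem pb_sum_smul (f : P ⟶ Q) (V : Opens Q.space.carrier) {n : ℕ} (c : Fin n → Fn Q.space V)
    (x : Fin n → Sec Q.mod V) :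
    pb f V (∑ i, c i • x i) = ∑ i, pullFn f.base V (c i) • pb f V (x i) := by
  rw [map_sum]
  exact Finset.sum_congr rfl fun i _ => pb_smul f V (c i) (x i)

theorem IsCartesian.isLocalBasis {f : P ⟶ Q} (hf : Hom.IsCartesian f)
    {U : Opens Q.space.carrier} {n : ℕ} {e : Fin n → Sec Q.mod U} (he : IsLocalBasis Q.mod U e) :
    IsLocalBasis P.mod ((Opens.map f.base.hom.base).obj U) fun i => pb f U (e i) :=
  isLocalBasis_of_isCartesian f hf he

/-- A morphism taking local bases to local bases is cartesian. -/
theorem isCartesian_of_isLocalBasis (f : P ⟶ Q)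
    (h : ∀ x : P.space.carrier, ∃ U : Opens Q.space.carrier, f.base.hom.base x ∈ U ∧
      ∃ (n : ℕ) (e : Fin n → Sec Q.mod U), IsLocalBasis Q.mod U e ∧
        IsLocalBasis P.mod ((Opens.map f.base.hom.base).obj U) fun i => pb f U (e i)) :
    Hom.IsCartesian f := by
  have hf : ofPullback f.base (Hom.toPullback f) = f :=
    ModSpace.Hom.ext rfl (heq_of_eq (Equiv.apply_symm_apply _ _))
  -- `f` is the composition of `(X, E) → (X, f^* F)` and the cartesian morphism `(X, f^* F) → (Y, F)`
  have hv : ofPullback f.base (Hom.toPullback f) =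
      vert (Hom.toPullback f) ≫ pull f.base Q.mod :=
    ModSpace.Hom.ext rfl (heq_of_eq ((pullbackAdj f.base).homEquiv_unit _ _ _))
  refine isIso_of_isLocalBasis (Hom.toPullback f) fun x => ?_
  obtain ⟨U, hxU, n, e, he, hfe⟩ := h x
  refine ⟨(Opens.map f.base.hom.base).obj U, hxU, n, fun i => pb (pull f.base Q.mod) U (e i),
    IsCartesian.isLocalBasis (isCartesian_pull f.base Q.mod) he, ?_⟩
  have h1 : ∀ i, app (Hom.toPullback f) ((Opens.map f.base.hom.base).obj U)
      (pb (pull f.base Q.mod) U (e i)) = pb f U (e i) := by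
    intro i
    refine (pb_eq_of_eq (hf.symm.trans hv) U (e i)).trans ?_ |>.symm
    exact res_self _ _ _
  have h2 : (fun i => app (Hom.toPullback f) ((Opens.map f.base.hom.base).obj U)
      (pb (pull f.base Q.mod) U (e i))) = fun i => pb f U (e i) := funext h1
  rw [h2]
  exact hfe

end ModSpace

/-! ### Vector bundles over the dual numbers as extensions -/

section DualNumbers

variable {Z : CSpace}

/-- The product `Spec ℂ[ε] × Z`. -/
abbrev dual (Z : CSpace) : CSpace := thicken (DualNumber ℂ) Z

/-- The direct image of a sheaf of modules along the projection `Spec ℂ[ε] × Z → Z`: the same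
sections, with only the functions on `Z` acting. -/
abbrev direct (F : Mod (dual Z)) : Mod Z := (pushforward (thickenProj (DualNumber ℂ) Z)).obj F

instance (F : Mod (dual Z)) (V : Opens Z.carrier) :
    Module (Fn (dual Z) V) (Sec (direct F) V) :=
  inferInstanceAs (Module (Fn (dual Z) V) (F.val.obj (op V)))

theorem smul_eq_incFn_smul (F : Mod (dual Z)) {V : Opens Z.carrier} (o : Fn Z V)
    (z : Sec (direct F) V) : o • z = (incFn (DualNumber ℂ) V o : Fn (dual Z) V) • z := rfl

theorem res_dual_smul (F : Mod (dual Z)) {V W : Opens Z.carrier} (h : W ≤ V) (c : Fn (dual Z) V)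
    (z : Sec (direct F) V) :
    res (direct F) h (c • z) = (resFn (X := dual Z) h c : Fn (dual Z) W) • res (direct F) h z :=
  res_smul F h c z

/-- A function `a + bε` acts as `a + ε b`. -/
theorem dual_smul (F : Mod (dual Z)) {V : Opens Z.carrier} (c : Fn (dual Z) V)
    (z : Sec (direct F) V) : c • z = reFn c • z + epsFn Z V • (imFn c • z) := by
  conv_lhs => rw [← incFn_add_epsFn c]
  rw [add_smul, mul_smul]
  rfl

/-- Multiplication by `ε`. -/
def epsMul (F : Mod (dual Z)) : direct F ⟶ direct F :=
  homOfApp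
    (fun V =>
      { toFun := fun z => epsFn Z V • z
        map_add' := fun z w => smul_add _ _ _
        map_smul' := fun o z => by
          refine (mul_smul (epsFn Z V) (incFn (DualNumber ℂ) V o : Fn (dual Z) V) z).symm.trans ?_
          rw [fn_mul_comm (X := dual Z) (epsFn Z V) (incFn (DualNumber ℂ) V o)]
          exact mul_smul _ _ _ })
    (fun h z => by
      refine Eq.trans ?_ (res_dual_smul F h _ z).symm
      rw [resFn_epsFn]
      rfl)

theorem app_epsMul (F : Mod (dual Z)) (V : Opens Z.carrier) (z : Sec (direct F) V) :
    app (epsMul F) V z = epsFn Z V • z := rfl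

/-- The `𝒪_Z`-module `q_* F` underlying a sheaf `F` on `Spec ℂ[ε] × Z` is presented as an extension
`0 → E → q_* F → E → 0` such that the composite `q_* F → E → q_* F` is the multiplication by `ε`. -/
structure IsDualExt {E : Mod Z} (F : Mod (dual Z)) (ι : E ⟶ direct F) (p : direct F ⟶ E) :
    Prop where
  comp_eq_zero : ι ≫ p = 0
  shortExact : (ShortComplex.mk ι p comp_eq_zero).ShortExact
  eps : p ≫ ι = epsMul F

namespace IsDualExt

variable {E : Mod Z} {F : Mod (dual Z)} {ι : E ⟶ direct F} {p : direct F ⟶ E}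

theorem mono (h : IsDualExt F ι p) : Mono ι := h.shortExact.mono_f

theorem epi (h : IsDualExt F ι p) : Epi p := h.shortExact.epi_g

theorem app_app (h : IsDualExt F ι p) (V : Opens Z.carrier) (z : Sec (direct F) V) :
    app ι V (app p V z) = epsFn Z V • z :=
  congrArg (fun g => app g V z) h.eps

theorem app_p_app_ι (h : IsDualExt F ι p) (V : Opens Z.carrier) (y : Sec E V) :
    app p V (app ι V y) = 0 :=
  congrArg (fun g => app g V y) h.comp_eq_zero

theorem app_p_smul (h : IsDualExt F ι p) {V : Opens Z.carrier} (c : Fn (dual Z) V)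
    (z : Sec (direct F) V) : app p V (c • z) = reFn c • app p V z := by
  rw [dual_smul, map_add, map_smul, ← h.app_app, h.app_p_app_ι, add_zero]

/-- Sections of `F` reducing to a local basis of `E` form a local basis. -/
theorem isLocalBasis (h : IsDualExt F ι p) {U : Opens Z.carrier} {n : ℕ}
    {e : Fin n → Sec (direct F) U} (he : IsLocalBasis E U fun i => app p U (e i)) :
    IsLocalBasis F U e := by
  intro (V : Opens Z.carrier) (hV : V ≤ U)
  have := h.mono
  change Function.Bijective fun c : Fin n → Fn (dual Z) V => ∑ i, c i • res (direct F) hV (e i)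
  have hp : ∀ c : Fin n → Fn (dual Z) V, app p V (∑ i, c i • res (direct F) hV (e i)) =
      ∑ i, reFn (c i) • res E hV (app p U (e i)) := by
    intro c
    rw [map_sum]
    exact Finset.sum_congr rfl fun i _ => by rw [h.app_p_smul, app_res]
  have hι : ∀ b : Fin n → Fn Z V, app ι V (∑ i, b i • res E hV (app p U (e i))) =
      ∑ i, ((epsFn Z V * incFn (DualNumber ℂ) V (b i) : Fn (dual Z) V)) •
        res (direct F) hV (e i) := by
    intro b
    rw [map_sum]
    refine Finset.sum_congr rfl fun i _ => ?_
    rw [map_smul, ← app_res, h.app_app, mul_smul, ← smul_eq_incFn_smul]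
    exact (map_smul (app (epsMul F) V) (b i) _).symm
  have hzero : ∀ b : Fin n → Fn Z V, ∑ i, b i • res E hV (app p U (e i)) = 0 → ∀ i, b i = 0 := by
    intro b hb i
    refine congrFun ((he V hV).1 (a₂ := 0) ?_) i
    simpa using hb
  constructor
  -- injectivity: `∑ (aᵢ + bᵢ ε) eᵢ = 0` gives `aᵢ = 0` by reduction, and then `bᵢ = 0` as `ι` is injective
  · intro c d hcd
    have h0 : ∑ i, (c i - d i) • res (direct F) hV (e i) = 0 := by
      simp only [sub_smul, Finset.sum_sub_distrib]
      exact sub_eq_zero.2 hcd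
    have h1 := hzero (fun i => reFn (c i - d i)) (by
      rw [← hp, h0, map_zero])
    have h2 : ∀ i, c i - d i = epsFn Z V * incFn (DualNumber ℂ) V (imFn (c i - d i)) := by
      intro i
      conv_lhs => rw [← incFn_add_epsFn (c i - d i), h1 i, map_zero, zero_add]
    have h3 := hzero (fun i => imFn (c i - d i)) (by
      apply injective_app_of_mono ι V
      rw [hι, map_zero, ← h0]
      exact Finset.sum_congr rfl fun i _ => by rw [← h2])
    funext i
    have h4 := h2 i
    rw [h3 i, map_zero, mul_zero] at h4
    exact sub_eq_zero.1 h4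
  -- surjectivity: subtract a combination with the same reduction, and expand the rest in `ι(E)`
  · intro z
    obtain ⟨a, ha⟩ := (he V hV).2 (app p V z)
    have h1 : app p V (z - ∑ i, (incFn (DualNumber ℂ) V (a i) : Fn (dual Z) V) •
        res (direct F) hV (e i)) = 0 := by
      rw [map_sub, hp, sub_eq_zero]
      simp only [reFn_inc]
      exact ha.symm
    obtain ⟨y, hy⟩ := exists_app_eq_of_exact h.shortExact.exact _ h1
    obtain ⟨b, hb⟩ := (he V hV).2 y
    refine ⟨fun i => incFn (DualNumber ℂ) V (a i) + epsFn Z V * incFn (DualNumber ℂ) V (b i), ?_⟩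
    simp only [add_smul, Finset.sum_add_distrib]
    have h2 : app ι V (∑ i, b i • res E hV (app p U (e i))) = z -
        ∑ i, (incFn (DualNumber ℂ) V (a i) : Fn (dual Z) V) • res (direct F) hV (e i) :=
      (congrArg (app ι V) hb).trans hy
    rw [← hι, h2]
    exact add_sub_cancel _ _

/-- Locally, `F` has bases reducing to local bases of `E`. -/
theorem exists_isLocalBasis (h : IsDualExt F ι p) (hE : IsLocallyFree E) (x : Z.carrier) :
    ∃ U : Opens Z.carrier, x ∈ U ∧ ∃ (n : ℕ) (e : Fin n → Sec (direct F) U),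
      IsLocalBasis F U e ∧ IsLocalBasis E U fun i => app p U (e i) := by
  have := h.epi
  obtain ⟨U, hx, n, e, he⟩ := hE x
  choose V hV hxV y hy using fun i => exists_local_lift_of_epi p (e i) hx
  obtain ⟨U', hU'U, hx', hU'⟩ := exists_le_of_finite hx V hxV
  have hb : IsLocalBasis E U' fun i => app p U' (res (direct F) (hU' i) (y i)) := by
    have h1 : (fun i => app p U' (res (direct F) (hU' i) (y i))) =
        fun i => res E hU'U (e i) := by
      funext i
      rw [app_res, hy, res_res]
    rw [h1]
    exact he.restrict hU'U
  exact ⟨U', hx', n, _, h.isLocalBasis hb, hb⟩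

theorem isLocallyFree (h : IsDualExt F ι p) (hE : IsLocallyFree E) : IsLocallyFree F := by
  intro x
  obtain ⟨U, hx, n, e, he, -⟩ := h.exists_isLocalBasis hE x
  exact ⟨U, hx, n, e, he⟩

/-- The reduction modulo `ε`, as a morphism `(Z, E) → (Spec ℂ[ε] × Z, F)`. -/
def hom (h : IsDualExt F ι p) : (⟨Z, E⟩ : ModSpace) ⟶ ⟨dual Z, F⟩ :=
  ModSpace.ofSections (P := ⟨Z, E⟩) (Q := ⟨dual Z, F⟩) (closedFibre (DualNumber ℂ) Z)
    (fun V => (app p V).toAddMonoidHom) (fun _ c z => h.app_p_smul c z)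
    (fun hV z => app_res p hV z)

theorem isCartesian_hom (h : IsDualExt F ι p) (hE : IsLocallyFree E) :
    ModSpace.Hom.IsCartesian h.hom := by
  refine ModSpace.isCartesian_of_isLocalBasis _ fun x => ?_
  obtain ⟨U, hx, n, e, he, hp⟩ := h.exists_isLocalBasis hE x
  exact ⟨U, hx, n, e, he, hp⟩

end IsDualExt

/-- The effect of a morphism `(Z, E) → (Spec ℂ[ε] × Z, F)` over the inclusion of the closed fibre as
a map of `𝒪_Z`-modules. -/
def fibreMap {E : Mod Z} {F : Mod (dual Z)}
    (m : F ⟶ (pushforward (closedFibre (DualNumber ℂ) Z)).obj E) : direct F ⟶ E :=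
  homOfApp
    (fun V =>
      { toFun := fun z => app m V (z : F.val.obj (op V))
        map_add' := fun z w => map_add (app m V) _ _
        map_smul' := fun o z => by
          refine (map_smul (app m V) (incFn (DualNumber ℂ) V o : Fn (dual Z) V) _).trans ?_
          exact congrArg (fun a : Fn Z V => (a • (show Sec E V from
            app m V (z : F.val.obj (op V))) : Sec E V)) (reFn_inc o) })
    (fun h z => app_res m h z)

theorem fibreMap_smul {E : Mod Z} {F : Mod (dual Z)}
    (m : F ⟶ (pushforward (closedFibre (DualNumber ℂ) Z)).obj E) {V : Opens Z.carrier}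
    (c : Fn (dual Z) V) (z : Sec (direct F) V) :
    app (fibreMap m) V (c • z) = reFn c • app (fibreMap m) V z :=
  map_smul (app m V) c (z : F.val.obj (op V))

end DualNumbers

section DualNumbers

variable {Z : CSpace}

/-- A vector bundle `F` on `Spec ℂ[ε] × Z` with reduction `E` modulo `ε` is an extension of `E` by
`E`. -/
theorem exists_isDualExt {E : Mod Z} {F : Mod (dual Z)}
    (m : F ⟶ (pushforward (closedFibre (DualNumber ℂ) Z)).obj E)
    (hm : ModSpace.Hom.IsCartesian (⟨closedFibre (DualNumber ℂ) Z, m⟩ :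
      (⟨Z, E⟩ : ModSpace) ⟶ ⟨dual Z, F⟩)) (hF : IsLocallyFree F) :
    ∃ ι, IsDualExt F ι (fibreMap m) := by
  let p := fibreMap m
  have hpeps : ∀ (V : Opens Z.carrier) (z : Sec (direct F) V), app p V (epsFn Z V • z) = 0 := by
    intro V z
    refine (fibreMap_smul m (epsFn Z V) z).trans ?_
    rw [reFn_eps, zero_smul]
  have hepseps : ∀ (V : Opens Z.carrier) (z : Sec (direct F) V),
      epsFn Z V • epsFn Z V • z = 0 := by
    intro V z
    rw [← mul_smul, epsFn_mul_epsFn, zero_smul]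
  -- on small open sets, the kernel and the image of `ε` both are the kernel of `p`
  have hloc : ∀ x : Z.carrier, ∃ U : Opens Z.carrier, x ∈ U ∧ ∀ V ≤ U,
      Function.Surjective (app p V) ∧ (∀ z : Sec (direct F) V, app p V z = 0 →
        ∃ z', epsFn Z V • z' = z) ∧
      ∀ z : Sec (direct F) V, epsFn Z V • z = 0 → app p V z = 0 := by
    intro x
    have hF' : ∃ U : Opens Z.carrier, x ∈ U ∧ ∃ (n : ℕ) (e : Fin n → Sec (direct F) U),
      IsLocalBasis F U e := hF x
    obtain ⟨U, hx, n, e, he⟩ := hF'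
    have hb : IsLocalBasis E U fun i => app p U (e i) := isLocalBasis_of_isCartesian _ hm he
    refine ⟨U, hx, fun (V : Opens Z.carrier) hV => ?_⟩
    have hbV := hb V hV
    have heV : Function.Bijective fun c : Fin n → Fn (dual Z) V =>
      ∑ i, c i • res (direct F) hV (e i) := he V hV
    have hp : ∀ c : Fin n → Fn (dual Z) V, app p V (∑ i, c i • res (direct F) hV (e i)) =
        ∑ i, reFn (c i) • res E hV (app p U (e i)) := by
      intro c
      rw [map_sum]
      exact Finset.sum_congr rfl fun i _ => by
        exact (fibreMap_smul m (c i) _).trans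
          (congrArg (fun y : Sec E V => reFn (c i) • y) (app_res p hV (e i)))
    have hre : ∀ c : Fin n → Fn (dual Z) V, app p V (∑ i, c i • res (direct F) hV (e i)) = 0 →
        ∀ i, reFn (c i) = 0 := by
      intro c hc i
      refine congrFun (hbV.1 (a₁ := fun i => reFn (c i)) (a₂ := 0) ?_) i
      rw [hp] at hc
      simpa using hc
    refine ⟨fun y => ?_, fun z hz => ?_, fun z hz => ?_⟩
    · obtain ⟨a, ha⟩ := hbV.2 y
      refine ⟨∑ i, (incFn (DualNumber ℂ) V (a i) : Fn (dual Z) V) • res (direct F) hV (e i), ?_⟩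
      rw [hp]
      simp only [reFn_inc]
      exact ha
    · obtain ⟨c, rfl⟩ := heV.2 z
      refine ⟨∑ i, (incFn (DualNumber ℂ) V (imFn (c i)) : Fn (dual Z) V) •
        res (direct F) hV (e i), ?_⟩
      rw [Finset.smul_sum]
      refine Finset.sum_congr rfl fun i _ => ?_
      have h1 := incFn_add_epsFn (c i)
      rw [hre c hz i, map_zero, zero_add] at h1
      refine (mul_smul _ _ _).symm.trans ?_
      exact congrArg (fun a : Fn (dual Z) V => a • res (direct F) hV (e i)) h1
    · obtain ⟨c, rfl⟩ := heV.2 z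
      have h1 : ∀ i, epsFn Z V * c i = 0 := by
        intro i
        refine congrFun (heV.1 (a₁ := fun i => epsFn Z V * c i) (a₂ := 0) ?_) i
        simp only [mul_smul, ← Finset.smul_sum]
        refine hz.trans ?_
        simp
      have h2 : ∀ i, reFn (c i) = 0 := by
        intro i
        have h3 := congrArg imFn (h1 i)
        rw [imFn_mul, reFn_eps, imFn_eps, zero_mul, one_mul, zero_add] at h3
        rw [h3]
        exact map_zero _
      refine (hp c).trans ?_
      simp [h2]
  have : Epi p := epi_of_local_lift p fun V y x hx => by
    obtain ⟨U, hxU, hU⟩ := hloc x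
    exact ⟨V ⊓ U, inf_le_left, ⟨hx, hxU⟩, (hU _ inf_le_right).1 _⟩
  have hker : ∀ (V : Opens Z.carrier) (z : Sec (direct F) V), app p V z = 0 →
      epsFn Z V • z = 0 := by
    intro V z hz
    refine sec_ext fun x hx => ?_
    obtain ⟨U, hxU, hU⟩ := hloc x
    refine ⟨V ⊓ U, inf_le_left, ⟨hx, hxU⟩, ?_⟩
    obtain ⟨z', hz'⟩ := (hU _ inf_le_right).2.1 (res (direct F) (inf_le_left : V ⊓ U ≤ V) z) (by
      rw [app_res, hz, res_zero])
    rw [res_dual_smul, resFn_epsFn, ← hz', res_zero]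
    exact hepseps _ _
  have hS : (ShortComplex.mk _ _ (kernel.condition p)).ShortExact := ⟨ShortComplex.exact_kernel _⟩
  have h0 : kernel.ι p ≫ epsMul F = 0 := hom_ext_app fun V z => by
    rw [app_comp, app_epsMul]
    exact hker V _ (congrArg (fun g => app g V z) (kernel.condition p))
  -- so multiplication by `ε` factors through `p`
  let ι : E ⟶ direct F := hS.exact.desc (epsMul F) h0
  have hι : p ≫ ι = epsMul F := hS.exact.g_desc (epsMul F) h0
  have hι' : ∀ (V : Opens Z.carrier) (z : Sec (direct F) V),
      app ι V (app p V z) = epsFn Z V • z := fun V z => congrArg (fun g => app g V z) hι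
  have hw : ι ≫ p = 0 := by
    rw [← cancel_epi p]
    refine hom_ext_app fun V z => ?_
    change app p V (app ι V (app p V z)) = 0
    rw [hι', hpeps]
  obtain ⟨w, hw⟩ := shortExact_of_local ι p (fun V y => congrArg (fun g => app g V y) hw) fun x => by
    obtain ⟨U, hxU, hU⟩ := hloc x
    refine ⟨U, hxU, fun V hV y hy => ?_, fun V hV z hz => ?_, fun V hV y x hx => ?_⟩
    · obtain ⟨z, rfl⟩ := (hU V hV).1 y
      rw [hι'] at hy
      exact (hU V hV).2.2 z hy
    · obtain ⟨z', rfl⟩ := (hU V hV).2.1 z hz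
      exact ⟨app p V z', hι' V z'⟩
    · exact ⟨V, le_rfl, hx, (hU V hV).1 _⟩
  exact ⟨ι, w, hw, hι⟩

/-! ### Modules over the dual numbers from endomorphisms of square zero -/

section OfDual

/-- The action `(a + bε) z = a z + b d(z)` of the functions on `Spec ℂ[ε] × Z`. -/
def dualAct {P : Mod Z} (d : P ⟶ P) {V : Opens Z.carrier} (c : Fn (dual Z) V) (z : Sec P V) :
    Sec P V :=
  reFn c • z + imFn c • app d V z

section

variable {P : Mod Z} (d : P ⟶ P) {V : Opens Z.carrier} (c c' : Fn (dual Z) V) (z z' : Sec P V)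

theorem dualAct_one : dualAct d (1 : Fn (dual Z) V) z = z := by
  have h1 : imFn (1 : Fn (dual Z) V) = 0 := by
    rw [← map_one (incFn (DualNumber ℂ) V)]
    exact imFn_inc 1
  have h2 : reFn (1 : Fn (dual Z) V) = 1 := map_one (pullFn (closedFibre (DualNumber ℂ) Z) V)
  rw [dualAct, h1, h2, zero_smul, add_zero, one_smul]

theorem dualAct_zero_left : dualAct d (0 : Fn (dual Z) V) z = 0 := by
  have h1 : imFn (0 : Fn (dual Z) V) = 0 := map_zero _
  have h2 : reFn (0 : Fn (dual Z) V) = 0 := map_zero (pullFn (closedFibre (DualNumber ℂ) Z) V)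
  rw [dualAct, h1, h2, zero_smul, zero_smul, add_zero]

theorem dualAct_mul (hd : d ≫ d = 0) : dualAct d (c * c') z = dualAct d c (dualAct d c' z) := by
  have hdd : app d V (app d V z) = 0 := congrArg (fun g => app g V z) hd
  have h2 : reFn (c * c') = reFn c * reFn c' := map_mul (pullFn (closedFibre _ Z) V) c c'
  rw [dualAct, dualAct, dualAct, map_add, map_smul, map_smul, hdd, h2, imFn_mul, add_smul,
    mul_smul, mul_smul, mul_smul, smul_add, smul_zero, add_zero, add_assoc]

theorem dualAct_zero : dualAct d c (0 : Sec P V) = 0 := by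
  rw [dualAct, map_zero, smul_zero, smul_zero, add_zero]

theorem dualAct_add : dualAct d c (z + z') = dualAct d c z + dualAct d c z' := by
  rw [dualAct, dualAct, dualAct, map_add, smul_add, smul_add, add_add_add_comm]

theorem dualAct_add_left : dualAct d (c + c') z = dualAct d c z + dualAct d c' z := by
  rw [dualAct, dualAct, dualAct, reFn_add, imFn_add, add_smul, add_smul, add_add_add_comm]

theorem dualAct_incFn (o : Fn Z V) : dualAct d (incFn (DualNumber ℂ) V o) z = o • z := by
  rw [dualAct, reFn_inc, imFn_inc, zero_smul, add_zero]

theorem dualAct_epsFn : dualAct d (epsFn Z V) z = app d V z := by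
  rw [dualAct, reFn_eps, imFn_eps, zero_smul, zero_add, one_smul]

theorem res_dualAct {W : Opens Z.carrier} (h : W ≤ V) :
    res P h (dualAct d c z) = dualAct d (resFn (X := dual Z) h c : Fn (dual Z) W) (res P h z) := by
  rw [dualAct, dualAct, res_add, res_smul, res_smul, ← app_res, ← resFn_reFn, ← resFn_imFn]

end

variable (P : Mod Z) (d : P ⟶ P) (hd : d ≫ d = 0)

/-- The presheaf of sections of `P`, on the space underlying `Spec ℂ[ε] × Z`. -/
def dualPresheaf : (Opens (dual Z).carrier)ᵒᵖ ⥤ AddCommGrpCat.{0} := P.val.presheaf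

/-- The module structure given by the action `(a + bε) z = a z + b d(z)`. -/
@[reducible]
def dualModule (V : (Opens (dual Z).carrier)ᵒᵖ) :
    Module ((ringSheaf (dual Z)).obj.obj V) ((dualPresheaf P).obj V) where
  smul c z := dualAct (Z := Z) (V := V.unop) d c (z : Sec P V.unop)
  one_smul z := dualAct_one d (z : Sec P V.unop)
  mul_smul c c' z := dualAct_mul (V := V.unop) d c c' (z : Sec P V.unop) hd
  smul_zero c := dualAct_zero (V := V.unop) d c
  smul_add c z z' := dualAct_add (V := V.unop) d c (z : Sec P V.unop) z'
  add_smul c c' z := dualAct_add_left (V := V.unop) d c c' (z : Sec P V.unop)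
  zero_smul z := dualAct_zero_left d (z : Sec P V.unop)

/-- The sheaf of modules on `Spec ℂ[ε] × Z` given by a sheaf of modules `P` on `Z` with an
endomorphism `d` of square zero, by which `ε` acts. -/
def ofDual : Mod (dual Z) where
  val :=
    letI := dualModule P d hd
    PresheafOfModules.ofPresheaf (R := (ringSheaf (dual Z)).obj) (dualPresheaf P)
      fun V _ f c z => res_dualAct (V := V.unop) d c (z : Sec P V.unop) f.unop.le
  isSheaf := P.isSheaf

/-- The `𝒪_Z`-module underlying `ofDual P d` is `P`. -/
def directOfDual : direct (ofDual P d hd) ≅ P where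
  hom := homOfApp
    (fun V =>
      { toFun := fun z => (z : Sec P V)
        map_add' := fun _ _ => rfl
        map_smul' := fun o z => dualAct_incFn d (z : Sec P V) o })
    (fun _ _ => rfl)
  inv := homOfApp
    (fun V =>
      { toFun := fun z => (z : Sec P V)
        map_add' := fun _ _ => rfl
        map_smul' := fun o z => (dualAct_incFn d (z : Sec P V) o).symm })
    (fun _ _ => rfl)
  hom_inv_id := rfl
  inv_hom_id := rfl

theorem directOfDual_inv_epsMul :
    (directOfDual P d hd).hom ≫ d ≫ (directOfDual P d hd).inv = epsMul (ofDual P d hd) := by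
  refine hom_ext_app fun V z => ?_
  exact (dualAct_epsFn d (z : Sec P V)).symm

end OfDual

/-- An extension of `E` by itself defines a sheaf on `Spec ℂ[ε] × Z`. -/
theorem exists_isDualExt_of_shortExact {E P : Mod Z} {ι : E ⟶ P} {p : P ⟶ E} (w : ι ≫ p = 0)
    (hS : (ShortComplex.mk ι p w).ShortExact) :
    ∃ (F : Mod (dual Z)) (a : direct F ≅ P), IsDualExt F (ι ≫ a.inv) (a.hom ≫ p) := by
  have hd : (p ≫ ι) ≫ (p ≫ ι) = 0 := by
    rw [Category.assoc, ← Category.assoc ι, w, zero_comp, comp_zero]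
  let a := directOfDual P (p ≫ ι) hd
  have h0 : (ι ≫ a.inv) ≫ (a.hom ≫ p) = 0 := by
    rw [Category.assoc, Iso.inv_hom_id_assoc, w]
  refine ⟨ofDual P (p ≫ ι) hd, a, h0, ?_, ?_⟩
  · let e : ShortComplex.mk ι p w ≅ ShortComplex.mk (ι ≫ a.inv) (a.hom ≫ p) h0 :=
      ShortComplex.isoMk (Iso.refl _) a.symm (Iso.refl _) (by simp) (by simp)
    exact ShortComplex.shortExact_of_iso e hS
  · rw [← directOfDual_inv_epsMul]
    simp [a]

end DualNumbers

/-! ### Lifting extensions along an exact functor -/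

section GluedExtension

universe w v u v' u'

variable {C : Type u} [Category.{v} C] [Abelian C] {C' : Type u'} [Category.{v'} C'] [Abelian C']

/-- For an extension `0 → E → P → E → 0` and a morphism `P → V` restricting to an epimorphism
`E → V`, the kernel of `P → V` is an extension of `E` by the kernel of `E → V`. -/
theorem shortExact_kernel {E P V : C'} {ι : E ⟶ P} {p : P ⟶ E} {w₀ : ι ≫ p = 0}
    (hS : (ShortComplex.mk ι p w₀).ShortExact) {φ : P ⟶ V} {w : E ⟶ V} [Epi w] (hφ : ι ≫ φ = w) :
    (ShortComplex.mk (kernel.lift φ (kernel.ι w ≫ ι) (by rw [Category.assoc, hφ, kernel.condition]))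
      (kernel.ι φ ≫ p) (by rw [kernel.lift_ι_assoc, Category.assoc, w₀, comp_zero])).ShortExact := by
  have : Mono ι := hS.mono_f
  have : Epi p := hS.epi_g
  have : Mono (kernel.lift φ (kernel.ι w ≫ ι) (by rw [Category.assoc, hφ, kernel.condition])) :=
    mono_of_mono_fac (kernel.lift_ι _ _ _)
  have : Epi (kernel.ι φ ≫ p) := by
    refine Preadditive.epi_of_cancel_zero _ fun {T} g hg => ?_
    -- `p ≫ g` vanishes on the kernel of `φ`, so it factors through `φ`, which is epi
    have : Epi φ := epi_of_epi_fac hφ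
    have hS' : (ShortComplex.mk _ _ (kernel.condition φ)).ShortExact :=
      ⟨ShortComplex.exact_kernel _⟩
    have h1 : φ ≫ hS'.exact.desc (p ≫ g) (by rw [← Category.assoc]; exact hg) = p ≫ g :=
      hS'.exact.g_desc _ _
    have h2 : w ≫ hS'.exact.desc (p ≫ g) (by rw [← Category.assoc]; exact hg) = 0 := by
      rw [← hφ, Category.assoc, h1, ← Category.assoc, w₀, zero_comp]
    rw [(cancel_epi w).1 (h2.trans comp_zero.symm), comp_zero] at h1
    exact (cancel_epi p).1 (h1.symm.trans comp_zero.symm)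
  refine shortExact_of_lift _ _ _ fun T k hk => ?_
  have h1 : (k ≫ kernel.ι φ) ≫ p = 0 := by rw [Category.assoc, hk]
  have h2 : hS.exact.lift (k ≫ kernel.ι φ) h1 ≫ ι = k ≫ kernel.ι φ := hS.exact.lift_f _ _
  have h3 : hS.exact.lift (k ≫ kernel.ι φ) h1 ≫ w = 0 := by
    rw [← hφ, ← Category.assoc, h2, Category.assoc, kernel.condition, comp_zero]
  refine ⟨kernel.lift w _ h3, ?_⟩
  rw [← cancel_mono (kernel.ι φ), Category.assoc, kernel.lift_ι, kernel.lift_ι_assoc, h2]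

/-- Lifting of extensions with additional structure. Let `0 → E' → P' → E' → 0` be an extension and
`P' → V'` a morphism extending an epimorphism `w' : E' → V'`. Along an exact functor `T` and
compatible morphisms `E → T E'` and `w : E → V` which induce an epimorphism `ker w → T (ker w')`
with kernel `N`, these data lift to an extension of `E` by `E` if `Ext²(E, N) = 0`.

The obstruction to lifting vanishes for the extension `ker (P' → V')` of `E'` by `ker w'`, from which
the extension `P'` arises by pushout. -/
theorem exists_glued_extension [EnoughInjectives C] [HasExt.{w} C] (T : C' ⥤ C) [T.Additive]
    (hT : ∀ S : ShortComplex C', S.ShortExact → (S.map T).ShortExact)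
    {E V : C} {E' V' P' : C'} {ι' : E' ⟶ P'} {p' : P' ⟶ E'} {w₀ : ι' ≫ p' = 0}
    (hS : (ShortComplex.mk ι' p' w₀).ShortExact) {φ' : P' ⟶ V'} {w' : E' ⟶ V'} [Epi w']
    (hφ : ι' ≫ φ' = w') (w : E ⟶ V) (π : E ⟶ T.obj E') (μ : kernel w ⟶ T.obj (kernel w')) [Epi μ]
    (hμ : μ ≫ T.map (kernel.ι w') = kernel.ι w ≫ π)
    (h : Subsingleton (Abelian.Ext.{w} E (kernel μ) 2)) :
    ∃ (P : C) (ι : E ⟶ P) (p : P ⟶ E) (w₁ : ι ≫ p = 0) (φ : P ⟶ V) (c : P ⟶ T.obj P'),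
      (ShortComplex.mk ι p w₁).ShortExact ∧ ι ≫ φ = w ∧ ι ≫ c = π ≫ T.map ι' ∧
      c ≫ T.map p' = p ≫ π ∧
      ∀ (U : C) (f : T.obj V' ⟶ U) (g : V ⟶ U), π ≫ T.map w' ≫ f = w ≫ g →
        c ≫ T.map φ' ≫ f = φ ≫ g := by
  -- the pullback to `E` of the extension `T (ker φ')` of `T E'` by `T (ker w')`
  have hK := hT _ (shortExact_kernel hS hφ)
  have hG := shortExact_pullback hK π
  have hN : (ShortComplex.mk _ _ (kernel.condition μ)).ShortExact := ⟨ShortComplex.exact_kernel _⟩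
  obtain ⟨F, m, e, w₂, c₀, hF, hc₁, hc₂⟩ := exists_lift_extension hN hG h
  -- `F` is a lift of it to an extension of `E` by `ker w`, with a map to `T P'` through `T (ker φ')`
  let κ : F ⟶ T.obj P' := c₀ ≫ Limits.pullback.snd _ _ ≫ T.map (kernel.ι φ')
  have hκp : κ ≫ T.map p' = e ≫ π := by
    have h1 := Limits.pullback.condition (f := π) (g := T.map (kernel.ι φ' ≫ p'))
    rw [← hc₂]
    refine Eq.trans ?_ ((congrArg (fun z => c₀ ≫ z) h1).symm.trans (Category.assoc _ _ _).symm)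
    simp [κ]
  have hκφ : κ ≫ T.map φ' = 0 := by
    simp only [κ, Category.assoc, ← T.map_comp, kernel.condition, T.map_zero, comp_zero]
  have hκm : m ≫ κ = kernel.ι w ≫ π ≫ T.map ι' := by
    rw [← Category.assoc (kernel.ι w), ← hμ, Category.assoc, ← T.map_comp]
    have h1 := congrArg (fun z => z ≫ Limits.pullback.snd _ _ ≫ T.map (kernel.ι φ')) hc₁
    refine Eq.trans (by simp [κ]) (h1.trans ?_)
    simp only [Category.assoc]
    rw [Limits.pullback.lift_snd_assoc]
    rw [← T.map_comp, kernel.lift_ι]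
  -- the pushout `P` of `F` along `ker w → E`, on which `φ` is `w` on `E` and zero on `F`
  have hP := shortExact_pushout hF (kernel.ι w)
  have hc : kernel.ι w ≫ π ≫ T.map ι' = m ≫ κ := hκm.symm
  refine ⟨_, _, _, _, pushout.desc w 0 (by rw [kernel.condition, comp_zero]),
    pushout.desc (π ≫ T.map ι') κ hc, hP, pushout.inl_desc _ _ _, pushout.inl_desc _ _ _, ?_, ?_⟩
  · apply pushout.hom_ext
    · rw [pushout.inl_desc_assoc, pushout.inl_desc_assoc, Category.assoc, ← T.map_comp, w₀,
        T.map_zero, comp_zero, zero_comp]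
    · rw [pushout.inr_desc_assoc, pushout.inr_desc_assoc, hκp]
  · intro U f g hfg
    apply pushout.hom_ext
    · rw [pushout.inl_desc_assoc, pushout.inl_desc_assoc, Category.assoc, ← hfg, ← hφ, T.map_comp,
        Category.assoc]
    · rw [pushout.inr_desc_assoc, pushout.inr_desc_assoc, ← Category.assoc, hκφ, zero_comp, zero_comp]

end GluedExtension

/-! ### Morphisms over the dual numbers -/

section DirectMap

variable {X Y : CSpace}

/-- The pullback of functions along `Spec ℂ[ε] × Y → Spec ℂ[ε] × X` induced by `i : Y → X`. -/
def dualPullFn (i : Y ⟶ X) (V : Opens X.carrier) :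
    Fn (dual X) V →+* Fn (dual Y) ((Opens.map i.hom.base).obj V) :=
  pullFn (thickenMap (AlgHom.id ℂ (DualNumber ℂ)) i) V

theorem coordFn_dualPullFn (ℓ : DualNumber ℂ →ₗ[ℂ] ℂ) (i : Y ⟶ X) (V : Opens X.carrier)
    (c : Fn (dual X) V) : coordFn ℓ ((Opens.map i.hom.base).obj V) (dualPullFn i V c) =
      pullFn i V (coordFn ℓ V c) := by
  have h : ℓ ∘ₗ (AlgHom.id ℂ (DualNumber ℂ)).toLinearMap = ℓ := LinearMap.ext fun _ => rfl
  have h1 := coordFn_pullFn ℓ (AlgHom.id ℂ (DualNumber ℂ)) i V c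
  rw [h] at h1
  exact h1

theorem reFn_eq_coordFn {V : Opens X.carrier} (c : Fn (dual X) V) :
    reFn c = coordFn (residueHom (DualNumber ℂ)).toLinearMap V c := pullFn_closedFibre V c

theorem reFn_dualPullFn (i : Y ⟶ X) (V : Opens X.carrier) (c : Fn (dual X) V) :
    reFn (dualPullFn i V c) = pullFn i V (reFn c) := by
  rw [reFn_eq_coordFn, reFn_eq_coordFn, coordFn_dualPullFn]

theorem imFn_dualPullFn (i : Y ⟶ X) (V : Opens X.carrier) (c : Fn (dual X) V) :
    imFn (dualPullFn i V c) = pullFn i V (imFn c) :=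
  coordFn_dualPullFn _ i V c

theorem dualPullFn_epsFn (i : Y ⟶ X) (V : Opens X.carrier) :
    dualPullFn i V (epsFn X V) = epsFn Y ((Opens.map i.hom.base).obj V) :=
  pullFn_scalFn _ i V _

/-- The effect of a morphism `(Spec ℂ[ε] × Y, G) → (Spec ℂ[ε] × X, F)` over `i : Y → X` on the
underlying sheaves of modules on `X`. -/
def directMap (i : Y ⟶ X) {G : Mod (dual Y)} {F : Mod (dual X)}
    (β : F ⟶ (pushforward (thickenMap (AlgHom.id ℂ (DualNumber ℂ)) i)).obj G) :
    direct F ⟶ (pushforward i).obj (direct G) :=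
  homOfApp
    (fun V =>
      { toFun := fun z => app β V (z : F.val.obj (op V))
        map_add' := fun z w => map_add (app β V) _ _
        map_smul' := fun o z => by
          refine (map_smul (app β V) (incFn (DualNumber ℂ) V o : Fn (dual X) V) _).trans ?_
          exact congrArg (fun a : Fn (dual Y) ((Opens.map i.hom.base).obj V) =>
            (a • (show Sec (direct G) ((Opens.map i.hom.base).obj V) from
              app β V (z : F.val.obj (op V))) : Sec (direct G) ((Opens.map i.hom.base).obj V)))
            (pullFn_incFn _ i V o) })
    (fun h z => app_res β h z)

theorem epsMul_directMap (i : Y ⟶ X) {G : Mod (dual Y)} {F : Mod (dual X)}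
    (β : F ⟶ (pushforward (thickenMap (AlgHom.id ℂ (DualNumber ℂ)) i)).obj G) :
    epsMul F ≫ directMap i β = directMap i β ≫ (pushforward i).map (epsMul G) := by
  refine hom_ext_app fun V z => ?_
  refine (map_smul (app β V) (epsFn X V) (z : F.val.obj (op V))).trans ?_
  exact congrArg (fun a : Fn (dual Y) ((Opens.map i.hom.base).obj V) =>
    (a • (show Sec (direct G) ((Opens.map i.hom.base).obj V) from
      app β V (z : F.val.obj (op V))) : Sec (direct G) ((Opens.map i.hom.base).obj V)))
    (dualPullFn_epsFn i V)

/-- The effect on sections of a morphism `E → i_* E'`. -/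
def secMap (i : Y ⟶ X) {E : Mod X} {E' : Mod Y} (b : E ⟶ (pushforward i).obj E')
    (V : Opens X.carrier) : Sec E V →+ Sec E' ((Opens.map i.hom.base).obj V) :=
  (app b V).toAddMonoidHom

theorem secMap_smul (i : Y ⟶ X) {E : Mod X} {E' : Mod Y} (b : E ⟶ (pushforward i).obj E')
    (V : Opens X.carrier) (c : Fn X V) (z : Sec E V) :
    secMap i b V (c • z) = pullFn i V c • secMap i b V z :=
  map_smul (app b V) c z

theorem secMap_dual_smul (i : Y ⟶ X) {G : Mod (dual Y)} {F : Mod (dual X)}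
    (b : direct F ⟶ (pushforward i).obj (direct G))
    (hb : epsMul F ≫ b = b ≫ (pushforward i).map (epsMul G)) (V : Opens X.carrier)
    (c : Fn (dual X) V) (z : Sec (direct F) V) :
    secMap i b V (c • z) =
      dualPullFn i V c • secMap i b V z := by
  have hε : ∀ z : Sec (direct F) V, secMap i b V (epsFn X V • z) =
      epsFn Y ((Opens.map i.hom.base).obj V) • secMap i b V z := fun z =>
    congrArg (fun g => app g V z) hb
  rw [dual_smul, map_add, secMap_smul, hε, secMap_smul]
  refine Eq.symm ((dual_smul G (dualPullFn i V c) (secMap i b V z)).trans ?_)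
  rw [reFn_dualPullFn, imFn_dualPullFn]

/-- A morphism between the underlying modules which commutes with `ε` comes from a morphism
`(Spec ℂ[ε] × Y, G) → (Spec ℂ[ε] × X, F)`. -/
def ofDirectMap (i : Y ⟶ X) {G : Mod (dual Y)} {F : Mod (dual X)}
    (b : direct F ⟶ (pushforward i).obj (direct G))
    (hb : epsMul F ≫ b = b ≫ (pushforward i).map (epsMul G)) :
    (⟨dual Y, G⟩ : ModSpace) ⟶ ⟨dual X, F⟩ :=
  ModSpace.ofSections (P := ⟨dual Y, G⟩) (Q := ⟨dual X, F⟩)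
    (thickenMap (AlgHom.id ℂ (DualNumber ℂ)) i) (fun V => secMap i b V)
    (fun V c z => secMap_dual_smul i b hb V c z) (fun h z => app_res b h z)

/-- A morphism over the dual numbers is cartesian if its reduction modulo `ε` is. -/
theorem isCartesian_ofDirectMap (i : Y ⟶ X) {G : Mod (dual Y)} {F : Mod (dual X)}
    (b : direct F ⟶ (pushforward i).obj (direct G))
    (hb : epsMul F ≫ b = b ≫ (pushforward i).map (epsMul G))
    {E : Mod X} {ι : E ⟶ direct F} {p : direct F ⟶ E} (h : IsDualExt F ι p) (hE : IsLocallyFree E)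
    {E' : Mod Y} {ι' : E' ⟶ direct G} {p' : direct G ⟶ E'} (h' : IsDualExt G ι' p')
    (w : E ⟶ (pushforward i).obj E')
    (hw : ModSpace.Hom.IsCartesian (⟨i, w⟩ : (⟨Y, E'⟩ : ModSpace) ⟶ ⟨X, E⟩))
    (hbw : b ≫ (pushforward i).map p' = p ≫ w) :
    ModSpace.Hom.IsCartesian (ofDirectMap i b hb) := by
  refine ModSpace.isCartesian_of_isLocalBasis _ fun y => ?_
  obtain ⟨U, hx, n, e, he, hp⟩ := h.exists_isLocalBasis hE (i.hom.base y)
  refine ⟨U, hx, n, e, he, ?_⟩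
  have h1 := ModSpace.IsCartesian.isLocalBasis
    (f := (⟨i, w⟩ : (⟨Y, E'⟩ : ModSpace) ⟶ ⟨X, E⟩)) hw (e := fun k => app p U (e k)) hp
  have h2 : (fun k => app p' ((Opens.map i.hom.base).obj U)
      (app b U (e k) : Sec (direct G) ((Opens.map i.hom.base).obj U))) =
      fun k => ModSpace.pb (⟨i, w⟩ : (⟨Y, E'⟩ : ModSpace) ⟶ ⟨X, E⟩) U (app p U (e k)) :=
    funext fun k => congrArg (fun g => app g U (e k)) hbw
  rw [← h2] at h1
  exact h'.isLocalBasis (U := (Opens.map i.hom.base).obj U) (e := fun k => secMap i b U (e k)) h1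

end DirectMap

/-! ### The constant framing over the dual numbers -/

section Frame

variable (D : FramingData)

/-- The inclusion of the closed fibre `D.closedFibre` in terms of the underlying modules on `Y`. -/
def frameFst : direct (D.thicken (DualNumber ℂ)).W ⟶ D.W :=
  fibreMap (D.closedFibre (DualNumber ℂ)).map

/-- The pullback of sections along `Spec ℂ[ε] × Y → Y`. -/
def frameInl : D.W ⟶ direct (D.thicken (DualNumber ℂ)).W := (D.proj (DualNumber ℂ)).map

theorem frameInl_frameFst : frameInl D ≫ frameFst D = 𝟙 D.W := by
  refine hom_ext_app fun V z => ?_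
  have h := ModSpace.pb_eq_of_eq (D.closedFibre_proj (DualNumber ℂ)) V z
  exact h.trans (res_self _ _ _)

theorem isCartesian_id (P : ModSpace) : ModSpace.Hom.IsCartesian (𝟙 P) := by
  rw [ModSpace.isCartesian_iff_bijective]
  intro N
  exact Function.bijective_id

theorem isCartesian_closedFibre : ModSpace.Hom.IsCartesian (D.closedFibre (DualNumber ℂ)) :=
  ModSpace.isCartesian_lift _ _ _ _ (isCartesian_id _)

/-- The pullback of `W` to `Spec ℂ[ε] × Y` is the split extension of `W` by `W`: the sections are
`j(a) + ε j(b)` for the pullback `j` of sections along the projection. -/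
theorem exists_frame_splitting (hW : IsLocallyFree D.W) :
    ∃ (ι : D.W ⟶ direct (D.thicken (DualNumber ℂ)).W) (r : direct (D.thicken (DualNumber ℂ)).W ⟶ D.W),
      IsDualExt (D.thicken (DualNumber ℂ)).W ι (frameFst D) ∧
      frameInl D ≫ epsMul _ = ι ∧ epsMul _ ≫ r = frameFst D ∧
      frameFst D ≫ frameInl D + r ≫ ι = 𝟙 _ := by
  have hF : IsLocallyFree (D.thicken (DualNumber ℂ)).W :=
    isLocallyFree_of_isCartesian _ (D.isCartesian_proj (DualNumber ℂ)) hW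
  obtain ⟨ι, h⟩ := exists_isDualExt (D.closedFibre (DualNumber ℂ)).map (isCartesian_closedFibre D) hF
  have := h.mono
  have h0 : (𝟙 _ - frameFst D ≫ frameInl D) ≫ frameFst D = 0 := by
    rw [Preadditive.sub_comp, Category.assoc, frameInl_frameFst]
    simp
  let r := h.shortExact.exact.lift (𝟙 _ - frameFst D ≫ frameInl D) h0
  have hr : r ≫ ι = 𝟙 _ - frameFst D ≫ frameInl D := h.shortExact.exact.lift_f _ h0
  have hi : frameInl D ≫ epsMul _ = ι := by
    rw [← h.eps, ← Category.assoc]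
    exact (congrArg (fun z => z ≫ ι) (frameInl_frameFst D)).trans (Category.id_comp _)
  refine ⟨ι, r, h, hi, ?_, ?_⟩
  · rw [← cancel_mono ι, Category.assoc, hr, Preadditive.comp_sub, Category.comp_id]
    have h1 : epsMul _ ≫ frameFst D = 0 := by
      rw [← h.eps, Category.assoc]
      exact (congrArg (fun z => _ ≫ z) h.comp_eq_zero).trans comp_zero
    rw [← Category.assoc, h1, zero_comp, sub_zero]
    exact h.eps.symm
  · rw [hr]
    abel

end Frame

/-! ### Lifting first-order deformations -/

/-- Morphisms over the same base map agree if their maps of sheaves do. The equality of the base maps is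
only propositional, whence the transport. -/
theorem ModSpace.eq_iff_map {P Q : ModSpace} {f g : P ⟶ Q} (hb : f.base = g.base) :
    f = g ↔ f.map ≫ eqToHom (by rw [hb]) = g.map := by
  obtain ⟨fb, fm⟩ := f
  obtain ⟨gb, gm⟩ := g
  obtain rfl : fb = gb := hb
  refine Iff.trans ?_ (iff_of_eq (congrArg (fun z => z = gm) (Category.comp_id fm).symm))
  constructor
  · intro h
    have h2 : (⟨fb, fm⟩ : ModSpace.Hom P Q) = ⟨fb, gm⟩ := h
    injection h2
  · intro h
    exact ModSpace.Hom.ext rfl (heq_of_eq h)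

/-- A cartesian morphism over `f` is, up to the isomorphism it defines, the canonical one from the
inverse image. -/
theorem ModSpace.vert_iso_comp_pull {P Q : ModSpace} {f : P ⟶ Q} (hf : ModSpace.Hom.IsCartesian f) :
    ModSpace.vert hf.iso.hom ≫ ModSpace.pull f.base Q.mod = f := by
  refine Eq.trans ?_ (ModSpace.ofPullback_iso hf)
  have h := (pullbackAdj f.base).homEquiv_unit Q.mod P.mod hf.iso.hom
  exact ModSpace.Hom.ext rfl (heq_of_eq h.symm)

instance {X Y : CSpace} (f : X ⟶ Y) : (pushforward f).Additive where
  map_add := rfl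

/-- The map `E → i_* W` corresponding to a framing `E|_Y ≅ W`. -/
def FramedBundle.restrMap {D : FramingData} (B : FramedBundle D) : B.E ⟶ (pushforward D.i).obj D.W :=
  B.restr.map

/-- The canonical map `E → x_* x^* E` to the restriction along a morphism of framing data. -/
def FramedBundle.pullUnit {D' D : FramingData} (κ : FramingData.Hom D' D) (B : FramedBundle D) :
    B.E ⟶ (pushforward κ.x).obj (B.pull κ).E :=
  (pullbackAdj κ.x).unit.app B.E

section Assembly

variable {D' D : FramingData} (κ : FramingData.Hom D' D) (B : FramedBundle D)

theorem pushforward_comp_obj {X Y Z : CSpace} (f : X ⟶ Y) (g : Y ⟶ Z) (E : Mod X) :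
    (pushforward (f ≫ g)).obj E = (pushforward g).obj ((pushforward f).obj E) := rfl

theorem pushforward_obj_comm : (pushforward κ.x).obj ((pushforward D'.i).obj D'.W) =
    (pushforward D.i).obj ((pushforward κ.w.base).obj D'.W) := by
  rw [← pushforward_comp_obj, ← pushforward_comp_obj, κ.comm]

/-- The compatibility of framings with restriction, as a commutative square of sheaves on `X`. The
two iterated direct images of `W'` agree only propositionally. -/
theorem pullUnit_restrMap : B.pullUnit κ ≫ (pushforward κ.x).map (B.pull κ).restrMap ≫
      eqToHom (pushforward_obj_comm κ) =
    B.restrMap ≫ (pushforward D.i).map κ.w.map := by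
  have h0 := FramedBundle.ofPullback_framing_pull κ B
  have h := (ModSpace.eq_iff_map κ.comm).1 h0
  have h1 := Category.assoc (B.pullUnit κ) ((pushforward κ.x).map (B.pull κ).restrMap)
    (eqToHom (pushforward_obj_comm κ))
  exact h1.symm.trans h

theorem pb_thicken_frameInl (V : Opens D.Y.carrier) (x : Sec D.W V) :
    ModSpace.pb (κ.thicken (DualNumber ℂ)).w V (app (frameInl D) V x) =
      app (frameInl D') ((Opens.map κ.w.base.hom.base).obj V) (ModSpace.pb κ.w V x) := by
  have h := ModSpace.pb_eq_of_eq (κ.thicken_w_proj (DualNumber ℂ)) V x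
  exact h.trans (res_self _ _ _)

theorem pb_thicken_epsMul (V : Opens D.Y.carrier) (x : Sec (direct (D.thicken (DualNumber ℂ)).W) V) :
    ModSpace.pb (κ.thicken (DualNumber ℂ)).w V (app (epsMul _) V x) =
      app (epsMul _) ((Opens.map κ.w.base.hom.base).obj V)
        (ModSpace.pb (κ.thicken (DualNumber ℂ)).w V x :
          Sec (D'.thicken (DualNumber ℂ)).W ((Opens.map κ.w.base.hom.base).obj V)) := by
  refine (ModSpace.pb_smul (κ.thicken (DualNumber ℂ)).w V (epsFn D.Y V) x).trans ?_
  have h := dualPullFn_epsFn κ.w.base V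
  exact congrArg (fun a : Fn (dual D'.Y) ((Opens.map κ.w.base.hom.base).obj V) =>
    a • (show Sec (direct (D'.thicken (DualNumber ℂ)).W) ((Opens.map κ.w.base.hom.base).obj V) from
      ModSpace.pb (κ.thicken (DualNumber ℂ)).w V x)) h

theorem preimage_comm (V : Opens D.X.carrier) :
    (Opens.map D'.i.hom.base).obj ((Opens.map κ.x.hom.base).obj V) ≤
      (Opens.map κ.w.base.hom.base).obj ((Opens.map D.i.hom.base).obj V) :=
  le_of_eq (congrArg (fun f : D'.Y ⟶ D.X => (Opens.map f.hom.base).obj V) κ.comm)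

set_option maxHeartbeats 1000000 in
/-- Morphisms `b` and `b'` over the inclusions of the subspaces, with components `u + ε v` and
`u' + ε v'`, are compatible if their components are. -/
theorem ofDirectMap_comp {F' : Mod (dual D'.X)} {F : Mod (dual D.X)}
    (c : direct F ⟶ (pushforward κ.x).obj (direct F'))
    (hc : epsMul F ≫ c = c ≫ (pushforward κ.x).map (epsMul F'))
    (b' : direct F' ⟶ (pushforward D'.i).obj (direct (D'.thicken (DualNumber ℂ)).W))
    (hb' : epsMul F' ≫ b' = b' ≫ (pushforward D'.i).map (epsMul _))
    (b : direct F ⟶ (pushforward D.i).obj (direct (D.thicken (DualNumber ℂ)).W))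
    (hb : epsMul F ≫ b = b ≫ (pushforward D.i).map (epsMul _))
    {ι' : D'.W ⟶ direct (D'.thicken (DualNumber ℂ)).W} (hι' : frameInl D' ≫ epsMul _ = ι')
    {ι : D.W ⟶ direct (D.thicken (DualNumber ℂ)).W} (hι : frameInl D ≫ epsMul _ = ι)
    {u' v' : direct F' ⟶ (pushforward D'.i).obj D'.W}
    (huv' : b' = u' ≫ (pushforward D'.i).map (frameInl D') + v' ≫ (pushforward D'.i).map ι')
    {u v : direct F ⟶ (pushforward D.i).obj D.W}
    (huv : b = u ≫ (pushforward D.i).map (frameInl D) + v ≫ (pushforward D.i).map ι)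
    (hu : c ≫ (pushforward κ.x).map u' ≫ eqToHom (pushforward_obj_comm κ) =
      u ≫ (pushforward D.i).map κ.w.map)
    (hv : c ≫ (pushforward κ.x).map v' ≫ eqToHom (pushforward_obj_comm κ) =
      v ≫ (pushforward D.i).map κ.w.map) :
    ofDirectMap D'.i b' hb' ≫ ofDirectMap κ.x c hc =
      (κ.thicken (DualNumber ℂ)).w ≫ ofDirectMap D.i b hb := by
  -- `hu` and `hv` on sections
  have key : ∀ (u' : direct F' ⟶ (pushforward D'.i).obj D'.W)
      (u : direct F ⟶ (pushforward D.i).obj D.W),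
      c ≫ (pushforward κ.x).map u' ≫ eqToHom (pushforward_obj_comm κ) =
      u ≫ (pushforward D.i).map κ.w.map → ∀ (V : Opens D.X.carrier) (z : Sec (direct F) V),
      secMap D'.i u' _ (secMap κ.x c V z) =
        res D'.W (preimage_comm κ V) (ModSpace.pb κ.w _ (secMap D.i u V z)) := by
    intro u' u hu V z
    have h : (⟨D'.i, u'⟩ : (⟨D'.Y, D'.W⟩ : ModSpace) ⟶ ⟨D'.X, direct F'⟩) ≫
        (⟨κ.x, c⟩ : (⟨D'.X, direct F'⟩ : ModSpace) ⟶ ⟨D.X, direct F⟩) =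
        κ.w ≫ (⟨D.i, u⟩ : (⟨D.Y, D.W⟩ : ModSpace) ⟶ ⟨D.X, direct F⟩) :=
      (ModSpace.eq_iff_map κ.comm).2 ((Category.assoc _ _ _).trans hu)
    exact ModSpace.pb_eq_of_eq h V z
  refine ModSpace.hom_ext_pb (κ.thicken (DualNumber ℂ)).comm fun (V : Opens D.X.carrier)
    (z : Sec (direct F) V) => ?_
  have hL : ModSpace.pb (ofDirectMap D'.i b' hb' ≫ ofDirectMap κ.x c hc) V z =
      app (frameInl D') _ (secMap D'.i u' _ (secMap κ.x c V z)) +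
        app ι' _ (secMap D'.i v' _ (secMap κ.x c V z)) :=
    congrArg (fun g => secMap D'.i g _ (secMap κ.x c V z)) huv'
  have hb0 : secMap D.i b V z =
      app (frameInl D) _ (secMap D.i u V z) + app ι _ (secMap D.i v V z) :=
    congrArg (fun g => secMap D.i g V z) huv
  have hι0 : ∀ (U : Opens D.Y.carrier) (x : Sec D.W U),
      ModSpace.pb (κ.thicken (DualNumber ℂ)).w U (app ι U x) =
        app ι' ((Opens.map κ.w.base.hom.base).obj U) (ModSpace.pb κ.w U x) := by
    intro U x
    subst hι hι'
    refine (pb_thicken_epsMul κ U (app (frameInl D) U x)).trans ?_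
    exact congrArg (app (epsMul (D'.thicken (DualNumber ℂ)).W) _) (pb_thicken_frameInl κ U x)
  have hR : ModSpace.pb ((κ.thicken (DualNumber ℂ)).w ≫ ofDirectMap D.i b hb) V z =
      app (frameInl D') _ (ModSpace.pb κ.w _ (secMap D.i u V z)) +
        app ι' _ (ModSpace.pb κ.w _ (secMap D.i v V z)) := by
    refine (congrArg (ModSpace.pb (κ.thicken (DualNumber ℂ)).w _) hb0).trans ?_
    refine (map_add (ModSpace.pb (κ.thicken (DualNumber ℂ)).w _) _ _).trans ?_
    exact congrArg₂ (fun y y' => y + y') (pb_thicken_frameInl κ _ _) (hι0 _ _)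
  rw [key u' u hu, key v' v hv, app_res, app_res, ← res_add] at hL
  exact hL.trans (congrArg (res (direct (D'.thicken (DualNumber ℂ)).W) _) hR.symm)

/-- The first-order deformation of `(E, α)` given by an extension of `E` by `E`, presented by a sheaf
`F` on `Spec ℂ[ε] × X`, and a lift `b` of the framing to `F`. -/
def deformationOfDualExt {F : Mod (dual D.X)} {ι : B.E ⟶ direct F} {p : direct F ⟶ B.E}
    (h : IsDualExt F ι p) (b : direct F ⟶ (pushforward D.i).obj (direct (D.thicken (DualNumber ℂ)).W))
    (hb : epsMul F ≫ b = b ≫ (pushforward D.i).map (epsMul _))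
    (hbp : b ≫ (pushforward D.i).map (frameFst D) = p ≫ B.restrMap)
    (hβ : ModSpace.Hom.IsCartesian (ofDirectMap D.i b hb)) : Deformation (DualNumber ℂ) B where
  fam :=
    { E := F
      locallyFree := h.isLocallyFree B.locallyFree
      framing := hβ.iso }
  ψ := (h.isCartesian_hom B.locallyFree).iso
  comm := by
    refine (congrArg (fun z => B.restr ≫ z)
      (ModSpace.ofPullback_iso (h.isCartesian_hom B.locallyFree))).trans (Eq.trans ?_
      (congrArg (fun z => D.closedFibre (DualNumber ℂ) ≫ z) (ModSpace.ofPullback_iso hβ)).symm)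
    refine ModSpace.hom_ext_pb (closedFibre_thickenMap (DualNumber ℂ) D.i).symm
      fun (V : Opens D.X.carrier) (z : Sec (direct F) V) => ?_
    exact (congrArg (fun g => app g V z) hbp).symm.trans
      (res_self ((pushforward D.i).obj D.W) le_rfl _).symm

/-- A cartesian morphism between the underlying sheaves identifies the restriction of a deformation
with a given one as soon as it is compatible with the framings and with the closed fibres. -/
theorem pull_isomorphic_of_isCartesian (ζ : Deformation (DualNumber ℂ) B)
    (η : Deformation (DualNumber ℂ) (B.pull κ))
    {γ : (⟨dual D'.X, η.fam.E⟩ : ModSpace) ⟶ ⟨dual D.X, ζ.fam.E⟩}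
    (hb : γ.base = (κ.thicken (DualNumber ℂ)).x) (hγ : ModSpace.Hom.IsCartesian γ)
    (h₁ : η.fam.restr ≫ γ = (κ.thicken (DualNumber ℂ)).w ≫ ζ.fam.restr)
    (h₂ : ModSpace.ofPullback (closedFibre (DualNumber ℂ) D'.X) η.ψ.hom ≫ γ =
      ModSpace.pull κ.x B.E ≫ ModSpace.ofPullback (closedFibre (DualNumber ℂ) D.X) ζ.ψ.hom) :
    (ζ.pull κ).Isomorphic η := by
  obtain ⟨g, m⟩ := γ
  obtain rfl : g = (κ.thicken (DualNumber ℂ)).x := hb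
  have hv := ModSpace.vert_iso_comp_pull hγ
  refine ⟨hγ.iso, ?_, ?_⟩
  · apply ModSpace.ofPullback_injective
    rw [ModSpace.ofPullback_map_comp]
    apply (ModSpace.isCartesian_pull (κ.thicken (DualNumber ℂ)).x ζ.fam.E).hom_ext
    · rfl
    · refine Eq.trans ?_ (FramedBundle.ofPullback_framing_pull (κ.thicken (DualNumber ℂ)) ζ.fam).symm
      refine (Category.assoc _ _ _).trans ?_
      exact (congrArg (fun z => η.fam.restr ≫ z) hv).trans h₁
  · apply ModSpace.ofPullback_injective
    rw [ModSpace.ofPullback_map_comp]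
    apply (ModSpace.isCartesian_pull (κ.thicken (DualNumber ℂ)).x ζ.fam.E).hom_ext
    · rfl
    · refine Eq.trans ?_ (ζ.ofPullback_ψ_pull κ).symm
      refine (Category.assoc _ _ _).trans ?_
      exact (congrArg (fun z => ModSpace.ofPullback (closedFibre (DualNumber ℂ) D'.X) η.ψ.hom ≫ z)
        hv).trans h₂

set_option maxHeartbeats 1000000 in
/-- Let `κ : (X', Y', W') → (X, Y, W)` be a morphism of framing data with `X' → X` a homeomorphism, and
let `E'` be the restriction of `E`. If `ker (E → i_* W) → ker (E' → i_* W')` is an epimorphism with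
kernel `N` and `Ext²(E, N) = 0`, then every first-order deformation of the restriction of `(E, α)`
lifts to a first-order deformation of `(E, α)`.

A first-order deformation of `(E', α')` is an extension `F'` of `E'` by itself together with a morphism
`φ' : F' → i_* W'` which restricts to `E' → i_* W'` on the subobject, the coefficient of `ε` in the
framing. These data lift by `exists_glued_extension`. -/
theorem exists_deformation_of_pull (hκ : IsHomeomorph κ.x.hom.base) (hW : IsLocallyFree D.W)
    (hW' : IsLocallyFree D'.W) [Epi (B.pull κ).restrMap]
    (μ : kernel B.restrMap ⟶ (pushforward κ.x).obj (kernel (B.pull κ).restrMap)) [Epi μ]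
    (hμ : μ ≫ (pushforward κ.x).map (kernel.ι (B.pull κ).restrMap) =
      kernel.ι B.restrMap ≫ B.pullUnit κ)
    (hExt : Subsingleton (Abelian.Ext B.E (kernel μ) 2))
    (η : Deformation (DualNumber ℂ) (B.pull κ)) :
    ∃ ζ : Deformation (DualNumber ℂ) B, (ζ.pull κ).Isomorphic η := by
  -- the extension `η.fam.E` and the coefficient `φ'` of `ε` of its framing
  let m' : η.fam.E ⟶ (pushforward (closedFibre (DualNumber ℂ) D'.X)).obj (B.pull κ).E :=
    (ModSpace.ofPullback (closedFibre (DualNumber ℂ) D'.X) η.ψ.hom).map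
  obtain ⟨ι', h'⟩ := exists_isDualExt m' (ModSpace.isCartesian_ofPullback _ _) η.fam.locallyFree
  obtain ⟨ιW', rW', hιW', hjι', hεr', hdec'⟩ := exists_frame_splitting D' hW'
  obtain ⟨ιW, rW, hιW, hjι, hεr, hdec⟩ := exists_frame_splitting D hW
  let b' := directMap D'.i η.fam.restrMap
  have hb' : b' ≫ (pushforward D'.i).map (frameFst D') = fibreMap m' ≫ (B.pull κ).restrMap := by
    refine hom_ext_app fun V z => ?_
    have h := ModSpace.pb_eq_of_eq η.comm V z
    exact (h.trans (res_self _ _ _)).symm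
  have hbε' : epsMul η.fam.E ≫ b' = b' ≫ (pushforward D'.i).map (epsMul _) :=
    epsMul_directMap D'.i η.fam.restrMap
  let φ' := b' ≫ (pushforward D'.i).map rW'
  have hφ' : ι' ≫ φ' = (B.pull κ).restrMap := by
    have := h'.epi
    rw [← cancel_epi (fibreMap m'), ← Category.assoc, h'.eps, ← Category.assoc, hbε', Category.assoc,
      ← Functor.map_comp, hεr', hb']
  -- the lifted extension `F`, with the lift `φ` of `φ'`
  obtain ⟨P, ι, p, w₁, φ, c, hS, hιφ, hιc, hcp, hcφ⟩ := exists_glued_extension (pushforward κ.x)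
    (fun S hS => shortExact_pushforward_map κ.x hκ hS) h'.shortExact hφ' B.restrMap
    (B.pullUnit κ) μ hμ hExt
  have hcφ' := hcφ _ _ _ (pullUnit_restrMap κ B)
  obtain ⟨F, a, h⟩ := exists_isDualExt_of_shortExact w₁ hS
  -- its framing, with constant term `E → i_* W` and with the coefficient `φ` of `ε`
  let b : direct F ⟶ (pushforward D.i).obj (direct (D.thicken (DualNumber ℂ)).W) :=
    a.hom ≫ (p ≫ B.restrMap ≫ (pushforward D.i).map (frameInl D) +
      φ ≫ (pushforward D.i).map ιW)
  have hJI : (pushforward D.i).map (frameInl D) ≫ (pushforward D.i).map (epsMul _) =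
      (pushforward D.i).map ιW := by rw [← Functor.map_comp, hjι]
  have hI0 : (pushforward D.i).map ιW ≫ (pushforward D.i).map (epsMul _) = 0 := by
    rw [← Functor.map_comp, ← hιW.eps, ← Category.assoc, hιW.comp_eq_zero, zero_comp,
      Functor.map_zero]
  have hbε : epsMul F ≫ b = b ≫ (pushforward D.i).map (epsMul _) := by
    rw [← h.eps]
    simp only [b, Category.assoc, Iso.inv_hom_id_assoc, Preadditive.comp_add, Preadditive.add_comp,
      hJI, hI0, comp_zero, add_zero]
    rw [← Category.assoc ι p, w₁, zero_comp, comp_zero, comp_zero, zero_add, ← Category.assoc ι φ,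
      hιφ]
  have hbp : b ≫ (pushforward D.i).map (frameFst D) = (a.hom ≫ p) ≫ B.restrMap := by
    simp only [b, Category.assoc, Preadditive.add_comp, ← Functor.map_comp, hιW.comp_eq_zero,
      frameInl_frameFst, CategoryTheory.Functor.map_id, Functor.map_zero, comp_zero, add_zero,
      Category.comp_id]
  let β := ofDirectMap D.i b hbε
  have hβ : ModSpace.Hom.IsCartesian β := isCartesian_ofDirectMap D.i b hbε h B.locallyFree hιW
    B.restrMap B.isCartesian_restr hbp
  let ζ := deformationOfDualExt B h b hbε hbp hβ
  -- the morphism `c : P → x_* F'` identifies the restriction of `ζ` with `η`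
  have hcε : epsMul F ≫ a.hom ≫ c = (a.hom ≫ c) ≫ (pushforward κ.x).map (epsMul η.fam.E) := by
    rw [← h.eps, ← h'.eps, Functor.map_comp]
    simp only [Category.assoc, Iso.inv_hom_id_assoc]
    rw [hιc, ← Category.assoc c, hcp, Category.assoc]
  have hcp' : (a.hom ≫ c) ≫ (pushforward κ.x).map (fibreMap m') =
      (a.hom ≫ p) ≫ B.pullUnit κ := by
    rw [Category.assoc, hcp, Category.assoc]
  have hγ := isCartesian_ofDirectMap κ.x (a.hom ≫ c) hcε h B.locallyFree h' (B.pullUnit κ)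
    (ModSpace.isCartesian_pull κ.x B.E) hcp'
  have key₁ : η.fam.restr ≫ ofDirectMap κ.x (a.hom ≫ c) hcε = (κ.thicken (DualNumber ℂ)).w ≫ β := by
    have hdecb : b' = (fibreMap m' ≫ (B.pull κ).restrMap) ≫ (pushforward D'.i).map (frameInl D') +
        φ' ≫ (pushforward D'.i).map ιW' := by
      rw [← hb', Category.assoc, Category.assoc, ← Functor.map_comp,
        ← Functor.map_comp, ← Preadditive.comp_add, ← Functor.map_add, hdec',
        CategoryTheory.Functor.map_id, Category.comp_id]
    have hη : η.fam.restr = ofDirectMap D'.i b' hbε' := rfl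
    rw [hη]
    refine ofDirectMap_comp κ (a.hom ≫ c) hcε b' hbε' b hbε hjι' hjι hdecb (u := (a.hom ≫ p) ≫ B.restrMap)
      (v := a.hom ≫ φ) ?_ ?_ ?_
    · simp only [b, Preadditive.comp_add, Category.assoc]
    · rw [Category.assoc (a.hom ≫ p), ← pullUnit_restrMap κ B, ← Category.assoc (a.hom ≫ p), ← hcp',
        Functor.map_comp]
      simp only [Category.assoc]
    · simp only [Category.assoc, hcφ']
  have key₂ : ModSpace.ofPullback (closedFibre (DualNumber ℂ) D'.X) η.ψ.hom ≫
      ofDirectMap κ.x (a.hom ≫ c) hcε = ModSpace.pull κ.x B.E ≫ h.hom := by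
    refine ModSpace.hom_ext_pb (closedFibre_thickenMap (DualNumber ℂ) κ.x) fun (V : Opens D.X.carrier)
      (z : Sec (direct F) V) => ?_
    exact (congrArg (fun g => app g V z) hcp').trans
      (res_self ((pushforward κ.x).obj (B.pull κ).E) le_rfl _).symm
  exact ⟨ζ, pull_isomorphic_of_isCartesian κ B ζ η rfl hγ
    (key₁.trans (congrArg (fun z => (κ.thicken (DualNumber ℂ)).w ≫ z)
      (ModSpace.ofPullback_iso hβ).symm))
    (key₂.trans (congrArg (fun z => ModSpace.pull κ.x B.E ≫ z)
      (ModSpace.ofPullback_iso (h.isCartesian_hom B.locallyFree)).symm))⟩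

end Assembly

/-! ### Kernels and local lifts of functions -/

section Kernels

variable {X : CSpace}

theorem exists_app_kernel_ι {E F : Mod X} (f : E ⟶ F) {U : Opens X.carrier} (x : Sec E U)
    (hx : app f U x = 0) : ∃ z, app (kernel.ι f) U z = x :=
  exists_app_eq_of_exact (S := ShortComplex.mk (kernel.ι f) f (kernel.condition f))
    (ShortComplex.exact_kernel f) x hx

theorem app_kernel_condition {E F : Mod X} (f : E ⟶ F) {U : Opens X.carrier}
    (z : Sec (kernel f) U) : app f U (app (kernel.ι f) U z) = 0 :=
  congrArg (fun g => app g U z) (kernel.condition f)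

/-- A morphism which vanishes on the sections annihilated by an epimorphism factors through it. -/
theorem exists_desc_of_epi {E F G : Mod X} (f : E ⟶ F) [Epi f] (g : E ⟶ G)
    (H : ∀ (U : Opens X.carrier) (x : Sec E U), app f U x = 0 → app g U x = 0) :
    ∃ l : F ⟶ G, f ≫ l = g := by
  have hS : (ShortComplex.mk _ _ (kernel.condition f)).ShortExact :=
    ⟨ShortComplex.exact_kernel f⟩
  have h0 : kernel.ι f ≫ g = 0 := hom_ext_app fun U z => H U _ (app_kernel_condition f z)
  exact ⟨hS.exact.desc g h0, hS.exact.g_desc g h0⟩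

/-- Two monomorphisms with the same image have isomorphic sources. -/
theorem nonempty_iso_of_mono {A B G : Mod X} (a : A ⟶ G) (b : B ⟶ G) [Mono a] [Mono b]
    (hab : ∀ (U : Opens X.carrier) (x : Sec A U), ∃ y, app b U y = app a U x)
    (hba : ∀ (U : Opens X.carrier) (y : Sec B U), ∃ x, app a U x = app b U y) :
    Nonempty (A ≅ B) := by
  obtain ⟨l, hl⟩ := exists_lift_of_mono b a hab
  obtain ⟨m, hm⟩ := exists_lift_of_mono a b hba
  exact ⟨⟨l, m, by rw [← cancel_mono a, Category.assoc, hm, hl, Category.id_comp],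
    by rw [← cancel_mono b, Category.assoc, hl, hm, Category.id_comp]⟩⟩

end Kernels

/-- Functions on `X` can be lifted locally along `f : X → Y` to functions on `Y`: the map
`𝒪_Y → f_* 𝒪_X` is an epimorphism of sheaves. -/
def HasLocalLifts {X Y : CSpace} (f : X ⟶ Y) : Prop :=
  ∀ (U : Opens Y.carrier) (s : Fn X ((Opens.map f.hom.base).obj U)), ∀ x ∈ U,
    ∃ (V : Opens Y.carrier) (h : V ≤ U), x ∈ V ∧ ∃ r : Fn Y V,
      pullFn f V r = resFn ((Opens.map f.hom.base).map (homOfLE h)).le s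

theorem IsClosedImmersion.hasLocalLifts {X Y : CSpace} {f : X ⟶ Y} (hf : IsClosedImmersion f) :
    HasLocalLifts f :=
  hf.2

/-- Finitely many functions can be lifted on a common neighbourhood. -/
theorem HasLocalLifts.exists_family {X Y : CSpace} {f : X ⟶ Y} (hf : HasLocalLifts f)
    {ι : Type*} [Finite ι] (U : Opens Y.carrier) (s : ι → Fn X ((Opens.map f.hom.base).obj U))
    {x : Y.carrier} (hx : x ∈ U) : ∃ (V : Opens Y.carrier) (h : V ≤ U), x ∈ V ∧ ∃ r : ι → Fn Y V,
      ∀ i, pullFn f V (r i) = resFn ((Opens.map f.hom.base).map (homOfLE h)).le (s i) := by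
  choose V hV hxV r hr using fun i => hf U (s i) x hx
  obtain ⟨W, hWU, hxW, hW⟩ := exists_le_of_finite hx V hxV
  refine ⟨W, hWU, hxW, fun i => resFn (hW i) (r i), fun i => ?_⟩
  rw [pullFn_resFn, hr, resFn_resFn]

/-- The property `HasLocalLifts` is preserved by products with `Spec A`. -/
theorem HasLocalLifts.thickenMap {A : Type} [CommRing A] [Algebra ℂ A] [Module.Finite ℂ A]
    {X Y : CSpace} {f : X ⟶ Y} (hf : HasLocalLifts f) :
    HasLocalLifts (thickenMap (AlgHom.id ℂ A) f) := by
  intro (U : Opens Y.carrier) (s : Fn (thicken A X) ((Opens.map f.hom.base).obj U)) x hx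
  let b := Module.finBasis ℂ A
  obtain ⟨V, hV, hxV, r, hr⟩ := hf.exists_family U
    (fun j => coordFn (b.coord j) ((Opens.map f.hom.base).obj U) s) hx
  refine ⟨V, hV, hxV, ∑ j, scalFn Y V (b j) * incFn A V (r j), ?_⟩
  have h1 : pullFn (FramedDef.thickenMap (AlgHom.id ℂ A) f) V
      (∑ j, scalFn Y V (b j) * incFn A V (r j)) =
      (∑ j, scalFn X ((Opens.map f.hom.base).obj V) (b j) *
        incFn A ((Opens.map f.hom.base).obj V) (pullFn f V (r j)) :
          Fn (thicken A X) ((Opens.map f.hom.base).obj V)) := by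
    rw [map_sum]
    refine Finset.sum_congr rfl fun j _ => ?_
    rw [map_mul, pullFn_scalFn, pullFn_incFn]
    rfl
  refine h1.trans ?_
  refine Eq.trans ?_ (congrArg (resFn (X := thicken A X) ((Opens.map f.hom.base).map (homOfLE hV)).le)
    (sum_scalFn_mul_coordFn b ((Opens.map f.hom.base).obj U) s))
  rw [map_sum]
  refine Finset.sum_congr rfl fun j _ => ?_
  rw [map_mul, resFn_scalFn, resFn_incFn, hr]

namespace ModSpace

variable {P Q : ModSpace}

theorem pb_sum_smul_res (f : P ⟶ Q) {U V : Opens Q.space.carrier} (h : V ≤ U) {n : ℕ}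
    (c : Fin n → Fn Q.space V) (e : Fin n → Sec Q.mod U) :
    pb f V (∑ i, c i • res Q.mod h (e i)) = ∑ i, pullFn f.base V (c i) •
      res P.mod ((Opens.map f.base.hom.base).map (homOfLE h)).le (pb f U (e i)) := by
  rw [pb_sum_smul]
  simp only [pb_res]

/-- Along a cartesian morphism, a section with coordinates `cᵢ` in a local basis pulls back to zero
if and only if the `cᵢ` do. -/
theorem pb_sum_eq_zero_iff {f : P ⟶ Q} (hf : Hom.IsCartesian f) {U V : Opens Q.space.carrier}
    (h : V ≤ U) {n : ℕ} {e : Fin n → Sec Q.mod U} (he : IsLocalBasis Q.mod U e)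
    (c : Fin n → Fn Q.space V) :
    pb f V (∑ i, c i • res Q.mod h (e i)) = 0 ↔ ∀ i, pullFn f.base V (c i) = 0 := by
  rw [pb_sum_smul_res]
  constructor
  · intro h0 i
    refine congrFun ((IsCartesian.isLocalBasis hf he _ ((Opens.map f.base.hom.base).map (homOfLE h)).le).1
      (a₁ := fun i => pullFn f.base V (c i)) (a₂ := 0) ?_) i
    refine h0.trans ?_
    simp
  · intro h0
    simp only [h0, zero_smul, Finset.sum_const_zero]

/-- The restriction map `F → f_* E` is an epimorphism if `𝒪_Y → f_* 𝒪_X` is, by lifting coordinates in a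
local basis. -/
theorem epi_map_of_isCartesian {f : P ⟶ Q} (hf : Hom.IsCartesian f) (hQ : IsLocallyFree Q.mod)
    (hl : HasLocalLifts f.base) : Epi f.map := by
  refine epi_of_local_lift _ fun U (y : Sec P.mod ((Opens.map f.base.hom.base).obj U)) x hx => ?_
  obtain ⟨U₁, hxU₁, n, e, he⟩ := hQ x
  have hV : (Opens.map f.base.hom.base).obj (U ⊓ U₁) ≤ (Opens.map f.base.hom.base).obj U₁ :=
    ((Opens.map f.base.hom.base).map (homOfLE inf_le_right)).le
  obtain ⟨c, hc⟩ := (IsCartesian.isLocalBasis hf he _ hV).2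
    (res P.mod ((Opens.map f.base.hom.base).map (homOfLE inf_le_left)).le y)
  obtain ⟨W, hW, hxW, r, hr⟩ := hl.exists_family (U ⊓ U₁) c (x := x) ⟨hx, hxU₁⟩
  refine ⟨W, hW.trans inf_le_left, hxW, ∑ i, r i • res Q.mod (hW.trans inf_le_right) (e i), ?_⟩
  refine (pb_sum_smul_res f (hW.trans inf_le_right) r e).trans ?_
  have h2 := congrArg (res P.mod ((Opens.map f.base.hom.base).map (homOfLE hW)).le) hc
  rw [res_res, res_sum] at h2
  refine Eq.trans (Finset.sum_congr rfl fun i _ => ?_) h2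
  rw [res_smul, res_res, hr]

end ModSpace

/-! ### Restriction of the kernel of the framing -/

section KernelMap

/-- The map `ker (E → i_* W) → x_* ker (E' → i'_* W')` induced by the restriction `E → x_* E'` of a
framed vector bundle. -/
theorem exists_kernelMap {D' D : FramingData} (κ : FramingData.Hom D' D) (B : FramedBundle D) :
    ∃ μ : kernel B.restrMap ⟶ (pushforward κ.x).obj (kernel (B.pull κ).restrMap),
      μ ≫ (pushforward κ.x).map (kernel.ι (B.pull κ).restrMap) =
        kernel.ι B.restrMap ≫ B.pullUnit κ := by
  have h0 : (kernel.ι B.restrMap ≫ B.pullUnit κ) ≫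
      (pushforward κ.x).map (B.pull κ).restrMap = 0 := by
    rw [← cancel_mono (eqToHom (pushforward_obj_comm κ)), Category.assoc, Category.assoc,
      pullUnit_restrMap, ← Category.assoc, kernel.condition, zero_comp, zero_comp]
  refine exists_lift_of_mono _ _ fun U z => ?_
  exact exists_app_kernel_ι (B.pull κ).restrMap
    (app (kernel.ι B.restrMap ≫ B.pullUnit κ) U z : Sec (B.pull κ).E ((Opens.map κ.x.hom.base).obj U))
    (congrArg (fun g => app g U z) h0)

variable {R R' : Type} [CommRing R] [Algebra ℂ R] [Module.Finite ℂ R] [CommRing R'] [Algebra ℂ R']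
  [Module.Finite ℂ R'] {D : FramingData} (π : R →ₐ[ℂ] R') (B : FramedBundle (D.thicken R))

set_option maxHeartbeats 1000000 in
/-- For a surjection `R → R'`, the sections of the bundle over `Spec R'` which vanish on
`Spec R' × Y` lift locally to sections over `Spec R` which vanish on `Spec R × Y`: apply a `ℂ`-linear
section of `R → R'` to the coordinates in a local basis. No lift of functions from `Y` to `X` is
involved. -/
theorem epi_kernelMap (hπ : Function.Surjective π)
    (μ : kernel B.restrMap ⟶ (pushforward (D.baseChange π).x).obj
      (kernel (B.pull (D.baseChange π)).restrMap))
    (hμ : μ ≫ (pushforward (D.baseChange π).x).map (kernel.ι (B.pull (D.baseChange π)).restrMap) =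
      kernel.ι B.restrMap ≫ B.pullUnit (D.baseChange π)) : Epi μ := by
  obtain ⟨σ, hσ⟩ := π.toLinearMap.exists_rightInverse_of_surjective (LinearMap.range_eq_top.2 hπ)
  have hσ' : ∀ r', π (σ r') = r' := fun r' => LinearMap.congr_fun hσ r'
  let κ := D.baseChange π
  let B' := B.pull κ
  refine epi_of_local_lift μ fun (U : Opens D.X.carrier) (y : Sec (kernel B'.restrMap) U) x hx => ?_
  obtain ⟨U₁, hxU₁, n, e, he⟩ := B.locallyFree x
  let V : Opens D.X.carrier := U ⊓ U₁
  have hV : V ≤ U₁ := inf_le_right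
  have hVU : V ≤ U := inf_le_left
  have he' : IsLocalBasis B'.E U₁ fun i => ModSpace.pb (ModSpace.pull κ.x B.E) U₁ (e i) :=
    ModSpace.IsCartesian.isLocalBasis (ModSpace.isCartesian_pull κ.x B.E) he
  obtain ⟨c, hc⟩ := (he' V hV).2 (res B'.E hVU (app (kernel.ι B'.restrMap) U y))
  -- the coordinates of `y` vanish on `Spec R' × Y`
  have hc0 := (ModSpace.pb_sum_eq_zero_iff (f := B'.restr) B'.isCartesian_restr hV he' c).1 (by
    refine (congrArg (ModSpace.pb B'.restr V) hc).trans ?_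
    refine (app_res B'.restrMap hVU _).trans ?_
    exact (congrArg (res ((pushforward (D.thicken R').i).obj (D.thicken R').W) hVU)
      (app_kernel_condition B'.restrMap y)).trans (res_zero (X := thicken R' D.X)
        ((pushforward (D.thicken R').i).obj (D.thicken R').W) hVU))
  -- so do their lifts under a linear section of `π`
  let d : Fin n → Fn (thicken R D.X) V := fun i => mapFn σ V (c i)
  have hd0 : ∀ i, pullFn (D.thicken R).i V (d i) = 0 := by
    intro i
    refine (mapFn_pullFn σ D.i V (c i)).symm.trans ?_
    refine (congrArg (mapFn σ ((Opens.map D.i.hom.base).obj V)) (hc0 i)).trans (map_zero _)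
  have hd : ∀ i, pullFn κ.x V (d i) = c i := fun i => pullFn_mapFn_section π σ hσ' V (c i)
  obtain ⟨z, hz⟩ := exists_app_kernel_ι B.restrMap (∑ i, d i • res B.E hV (e i))
    ((ModSpace.pb_sum_eq_zero_iff (f := B.restr) B.isCartesian_restr hV he d).2 hd0)
  refine ⟨V, hVU, ⟨hx, hxU₁⟩, z, ?_⟩
  refine injective_app_of_mono (kernel.ι B'.restrMap) V ?_
  refine (congrArg (fun g : kernel B.restrMap ⟶ (pushforward κ.x).obj B'.E => app g V z) hμ).trans ?_
  refine (congrArg (app (B.pullUnit κ) V) hz).trans ?_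
  refine (ModSpace.pb_sum_smul_res (ModSpace.pull κ.x B.E) hV d e).trans ?_
  refine Eq.trans ?_ (hc.trans (app_res (kernel.ι B'.restrMap) hVU y).symm)
  exact Finset.sum_congr rfl fun i _ => congrArg (fun a : Fn (thicken R' D.X) V =>
    a • res B'.E hV (ModSpace.pb (ModSpace.pull κ.x B.E) U₁ (e i))) (hd i)

end KernelMap

/-! ### Multiplication by the generator of a small extension -/

section SmallExtensionFunctions

variable {R : Type} [CommRing R] [Algebra ℂ R] [Module.Finite ℂ R] {X Y : CSpace}

/-- An element annihilated by the maximal ideal multiplies functions through their restrictions to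
the closed fibre. -/
theorem scalFn_mul_incFn_pullFn [IsLocalRing R] {t : R} (h : ∀ a, a * t = residueHom R a • t)
    (V : Opens X.carrier) (c : Fn (thicken R X) V) :
    scalFn X V t * incFn R V (pullFn (closedFibre R X) V c) = scalFn X V t * c := by
  rw [pullFn_closedFibre]
  induction c using fn_induction with
  | tmul a o =>
    rw [coordFn_mul, map_mul, ← mul_assoc, ← mul_assoc, ← map_mul, mul_comm t a, h, scalFn_smul]
    exact congrArg (fun z : Fn (thicken R X) V => z * incFn R V o)
      (fn_mul_comm (X := thicken R X) _ _)
  | add c d hc hd => rw [map_add, map_add, mul_add, mul_add, hc, hd]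

/-- For `t ≠ 0` the map `𝒪_X → R ⊗ 𝒪_X`, `o ↦ t ⊗ o`, is injective. -/
theorem eq_zero_of_scalFn_mul_incFn {t : R} (ht : t ≠ 0) (V : Opens X.carrier) (o : Fn X V)
    (h : scalFn X V t * incFn R V o = 0) : o = 0 := by
  let b := Module.finBasis ℂ R
  obtain ⟨j, hj⟩ : ∃ j, b.coord j t ≠ 0 := by
    by_contra! h0
    exact ht (b.forall_coord_eq_zero_iff.1 h0)
  have h1 := congrArg (coordFn (b.coord j) V) h
  rw [coordFn_mul, map_zero] at h1
  have h2 := congrArg (fun z => constFn X V (b.coord j t)⁻¹ * z) h1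
  simp only [mul_zero] at h2
  rwa [← mul_assoc, ← map_mul, inv_mul_cancel₀ hj, map_one, one_mul] at h2

theorem pullFn_closedFibre_incFn [IsLocalRing R] (V : Opens X.carrier) (o : Fn X V) :
    pullFn (closedFibre R X) V (incFn R V o) = o := by
  refine (pullFn_closedFibre V (incFn R V o)).trans ?_
  rw [coordFn_incFn]
  change constFn X V (residueHom R 1) * o = o
  rw [map_one, map_one, one_mul]

theorem hasLocalLifts_closedFibre [IsLocalRing R] : HasLocalLifts (closedFibre R X) := by
  intro (U : Opens X.carrier) (s : Fn X U) x hx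
  refine ⟨U, le_rfl, hx, incFn R U s, ?_⟩
  exact (pullFn_closedFibre_incFn U s).trans (resFn_self (X := X) le_rfl s).symm

/-- Multiplication by an element of `R`. -/
def scalMul (t : R) (E : Mod (thicken R X)) : E ⟶ E :=
  homOfApp
    (fun (V : Opens X.carrier) =>
      { toFun := fun x => scalFn X V t • x
        map_add' := fun x y => smul_add _ _ _
        map_smul' := fun r x => by
          refine (smul_smul (scalFn X V t) r x).trans (Eq.trans ?_ (smul_smul r (scalFn X V t) x).symm)
          exact congrArg (fun a : Fn (thicken R X) V => a • x) (fn_mul_comm (X := thicken R X) _ _) })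
    (fun {U V} h x => by
      refine Eq.trans ?_ (res_smul E h (scalFn X U t) x).symm
      exact congrArg (fun a : Fn (thicken R X) V => a • res E h x) (resFn_scalFn (X := X) h t).symm)

end SmallExtensionFunctions

section ScalarMultiplication

variable {R : Type} [CommRing R] [Algebra ℂ R] [Module.Finite ℂ R] [IsLocalRing R] {D : FramingData}
  {B₀ : FramedBundle D} (ξ : Deformation R B₀)

/-- The morphism `(X, E₀) → (Spec R × X, E)` given by a deformation `E` of `E₀`. -/
def Deformation.fibre : (⟨D.X, B₀.E⟩ : ModSpace) ⟶ ⟨thicken R D.X, ξ.fam.E⟩ :=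
  ModSpace.ofPullback (closedFibre R D.X) ξ.ψ.hom

theorem Deformation.isCartesian_fibre : ModSpace.Hom.IsCartesian ξ.fibre :=
  ModSpace.isCartesian_ofPullback _ _

instance : Epi ξ.fibre.map :=
  ModSpace.epi_map_of_isCartesian ξ.isCartesian_fibre ξ.fam.locallyFree hasLocalLifts_closedFibre

theorem Deformation.pb_fibre_sum {U V : Opens D.X.carrier} (h : V ≤ U) {n : ℕ}
    (e : Fin n → Sec ξ.fam.E U) (o : Fin n → Fn D.X V) :
    ModSpace.pb ξ.fibre V (∑ i, (incFn R V (o i) : Fn (thicken R D.X) V) • res ξ.fam.E h (e i)) =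
      ∑ i, o i • res B₀.E h (ModSpace.pb ξ.fibre U (e i)) := by
  refine (ModSpace.pb_sum_smul_res ξ.fibre h (fun i => incFn R V (o i)) e).trans ?_
  refine Finset.sum_congr rfl fun i _ => ?_
  exact congrArg (fun a : Fn D.X V => a • res B₀.E h (ModSpace.pb ξ.fibre U (e i)))
    (pullFn_closedFibre_incFn V (o i))

/-- If `t` is annihilated by the maximal ideal, multiplication by `t` on `E` factors through the
restriction `E₀` of `E` to the closed fibre. On `∑ oᵢ eᵢ`, for the basis of `E₀` obtained from a local
basis of `E`, the induced map has the value `∑ t oᵢ eᵢ`. -/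
theorem Deformation.exists_scalHom {t : R} (ht : ∀ a, a * t = residueHom R a • t) :
    ∃ T : (pushforward (closedFibre R D.X)).obj B₀.E ⟶ ξ.fam.E,
      ∀ {U V : Opens D.X.carrier} (h : V ≤ U) {n : ℕ} (e : Fin n → Sec ξ.fam.E U)
        (o : Fin n → Fn D.X V),
        app T V (∑ i, o i • res B₀.E h (ModSpace.pb ξ.fibre U (e i)) : Sec B₀.E V) =
          ∑ i, (scalFn D.X V t * incFn R V (o i) : Fn (thicken R D.X) V) • res ξ.fam.E h (e i) := by
  -- a section with zero restriction to the closed fibre has coordinates with zero restriction, which are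
  -- annihilated by `t`
  obtain ⟨T, hT⟩ := exists_desc_of_epi ξ.fibre.map (scalMul t ξ.fam.E) (by
    intro (U : Opens D.X.carrier) z hz
    refine sec_ext fun x hx => ?_
    obtain ⟨U₁, hxU₁, n, e, he⟩ := ξ.fam.locallyFree x
    let V : Opens D.X.carrier := U ⊓ U₁
    have hV : V ≤ U₁ := inf_le_right
    have hVU : V ≤ U := inf_le_left
    refine ⟨V, hVU, ⟨hx, hxU₁⟩, ?_⟩
    obtain ⟨c, hc⟩ := (he V hV).2 (res ξ.fam.E hVU z)
    have hc0 := (ModSpace.pb_sum_eq_zero_iff ξ.isCartesian_fibre hV he c).1 (by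
      refine (congrArg (ModSpace.pb ξ.fibre V) hc).trans ?_
      refine (app_res ξ.fibre.map hVU z).trans ?_
      exact (congrArg (res ((pushforward (closedFibre R D.X)).obj B₀.E) hVU) hz).trans
        (res_zero _ hVU))
    refine (app_res (scalMul t ξ.fam.E) hVU z).symm.trans ?_
    refine Eq.trans ?_ (res_zero ξ.fam.E hVU).symm
    refine (congrArg (app (scalMul t ξ.fam.E) V) hc).symm.trans ?_
    refine (app_sum_smul (scalMul t ξ.fam.E) c _).trans ?_
    refine Finset.sum_eq_zero fun i _ => ?_
    refine (smul_smul (c i) (scalFn D.X V t) (res ξ.fam.E hV (e i))).trans ?_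
    have h0 : c i * (scalFn D.X V t : Fn (thicken R D.X) V) = 0 := by
      refine (fn_mul_comm (X := thicken R D.X) _ _).trans ?_
      refine (scalFn_mul_incFn_pullFn ht V (c i)).symm.trans ?_
      refine (congrArg (fun a : Fn D.X V => scalFn D.X V t * incFn R V a) (hc0 i)).trans ?_
      exact (congrArg (fun a : Fn (thicken R D.X) V => scalFn D.X V t * a)
        (map_zero (incFn R V))).trans (mul_zero _)
    exact (congrArg (fun a : Fn (thicken R D.X) V => a • res ξ.fam.E hV (e i)) h0).trans
      (zero_smul _ _))
  refine ⟨T, fun {U V} h n e o => ?_⟩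
  rw [← ξ.pb_fibre_sum h e o]
  refine (congrArg (fun g : ξ.fam.E ⟶ ξ.fam.E => app g V (∑ i,
    (incFn R V (o i) : Fn (thicken R D.X) V) • res ξ.fam.E h (e i))) hT).trans ?_
  refine (app_sum_smul (scalMul t ξ.fam.E) (fun i => incFn R V (o i)) _).trans ?_
  refine Finset.sum_congr rfl fun i _ => ?_
  refine (smul_smul (incFn R V (o i) : Fn (thicken R D.X) V) (scalFn D.X V t)
    (res ξ.fam.E h (e i))).trans ?_
  exact congrArg (fun a : Fn (thicken R D.X) V => a • res ξ.fam.E h (e i))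
    (fn_mul_comm (X := thicken R D.X) _ _)

end ScalarMultiplication

/-! ### The kernel of the restriction -/

theorem app_kernel_ι_comp {X : CSpace} {E F M N : Mod X} {w : E ⟶ F} {μ : kernel w ⟶ M}
    {b : M ⟶ N} {u : E ⟶ N} (h : μ ≫ b = kernel.ι w ≫ u) (V : Opens X.carrier)
    (y : Sec (kernel μ) V) : app u V (app (kernel.ι μ ≫ kernel.ι w) V y) = 0 := by
  have h1 : app b V (app μ V (app (kernel.ι μ) V y)) =
      app u V (app (kernel.ι w) V (app (kernel.ι μ) V y)) := congrArg (fun g => app g V _) h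
  have h2 : app b V (app μ V (app (kernel.ι μ) V y)) = 0 :=
    (congrArg (app b V) (app_kernel_condition μ y)).trans (map_zero _)
  have h3 := app_comp (kernel.ι μ) (kernel.ι w) V y
  exact (congrArg (app u V) h3).trans (h1.symm.trans h2)

/-- For a map `μ` from the kernel of `w` induced by `u`, the kernel of `μ` consists of the sections
annihilated by `w` and `u`. -/
theorem exists_app_kernel_comp_iff {X : CSpace} {E F M N : Mod X} {w : E ⟶ F} {μ : kernel w ⟶ M}
    {b : M ⟶ N} [Mono b] {u : E ⟶ N} (h : μ ≫ b = kernel.ι w ≫ u) (V : Opens X.carrier)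
    (z : Sec E V) :
    (∃ y, app (kernel.ι μ ≫ kernel.ι w) V y = z) ↔ app w V z = 0 ∧ app u V z = 0 := by
  have h' : ∀ s, app b V (app μ V s) = app u V (app (kernel.ι w) V s) := fun s =>
    congrArg (fun g => app g V s) h
  constructor
  · rintro ⟨y, rfl⟩
    have h1 := app_comp (kernel.ι μ) (kernel.ι w) V y
    exact ⟨(congrArg (app w V) h1).trans (app_kernel_condition w (app (kernel.ι μ) V y)),
      app_kernel_ι_comp h V y⟩
  · rintro ⟨h1, h2⟩
    have h3 := exists_app_kernel_ι w z h1
    obtain ⟨s, hs⟩ := h3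
    have h4 : app b V (app μ V s) = 0 := (h' s).trans ((congrArg (app u V) hs).trans h2)
    have h5 : app μ V s = 0 := injective_app_of_mono b V (h4.trans (map_zero (app b V)).symm)
    have h6 := exists_app_kernel_ι μ s h5
    obtain ⟨y, hy⟩ := h6
    have h7 := app_comp (kernel.ι μ) (kernel.ι w) V y
    exact ⟨y, h7.trans ((congrArg (app (kernel.ι w) V) hy).trans hs)⟩

section KernelOfKernelMap

variable {R R' : Type} [CommRing R] [Algebra ℂ R] [Module.Finite ℂ R] [CommRing R']
  [Algebra ℂ R'] [Module.Finite ℂ R'] {D : FramingData} (π : R →ₐ[ℂ] R')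

/-- A function on `Spec R × X` which vanishes on `Spec R' × X` is of the form `t ⊗ o`. -/
theorem exists_eq_scalFn_mul {t : R} {σ : R' →ₗ[ℂ] R} {μ : R →ₗ[ℂ] ℂ}
    (h : ∀ r, σ (π r) + μ r • t = r) {X : CSpace} (V : Opens X.carrier) {c : Fn (thicken R X) V}
    (hc : (pullFn (thickenMap π (𝟙 X)) V c : Fn (thicken R' X) V) = 0) :
    scalFn X V t * incFn R V (coordFn μ V c) = c := by
  refine Eq.trans ?_ (mapFn_add_scalFn_mul π t σ μ h V c)
  have h1 : mapFn σ V (pullFn (thickenMap π (𝟙 X)) V c : Fn (thicken R' X) V) = 0 :=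
    (congrArg (mapFn σ V) hc).trans (map_zero _)
  exact (zero_add _).symm.trans (congrArg (fun a : Fn (thicken R X) V =>
    a + scalFn X V t * incFn R V (coordFn μ V c)) h1.symm)

theorem pullFn_scalFn_mul_eq_zero {t : R} (ht : π t = 0) {X : CSpace} (V : Opens X.carrier)
    (o : Fn X V) :
    (pullFn (thickenMap π (𝟙 X)) V (scalFn X V t * incFn R V o) : Fn (thicken R' X) V) = 0 := by
  refine (map_mul (pullFn (thickenMap π (𝟙 X)) V) _ _).trans ?_
  rw [pullFn_scalFn, ht, map_zero]
  exact zero_mul _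

theorem pullFn_scalFn_mul {X Y : CSpace} (i : Y ⟶ X) (t : R) (V : Opens X.carrier) (o : Fn X V) :
    pullFn (thickenMap (AlgHom.id ℂ R) i) V (scalFn X V t * incFn R V o) =
      scalFn Y ((Opens.map i.hom.base).obj V) t *
        incFn R ((Opens.map i.hom.base).obj V) (pullFn i V o) := by
  rw [map_mul, pullFn_scalFn, pullFn_incFn]
  rfl

/-- A section over `Spec R × X` which vanishes on `Spec R' × X` has coordinates of the form `t ⊗ oᵢ`. -/
theorem coordinates_eq_scalFn_mul (B : FramedBundle (D.thicken R)) {t : R} {σ : R' →ₗ[ℂ] R}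
    {ℓ : R →ₗ[ℂ] ℂ} (h : ∀ r, σ (π r) + ℓ r • t = r) {U V : Opens D.X.carrier} (hV : V ≤ U) {n : ℕ}
    {e : Fin n → Sec B.E U} (he : IsLocalBasis B.E U e) (z : Sec B.E V)
    (hz : app (B.pullUnit (D.baseChange π)) V z = 0) : ∃ o : Fin n → Fn D.X V,
      ∑ i, (scalFn D.X V t * incFn R V (o i) : Fn (thicken R D.X) V) • res B.E hV (e i) = z := by
  obtain ⟨c, hc⟩ := (he V hV).2 z
  have hc0 := (ModSpace.pb_sum_eq_zero_iff
    (ModSpace.isCartesian_pull (D.baseChange π).x B.E) hV he c).1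
      ((congrArg (app (B.pullUnit (D.baseChange π)) V) hc).trans hz)
  refine ⟨fun i => coordFn ℓ V (c i), Eq.trans ?_ hc⟩
  exact Finset.sum_congr rfl fun i _ => congrArg (fun a : Fn (thicken R D.X) V =>
    a • res B.E hV (e i)) (exists_eq_scalFn_mul π h V (hc0 i))

/-- If `t = 0`, a family is determined by its restriction modulo `t`. -/
theorem isZero_kernel_kernelMap (B : FramedBundle (D.thicken R))
    {K : Mod (thicken R D.X)} {k : K ⟶ B.E} [Mono k]
    (hk : ∀ V z, (∃ y, app k V y = z) ↔
      app B.restrMap V z = 0 ∧ app (B.pullUnit (D.baseChange π)) V z = 0)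
    {σ : R' →ₗ[ℂ] R} {ℓ : R →ₗ[ℂ] ℂ} (h : ∀ r, σ (π r) + ℓ r • (0 : R) = r) :
    IsZero K := by
  refine IsZero.of_mono_eq_zero k ?_
  refine hom_ext_app fun (U : Opens D.X.carrier) y => sec_ext fun x hx => ?_
  obtain ⟨U₁, hxU₁, n, e, he⟩ := B.locallyFree x
  let V : Opens D.X.carrier := U ⊓ U₁
  have hV : V ≤ U₁ := inf_le_right
  have hVU : V ≤ U := inf_le_left
  refine ⟨V, hVU, ⟨hx, hxU₁⟩, ?_⟩
  have hy := (app_res k hVU y)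
  obtain ⟨o, ho⟩ := coordinates_eq_scalFn_mul π B h hV he _
    ((hk V _).1 ⟨_, hy⟩).2
  refine ho.symm.trans (Eq.trans ?_ (res_zero B.E hVU).symm)
  refine Finset.sum_eq_zero fun i _ => ?_
  rw [map_zero, zero_mul, zero_smul]

variable [IsLocalRing R] {B₀ : FramedBundle D}

set_option maxHeartbeats 1000000 in
/-- Let `R → R'` be a small extension with kernel generated by `t ≠ 0`. The sheaf `K` of sections of `E`
which vanish on `Spec R × Y` and on `Spec R' × X` is isomorphic to the direct image, under the inclusion
of the closed fibre, of the sheaf of sections of `E₀` which vanish on `Y`. The isomorphism is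
multiplication by `t`. -/
theorem nonempty_kernel_kernelMap_iso (ξ : Deformation R B₀) {t : R}
    (h : ∀ a, a * t = residueHom R a • t) (ht : t ≠ 0) (hπt : π t = 0)
    {σ : R' →ₗ[ℂ] R} {ℓ : R →ₗ[ℂ] ℂ} (hσ : ∀ r, σ (π r) + ℓ r • t = r)
    {K : Mod (thicken R D.X)} {k : K ⟶ ξ.fam.E} [Mono k]
    (hk : ∀ V z, (∃ y, app k V y = z) ↔
      app ξ.fam.restrMap V z = 0 ∧ app (ξ.fam.pullUnit (D.baseChange π)) V z = 0) :
    Nonempty ((pushforward (closedFibre R D.X)).obj (kernel B₀.restrMap) ≅ K) := by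
  let B := ξ.fam
  obtain ⟨T, hT⟩ := ξ.exists_scalHom h
  -- coordinates of sections of `E₀` and their images under `T`
  have hloc : ∀ x : D.X.carrier, ∃ U : Opens D.X.carrier, x ∈ U ∧ ∃ (n : ℕ) (e : Fin n → Sec B.E U),
      IsLocalBasis B.E U e ∧ IsLocalBasis B₀.E U fun i => ModSpace.pb ξ.fibre U (e i) := by
    intro x
    obtain ⟨U, hxU, n, e, he⟩ := B.locallyFree x
    exact ⟨U, hxU, n, e, he, ModSpace.IsCartesian.isLocalBasis ξ.isCartesian_fibre he⟩
  have : Mono T := mono_of_injective_app T (injective_app_of_local T fun x => by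
    obtain ⟨U, hxU, n, e, he, he₀⟩ := hloc x
    refine ⟨U, hxU, fun (V : Opens D.X.carrier) (hV : V ≤ U) (y : Sec B₀.E V) hy => ?_⟩
    obtain ⟨o, ho⟩ := (he₀ V hV).2 y
    have h1 : ∑ i, (scalFn D.X V t * incFn R V (o i) : Fn (thicken R D.X) V) • res B.E hV (e i) = 0 :=
      (hT hV e o).symm.trans ((congrArg (app T V) ho).trans hy)
    have h2 : ∀ i, o i = 0 := fun i => eq_zero_of_scalFn_mul_incFn ht V (o i) (congrFun
      ((he V hV).1 (a₁ := fun i => scalFn D.X V t * incFn R V (o i)) (a₂ := 0) (by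
        refine h1.trans ?_
        simp)) i)
    refine ho.symm.trans ?_
    simp only [h2, zero_smul, Finset.sum_const_zero]
    rfl)
  -- `∑ t oᵢ eᵢ` lies in `K` if and only if `∑ oᵢ eᵢ` vanishes on `Y`
  have hker : ∀ (U V : Opens D.X.carrier) (hV : V ≤ U) (n : ℕ) (e : Fin n → Sec B.E U)
      (_ : IsLocalBasis B.E U e) (o : Fin n → Fn D.X V),
      (∃ y, app k V y =
        ∑ i, (scalFn D.X V t * incFn R V (o i) : Fn (thicken R D.X) V) • res B.E hV (e i)) ↔
      app B₀.restrMap V (∑ i, o i • res B₀.E hV (ModSpace.pb ξ.fibre U (e i))) = 0 := by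
    intro U V hV n e he o
    have he₀ : IsLocalBasis B₀.E U fun i => ModSpace.pb ξ.fibre U (e i) :=
      ModSpace.IsCartesian.isLocalBasis ξ.isCartesian_fibre he
    refine (hk V _).trans ?_
    refine Iff.trans ?_ (ModSpace.pb_sum_eq_zero_iff B₀.isCartesian_restr hV he₀ o).symm
    have hi : ∀ i, (pullFn (D.thicken R).i V (scalFn D.X V t * incFn R V (o i)) = 0 ↔
        pullFn D.i V (o i) = 0) := by
      intro i
      rw [pullFn_scalFn_mul]
      refine ⟨fun h0 => eq_zero_of_scalFn_mul_incFn ht _ _ h0, fun h0 => ?_⟩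
      rw [h0, map_zero, mul_zero]
      rfl
    constructor
    · rintro ⟨h1, -⟩ i
      exact (hi i).1 ((ModSpace.pb_sum_eq_zero_iff B.isCartesian_restr hV he _).1 h1 i)
    · intro h1
      refine ⟨(ModSpace.pb_sum_eq_zero_iff B.isCartesian_restr hV he _).2 fun i => (hi i).2 (h1 i),
        ?_⟩
      exact (ModSpace.pb_sum_eq_zero_iff
        (ModSpace.isCartesian_pull (D.baseChange π).x B.E) hV he _).2 fun i =>
          pullFn_scalFn_mul_eq_zero π hπt V (o i)
  -- so `T`, restricted to the sections vanishing on `Y`, has the same image as `k`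
  let a : (pushforward (closedFibre R D.X)).obj (kernel B₀.restrMap) ⟶ B.E :=
    (pushforward (closedFibre R D.X)).map (kernel.ι B₀.restrMap) ≫ T
  refine nonempty_iso_of_mono a k
    (fun (U : Opens D.X.carrier) (y : Sec (kernel B₀.restrMap) U) => ?_)
    (fun (U : Opens D.X.carrier) y => ?_)
  · refine exists_app_eq_of_local _ _ fun x hx => ?_
    obtain ⟨U₁, hxU₁, n, e, he, he₀⟩ := hloc x
    let V : Opens D.X.carrier := U ⊓ U₁
    have hV : V ≤ U₁ := inf_le_right
    have hVU : V ≤ U := inf_le_left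
    obtain ⟨o, ho⟩ := (he₀ V hV).2 (res B₀.E hVU (app (kernel.ι B₀.restrMap) U y))
    obtain ⟨w, hw⟩ := (hker U₁ V hV n e he o).2 ((congrArg (app B₀.restrMap V) ho).trans (by
      rw [← app_res, app_kernel_condition]))
    refine ⟨V, hVU, ⟨hx, hxU₁⟩, w, hw.trans ((hT hV e o).symm.trans ?_)⟩
    exact (congrArg (app T V) ho).trans (app_res T hVU (app (kernel.ι B₀.restrMap) U y))
  · refine exists_app_eq_of_local _ _ fun x hx => ?_
    obtain ⟨U₁, hxU₁, n, e, he, he₀⟩ := hloc x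
    let V : Opens D.X.carrier := U ⊓ U₁
    have hV : V ≤ U₁ := inf_le_right
    have hVU : V ≤ U := inf_le_left
    have hy := app_res k hVU y
    obtain ⟨o, ho⟩ := coordinates_eq_scalFn_mul π B hσ hV he _
      ((hk V _).1 ⟨_, hy⟩).2
    obtain ⟨w, hw⟩ := exists_app_kernel_ι B₀.restrMap _
      ((hker U₁ V hV n e he o).1 ⟨_, hy.trans ho.symm⟩)
    refine ⟨V, hVU, ⟨hx, hxU₁⟩, w, ?_⟩
    exact (congrArg (app T V) hw).trans ((hT hV e o).trans ho)

end KernelOfKernelMap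

/-! ### The tensor product with an ideal sheaf -/

section IdealTensor

variable {X : CSpace}

/-- The presheaf `V ↦ J(V) ⊗ E(V)`. -/
abbrev presheafTensor (J E : Mod X) :
    PresheafOfModules.{0} (commRingPresheaf X ⋙ forget₂ CommRingCat.{0} RingCat.{0}) :=
  PresheafOfModules.Monoidal.tensorObj (R := commRingPresheaf X) J.val E.val

/-- The section `j ⊗ x` of the presheaf tensor product. -/
def tensorTmul {J E : Mod X} {V : Opens X.carrier} (j : Sec J V) (x : Sec E V) :
    (presheafTensor J E).obj (op V) :=
  TensorProduct.tmul ((commRingPresheaf X).obj (op V)) j x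

/-- The map `j ⊗ x ↦ a(j) x` from the presheaf tensor product, for `a : J → 𝒪_X`. -/
def mulPresheaf {J : Mod X} (a : J ⟶ unitMod X) (E : Mod X) : presheafTensor J E ⟶ E.val :=
  PresheafOfModules.Monoidal.tensorHom (R := commRingPresheaf X) a.val (𝟙 E.val) ≫
    (MonoidalCategoryStruct.leftUnitor
      (C := PresheafOfModules.{0} (commRingPresheaf X ⋙ forget₂ CommRingCat.{0} RingCat.{0}))
      E.val).hom

theorem mulPresheaf_tmul {J : Mod X} (a : J ⟶ unitMod X) (E : Mod X) {V : Opens X.carrier}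
    (j : Sec J V) (x : Sec E V) :
    (mulPresheaf a E).app (op V) (tensorTmul j x) = (show Fn X V from app a V j) • x := rfl

/-- The map `J ⊗ E → E` induced by `a : J → 𝒪_X`. -/
def mulHom {J : Mod X} (a : J ⟶ unitMod X) (E : Mod X) : tensor J E ⟶ E :=
  (PresheafOfModules.sheafificationHomEquiv (𝟙 (ringSheaf X).obj)).symm (mulPresheaf a E)

/-- The map from sections of the presheaf tensor product to sections of its sheafification `J ⊗ E`. -/
def tensorUnit (J E : Mod X) (V : Opens X.carrier) :
    (presheafTensor J E).obj (op V) →+ Sec (tensor J E) V :=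
  ((toSheafify (Opens.grothendieckTopology X.carrier) (presheafTensor J E).presheaf).app (op V)).hom

theorem app_mulHom_tensorUnit {J : Mod X} (a : J ⟶ unitMod X) (E : Mod X) (V : Opens X.carrier)
    (p : (presheafTensor J E).obj (op V)) :
    app (mulHom a E) V (tensorUnit J E V p) = (mulPresheaf a E).app (op V) p := by
  have h : PresheafOfModules.sheafificationHomEquiv (𝟙 (ringSheaf X).obj) (mulHom a E) =
      mulPresheaf a E := Equiv.apply_symm_apply _ _
  exact congrArg (fun g => g.app (op V) p) h

theorem exists_local_tensorUnit {J E : Mod X} {U : Opens X.carrier} (z : Sec (tensor J E) U)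
    {x : X.carrier} (hx : x ∈ U) : ∃ (V : Opens X.carrier) (h : V ≤ U), x ∈ V ∧
      ∃ p, tensorUnit J E V p = res (tensor J E) h z := by
  have h : Presheaf.IsLocallySurjective (Opens.grothendieckTopology X.carrier)
      (toSheafify (Opens.grothendieckTopology X.carrier) (presheafTensor J E).presheaf) :=
    inferInstance
  have h' := Presheaf.imageSieve_mem (Opens.grothendieckTopology X.carrier)
    (toSheafify (Opens.grothendieckTopology X.carrier) (presheafTensor J E).presheaf) (U := op U) z
  obtain ⟨V, i, ⟨p, hp⟩, hV⟩ := h' x hx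
  exact ⟨V, i.le, hV, p, hp⟩

theorem exists_eq_sum_tensorTmul {J E : Mod X} {U V : Opens X.carrier} (h : V ≤ U) {n : ℕ}
    {e : Fin n → Sec E U} (he : IsLocalBasis E U e) (p : (presheafTensor J E).obj (op V)) :
    ∃ j : Fin n → Sec J V, ∑ i, tensorTmul (j i) (res E h (e i)) = p := by
  let _ : Module ((commRingPresheaf X).obj (op V)) (Sec J V) :=
    inferInstanceAs (Module (Fn X V) (Sec J V))
  let _ : Module ((commRingPresheaf X).obj (op V)) (Sec E V) :=
    inferInstanceAs (Module (Fn X V) (Sec E V))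
  have key : ∀ q : TensorProduct ((commRingPresheaf X).obj (op V)) (Sec J V) (Sec E V),
      ∃ j : Fin n → Sec J V, (∑ i, TensorProduct.tmul ((commRingPresheaf X).obj (op V)) (j i)
        (res E h (e i))) = q := by
    intro q
    induction q using TensorProduct.induction_on with
    | zero => exact ⟨0, by simp⟩
    | tmul j x =>
      obtain ⟨c, hc⟩ := (he V h).2 x
      refine ⟨fun i => c i • j, ?_⟩
      simp only at hc
      rw [← hc, TensorProduct.tmul_sum]
      refine Finset.sum_congr rfl fun i _ => ?_
      exact TensorProduct.smul_tmul (show (commRingPresheaf X).obj (op V) from c i) j (res E h (e i))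
    | add q q' hq hq' =>
      obtain ⟨j, rfl⟩ := hq
      obtain ⟨j', rfl⟩ := hq'
      refine ⟨fun i => j i + j' i, ?_⟩
      simp only [TensorProduct.add_tmul, Finset.sum_add_distrib]
  exact key p

theorem app_mulHom_sum {J : Mod X} (a : J ⟶ unitMod X) (E : Mod X) {V : Opens X.carrier} {n : ℕ}
    (j : Fin n → Sec J V) (x : Fin n → Sec E V) :
    app (mulHom a E) V (tensorUnit J E V (∑ i, tensorTmul (j i) (x i))) =
      ∑ i, (show Fn X V from app a V (j i)) • x i := by
  rw [app_mulHom_tensorUnit]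
  refine (map_sum ((mulPresheaf a E).app (op V)).hom _ _).trans ?_
  exact Finset.sum_congr rfl fun i _ => mulPresheaf_tmul a E (j i) (x i)

theorem exists_local_sum_tensorTmul {J E : Mod X} (hE : IsLocallyFree E) {U : Opens X.carrier}
    (z : Sec (tensor J E) U) {x : X.carrier} (hx : x ∈ U) :
    ∃ (U₁ : Opens X.carrier) (n : ℕ) (e : Fin n → Sec E U₁), IsLocalBasis E U₁ e ∧
      ∃ (V : Opens X.carrier) (h : V ≤ U) (h₁ : V ≤ U₁), x ∈ V ∧ ∃ j : Fin n → Sec J V,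
        tensorUnit J E V (∑ i, tensorTmul (j i) (res E h₁ (e i))) = res (tensor J E) h z := by
  obtain ⟨U₁, hxU₁, n, e, he⟩ := hE x
  obtain ⟨V, hV, hxV, p, hp⟩ := exists_local_tensorUnit
    (res (tensor J E) (inf_le_left : U ⊓ U₁ ≤ U) z) (x := x) ⟨hx, hxU₁⟩
  obtain ⟨j, hj⟩ := exists_eq_sum_tensorTmul (hV.trans inf_le_right) he p
  refine ⟨U₁, n, e, he, V, hV.trans inf_le_left, hV.trans inf_le_right, hxV, j, ?_⟩
  rw [hj, hp, res_res]

/-- For an ideal sheaf `J` and a locally free sheaf `E`, the map `J ⊗ E → E` is injective. -/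
theorem mono_mulHom {J : Mod X} (a : J ⟶ unitMod X) [Mono a] {E : Mod X} (hE : IsLocallyFree E) :
    Mono (mulHom a E) := by
  refine mono_of_injective_app _ fun U => ?_
  rw [injective_iff_map_eq_zero]
  intro z hz
  refine sec_ext fun x hx => ?_
  obtain ⟨U₁, n, e, he, V, h, h₁, hxV, j, hj⟩ := exists_local_sum_tensorTmul hE z hx
  refine ⟨V, h, hxV, ?_⟩
  have h0 := app_mulHom_sum a E j fun i => res E h₁ (e i)
  rw [hj, app_res, hz, res_zero] at h0
  have h2 : ∀ i, j i = 0 := fun i => injective_app_of_mono a V ((congrFun ((he V h₁).1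
    (a₁ := fun i => (show Fn X V from app a V (j i))) (a₂ := 0) (by
      refine h0.symm.trans ?_
      simp)) i).trans (map_zero (app a V)).symm)
  rw [res_zero, ← hj]
  have h3 : ∀ i, tensorTmul (j i) (res E h₁ (e i)) = 0 := fun i => by
    rw [h2 i]
    exact TensorProduct.zero_tmul _ _
  simp only [h3, Finset.sum_const_zero, map_zero]

end IdealTensor

/-! ### Vanishing of the obstruction space -/

section FramedKernel

variable {D : FramingData} (B : FramedBundle D)

theorem app_idealSheaf_ι {X Y : CSpace} (i : Y ⟶ X) {V : Opens X.carrier}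
    (j : Sec (idealSheaf i) V) : pullFn i V (show Fn X V from
      app (kernel.ι (SheafOfModules.unitToPushforwardObjUnit (ringHom i))) V j) = 0 :=
  app_kernel_condition (SheafOfModules.unitToPushforwardObjUnit (ringHom i)) j

/-- The kernel of `E → i_* W` for a framed vector bundle is `J ⊗ E`, where `J` is the ideal sheaf. -/
theorem nonempty_tensor_idealSheaf_iso :
    Nonempty (tensor (idealSheaf D.i) B.E ≅ kernel B.restrMap) := by
  let a : idealSheaf D.i ⟶ unitMod D.X :=
    kernel.ι (SheafOfModules.unitToPushforwardObjUnit (ringHom D.i))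
  have : Mono a := inferInstanceAs (Mono (kernel.ι _))
  have := mono_mulHom a B.locallyFree
  refine nonempty_iso_of_mono (mulHom a B.E) (kernel.ι B.restrMap) (fun U z => ?_) (fun U z => ?_)
  · refine exists_app_kernel_ι _ _ (sec_ext fun x hx => ?_)
    obtain ⟨U₁, n, e, he, V, h, h₁, hxV, j, hj⟩ := exists_local_sum_tensorTmul B.locallyFree z hx
    refine ⟨V, h, hxV, ?_⟩
    have h0 := app_mulHom_sum a B.E j fun i => res B.E h₁ (e i)
    rw [hj, app_res] at h0
    rw [res_zero, ← app_res, h0]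
    exact (ModSpace.pb_sum_eq_zero_iff B.isCartesian_restr h₁ he _).2 fun i => app_idealSheaf_ι _ (j i)
  · refine exists_app_eq_of_local _ _ fun x hx => ?_
    obtain ⟨U₁, hxU₁, n, e, he⟩ := B.locallyFree x
    have hV : U ⊓ U₁ ≤ U₁ := inf_le_right
    have hVU : U ⊓ U₁ ≤ U := inf_le_left
    obtain ⟨c, hc⟩ := (he _ hV).2 (res B.E hVU (app (kernel.ι B.restrMap) U z))
    have hc0 := (ModSpace.pb_sum_eq_zero_iff B.isCartesian_restr hV he c).1
      ((congrArg (app B.restrMap (U ⊓ U₁)) hc).trans (by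
        rw [← app_res, app_kernel_condition]
        rfl))
    choose j hj using fun i => exists_app_kernel_ι
      (SheafOfModules.unitToPushforwardObjUnit (ringHom D.i)) (c i) (hc0 i)
    refine ⟨U ⊓ U₁, hVU, ⟨hx, hxU₁⟩, tensorUnit _ _ _ (∑ i, tensorTmul (j i) (res B.E hV (e i))), ?_⟩
    refine (app_mulHom_sum a B.E j _).trans (Eq.trans ?_ hc)
    exact Finset.sum_congr rfl fun i _ => congrArg (fun r : Fn D.X (U ⊓ U₁) => r • res B.E hV (e i))
      (hj i)

variable {R R' : Type} [CommRing R] [Algebra ℂ R] [Module.Finite ℂ R] [IsLocalRing R] [CommRing R']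
  [Algebra ℂ R'] [Module.Finite ℂ R']

/-- For a small extension `R → R'`, the group `Ext²(E, N)` containing the obstruction to lifting
first-order deformations from `Spec R'` to `Spec R` vanishes if `Ext²(E₀, J ⊗ E₀)` does. Here `N` is the
kernel of the restriction from `ker (E → i_* W)` to `Spec R'`. -/
theorem subsingleton_ext_two_kernel_kernelMap {B₀ : FramedBundle D}
    (hExt : Subsingleton (Abelian.Ext B₀.E (tensor (idealSheaf D.i) B₀.E) 2))
    (π : R →ₐ[ℂ] R') (hπ : Function.Surjective π) (t : R) (hker : RingHom.ker π = Ideal.span {t})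
    (ht : ∀ a ∈ IsLocalRing.maximalIdeal R, t * a = 0) (ξ : Deformation R B₀)
    (μ : kernel ξ.fam.restrMap ⟶ (pushforward (D.baseChange π).x).obj
      (kernel (ξ.fam.pull (D.baseChange π)).restrMap))
    (hμ : μ ≫ (pushforward (D.baseChange π).x).map
        (kernel.ι (ξ.fam.pull (D.baseChange π)).restrMap) =
      kernel.ι ξ.fam.restrMap ≫ ξ.fam.pullUnit (D.baseChange π)) :
    Subsingleton (Abelian.Ext ξ.fam.E (kernel μ) 2) := by
  obtain ⟨ht', σ, ℓ, -, hσ⟩ := exists_linear_splitting π hπ t hker ht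
  have hk := exists_app_kernel_comp_iff hμ
  by_cases h0 : t = 0
  -- for `t = 0` the restriction is an isomorphism
  · subst h0
    exact subsingleton_ext_of_isZero (isZero_kernel_kernelMap π ξ.fam hk hσ) 2
  · have hπt : π t = 0 := by
      rw [← RingHom.mem_ker, hker]
      exact Ideal.mem_span_singleton_self t
    have he := nonempty_kernel_kernelMap_iso (K := kernel μ)
      (k := kernel.ι μ ≫ kernel.ι ξ.fam.restrMap) π ξ ht' h0 hπt hσ hk
    have he₀ := nonempty_tensor_idealSheaf_iso B₀
    obtain ⟨e⟩ := he
    obtain ⟨e₀⟩ := he₀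
    exact subsingleton_ext_of_iso e (subsingleton_ext_two_closedFibre ξ.fam.locallyFree
      (subsingleton_ext_of_iso_left ξ.ψ.symm (subsingleton_ext_of_iso e₀ hExt)))

end FramedKernel

end FramedDef

end

theorem proposition1p3 (D : FramedDef.FramingData)
    (hX : FramedDef.IsAnalyticSpace D.X) (hY : FramedDef.IsAnalyticSpace D.Y)
    (hi : FramedDef.IsClosedImmersion D.i) (hW : FramedDef.IsLocallyFree D.W)
    (B₀ : FramedDef.FramedBundle D)
    (hExt : Subsingleton
      (CategoryTheory.Abelian.Ext B₀.E (FramedDef.tensor (FramedDef.idealSheaf D.i) B₀.E) 2))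
    (R R' : Type) [CommRing R] [Algebra ℂ R] [Module.Finite ℂ R] [IsLocalRing R]
    [CommRing R'] [Algebra ℂ R'] [Module.Finite ℂ R'] [IsLocalRing R']
    (π : R →ₐ[ℂ] R') (hπ : Function.Surjective π) (t : R)
    (hker : RingHom.ker π = Ideal.span {t}) (ht : ∀ a ∈ IsLocalRing.maximalIdeal R, t * a = 0)
    (ξ : FramedDef.Deformation R B₀) :
    Function.Surjective (FramedDef.tangentMap π ξ.fam) := by
  have hi' := hi.hasLocalLifts
  let κ := D.baseChange π
  refine Quotient.ind fun η => ?_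
  have hWR : FramedDef.IsLocallyFree (D.thicken R).W :=
    FramedDef.isLocallyFree_of_isCartesian _ (D.isCartesian_proj R) hW
  have hWR' : FramedDef.IsLocallyFree (D.thicken R').W :=
    FramedDef.isLocallyFree_of_isCartesian _ (D.isCartesian_proj R') hW
  -- sections of `W` on `Spec R' × Y` lift locally to the bundle on `Spec R' × X`
  have : Epi (ξ.fam.pull κ).restrMap := FramedDef.ModSpace.epi_map_of_isCartesian
    (ξ.fam.pull κ).isCartesian_restr (ξ.fam.pull κ).locallyFree (hi'.thickenMap (A := R'))
  obtain ⟨μ, hμ⟩ := FramedDef.exists_kernelMap κ ξ.fam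
  have : Epi μ := FramedDef.epi_kernelMap π ξ.fam hπ μ hμ
  have hExt' := FramedDef.subsingleton_ext_two_kernel_kernelMap hExt π hπ t hker ht ξ μ hμ
  obtain ⟨ζ, hζ⟩ := FramedDef.exists_deformation_of_pull κ ξ.fam
    (FramedDef.isHomeomorph_thickenMap_id π D.X) hWR hWR' μ hμ hExt' η
  exact ⟨Quotient.mk _ ζ, Quotient.sound hζ⟩
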